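/- Let $C$ be a smooth projective geometrically irreducible curve over a finite field $\mathbb F_q$, $\infty$ a closed point of $C$, $A=H^0(C\setminus\{\infty\},\mathcal O_C)$, $K=\mathrm{Frac}(A)$, and let $\mathbb C_\infty$ be the completion of an algebraic closure of $K$ at a place above $\infty$. Let $K\subseteq L\subseteq\mathbb C_\infty$ be an intermediate field. An Anderson $A$-module $E=(\mathbb G_{a,L}^d,\phi)$ of generic characteristic over $L$ is given by a ring homomorphism $\phi\colon A\to\mathrm{End}(\mathbb G_{a,L}^d)$ into the $L$-endomorphisms of the $\mathbb F_q$-vector space scheme $\mathbb G_{a,L}^d$ such that $d\phi_a-a$ is nilpotent on $\mathrm{Lie}\,E$ for all $a\in A$; it is called uniformizable if its exponential map $\mathrm{Lie}\,E\to E(\mathbb C_\infty)$ is surjective. Let $B$ be an $\mathbb F_q$-basis of $A$. The $A$-module of special functions $\mathfrak{sf}(E)$ consists of the elements $h=\sum_{b\in B}b\otimes e_b$ with $e_b\in E(\mathbb C_\infty)$ and $e_b\to0$ (that is, elements of the completion of $A\otimes_{\mathbb F_q}E(\mathbb C_\infty)$) such that $\phi_a(h)=a\cdot h$ for all $a\in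 A$, where $\phi_a$ acts on the right and $a$ multiplies on the left tensor factor. Let $\mathfrak p$ be a nonzero prime ideal of $A$, $A_{\mathfrak p}$ the $\mathfrak p$-adic completion of $A$, $K_{\mathfrak p}$ its fraction field, $\mathbb F_{\mathfrak p}=A/\mathfrak p$, regarded as a subfield of $A_{\mathfrak p}$, $\hat\Omega_{A_{\mathfrak p}/\mathbb F_{\mathfrak p}}$ the module of continuous differentials, $\mathrm{tr}\colon\mathbb F_{\mathfrak p}\to\mathbb F_q$ the trace, and $T_{\mathfrak p}(E)=\mathrm{Hom}_A(K_{\mathfrak p}/A_{\mathfrak p},E(\mathbb C_\infty))$ the $\mathfrak p$-adic Tate module. Then for all Anderson $A$-modules $E$ of generic characteristic over $L$ there are homomorphisms of $A_{\mathfrak p}$-modules $$j_E\colon\ \hat\Omega_{A_{\mathfrak p}/\mathbb F_{\mathfrak p}}\otimes_A\mathfrak{sf}(E)\longrightarrow T_{\mathfrak p}(E),\qquad j_E\Bigl(\omega\otimes\sum_{b\in B}b\otimes e_b\Bigr)(x)=\sum_{b\in B}\mathrm{tr}\bigl(\mathrm{res}_{\mathfrak p}(x\,b\,\omega)\bigr)\,e_b,$$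 which are compatible with morphisms of Anderson $A$-modules over $L$, such that for every $E$: 1. $j_E$ is injective, and its image is a direct summand of the $A_{\mathfrak p}$-module $T_{\mathfrak p}(E)$. 2. If $E$ is uniformizable, then $j_E$ is an isomorphism. In that case $\mathfrak{sf}(E)$ is a finitely generated $A$-module, and for every nonzero prime $\mathfrak q$ of $A$ the torsion $E[\mathfrak q]$ is finite-dimensional over $A/\mathfrak q$ and $\mathrm{rk}_A\,\mathfrak{sf}(E)=\dim_{A/\mathfrak q}E[\mathfrak q]$, the $\mathfrak q$-rank of $E$. In particular the $\mathfrak q$-rank of a uniformizable $E$ does not depend on $\mathfrak q$. -/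

import Mathlib

open Filter Topology IsDedekindDomain
open scoped TensorProduct Polynomial

noncomputable section

/-! ### The coefficient ring `A` and the field `C_∞` -/

/-- `A` is the ring of functions regular away from the closed point `∞` on a smooth projective
geometrically irreducible curve over the finite field `Fq`, with function field `K = Frac A`.
The closed points of the curve are the nontrivial valuation rings of `K` (they contain `Fq`
automatically, since `Fq` is finite), and `Oinf` is the local ring at `∞`. Geometric irreducibility
means that `Fq` is algebraically closed in `K`. Smoothness and dimension one are contained in
`IsDedekindDomain A` and `not_isField`. -/
structure IsPuncturedCurve (Fq A K : Type*) [Field Fq] [CommRing A] [IsDedekindDomain A]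
    [Field K] [Algebra Fq A] [Algebra A K] [Algebra Fq K] [IsScalarTower Fq A K]
    [IsFractionRing A K] (Oinf : ValuationSubring K) : Prop where
  finiteType : Algebra.FiniteType Fq A
  not_isField : ¬ IsField A
  constants : ∀ x : K, IsAlgebraic Fq x → x ∈ (algebraMap Fq K).range
  inf_ne_top : Oinf ≠ ⊤
  mem_iff : ∀ x : K, x ∈ (algebraMap A K).range ↔
    ∀ V : ValuationSubring K, V ≠ ⊤ → V ≠ Oinf → x ∈ V

/-- The normed field `C` is the completion of an algebraic closure of `K` at a place above the
place of `K` with valuation ring `Oinf`: the elements of `C` that are algebraic over `K` form an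
algebraic closure of `K`, this subfield is dense in the complete field `C`, and the
nonarchimedean norm of `C` has `Oinf` as its closed unit ball on `K`. -/
structure IsCompletedAlgClosure (K C : Type*) [Field K] [NormedField C] [Algebra K C]
    (Oinf : ValuationSubring K) : Prop where
  complete : CompleteSpace C
  ultrametric : IsUltrametricDist C
  isAlgClosed : IsAlgClosed (algebraicClosure K C)
  dense : Dense (algebraicClosure K C : Set C)
  norm_le_one_iff : ∀ x : K, ‖algebraMap K C x‖ ≤ 1 ↔ x ∈ Oinf

/-! ### Anderson modules -/

/-- The map `x ↦ ∑ₖ Mₖ x^(q^k)` on points given by the matrix `∑ₖ Mₖ τ^k` of twisted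
polynomials with coefficients in `L`. -/
def twistedEval {K C : Type*} [Field K] [Field C] [Algebra K C] {L : IntermediateField K C}
    {m n : ℕ} (q : ℕ) (M : ℕ →₀ Matrix (Fin m) (Fin n) L) (x : Fin n → C) : Fin m → C :=
  M.sum fun k Mk => (Mk.map (algebraMap L C)).mulVec fun i => x i ^ q ^ k

theorem continuous_twistedEval {K C : Type*} [Field K] [NormedField C] [Algebra K C]
    {L : IntermediateField K C} {m n : ℕ} (q : ℕ) (M : ℕ →₀ Matrix (Fin m) (Fin n) L) :
    Continuous (twistedEval (C := C) q M) := by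
  unfold twistedEval Finsupp.sum
  refine continuous_finsetSum _ fun k _ => ?_
  refine Continuous.matrix_mulVec continuous_const ?_
  fun_prop

/-- An Anderson `A`-module of generic characteristic over `L`, in coordinates: the group scheme
is `G_a^dim` over `L`, and `φ` is a ring homomorphism from `A` to the endomorphisms of the
`Fq`-vector space scheme `G_a^dim`. Since `C` is infinite, such an endomorphism is the same as
an `Fq`-linear map on `C`-points that is given by a matrix of twisted polynomials over `L`; its
differential is the coefficient of `τ^0`. -/
structure AndersonModule (Fq A : Type*) {K C : Type*} [Field Fq] [CommRing A] [Field K]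
    [NormedField C] [Algebra A K] [Algebra K C] [Algebra Fq C] (L : IntermediateField K C) where
  /-- the dimension -/
  dim : ℕ
  /-- the action of `A` on `C`-points -/
  φ : A →+* Module.End Fq (Fin dim → C)
  /-- the coefficients of `φ a` as a matrix of twisted polynomials -/
  coeff : A → ℕ →₀ Matrix (Fin dim) (Fin dim) L
  φ_apply : ∀ a x, φ a x = twistedEval (Nat.card Fq) (coeff a) x
  isNilpotent : ∀ a, IsNilpotent
    (coeff a 0 - Matrix.scalar (Fin dim) (algebraMap K L (algebraMap A K a)))

namespace AndersonModule

section Basic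

variable {Fq A K C : Type*} [Field Fq] [CommRing A] [Field K]
  [NormedField C] [Algebra A K] [Algebra K C] [Algebra Fq C] {L : IntermediateField K C}

/-- The points `E(C)`, as an `Fq`-vector space and with the `A`-action through `φ`. -/
def Points (E : AndersonModule Fq A L) : Type _ := Fin E.dim → C

instance (E : AndersonModule Fq A L) : NormedAddCommGroup E.Points :=
  inferInstanceAs (NormedAddCommGroup (Fin E.dim → C))

instance (E : AndersonModule Fq A L) : Module Fq E.Points :=
  inferInstanceAs (Module Fq (Fin E.dim → C))

instance (E : AndersonModule Fq A L) : Module (Module.End Fq (Fin E.dim → C)) E.Points :=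
  inferInstanceAs (Module (Module.End Fq (Fin E.dim → C)) (Fin E.dim → C))

instance (E : AndersonModule Fq A L) : Module A E.Points :=
  Module.compHom _ E.φ

theorem smul_eq (E : AndersonModule Fq A L) (a : A) (x : E.Points) :
    a • x = (E.φ a : (Fin E.dim → C) →ₗ[Fq] (Fin E.dim → C)) x := rfl

theorem continuous_smul (E : AndersonModule Fq A L) (a : A) :
    Continuous fun x : E.Points => a • x := by
  have h : (fun x : E.Points => a • x) = twistedEval (Nat.card Fq) (E.coeff a) :=
    funext fun x => E.φ_apply a x
  rw [h]
  exact continuous_twistedEval _ _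

instance (E : AndersonModule Fq A L) : SMulCommClass A Fq E.Points :=
  ⟨fun a c x => (E.φ a).map_smul c x⟩

/-- A morphism of Anderson modules over `L`: a morphism of `Fq`-vector space schemes over `L`
that commutes with the two actions of `A`. -/
structure Hom (E E' : AndersonModule Fq A L) where
  /-- the map on `C`-points -/
  toLinearMap : E.Points →ₗ[Fq] E'.Points
  map_smul : ∀ (a : A) (x : E.Points), toLinearMap (a • x) = a • toLinearMap x
  isAlgebraic : ∃ M : ℕ →₀ Matrix (Fin E'.dim) (Fin E.dim) L,
    ∀ x : Fin E.dim → C, toLinearMap x = twistedEval (Nat.card Fq) M x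

theorem Hom.continuous {E E' : AndersonModule Fq A L} (f : Hom E E') :
    Continuous f.toLinearMap := by
  obtain ⟨M, hM⟩ := f.isAlgebraic
  have h : (f.toLinearMap : E.Points → E'.Points) = twistedEval (Nat.card Fq) M :=
    funext fun x => hM x
  rw [h]
  exact continuous_twistedEval _ _

/-- `E` is uniformizable: its exponential map `Lie E = C^dim → E(C)` is surjective. The
exponential map is the unique entire `Fq`-linear power series `x ↦ ∑ₙ eₙ x^(q^n)` with `e₀ = 1`
and `φ_a (exp x) = exp (dφ_a x)` for all `a`. -/
def IsUniformizable (E : AndersonModule Fq A L) : Prop :=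
  ∃ (e : ℕ → Matrix (Fin E.dim) (Fin E.dim) C) (exp : (Fin E.dim → C) → Fin E.dim → C),
    e 0 = 1 ∧
    (∀ x, HasSum (fun n => (e n).mulVec fun i => x i ^ Nat.card Fq ^ n) (exp x)) ∧
    (∀ a x, E.φ a (exp x) = exp (((E.coeff a 0).map (algebraMap L C)).mulVec x)) ∧
    Function.Surjective exp

/-- The `𝔭`-torsion `E[𝔭]`. -/
def torsion (E : AndersonModule Fq A L) (I : Ideal A) : Submodule A E.Points :=
  Submodule.torsionBySet A E.Points I

instance (E : AndersonModule Fq A L) (I : Ideal A) : Module (A ⧸ I) (E.torsion I) :=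
  inferInstanceAs (Module (A ⧸ I) (Submodule.torsionBySet A E.Points I))

/-- The `𝔭`-rank of `E`, i.e. the dimension of `E[𝔭]` over `A ⧸ 𝔭`. -/
def rankAt (E : AndersonModule Fq A L) (v : HeightOneSpectrum A) : ℕ :=
  Module.finrank (A ⧸ v.asIdeal) (E.torsion v.asIdeal)

end Basic

/-! ### Special functions -/

section SpecialFunctions

variable {Fq A K C : Type*} [Field Fq] [CommRing A] [Field K] [NormedField C]
  [Algebra Fq A] [Algebra A K] [Algebra K C] [Algebra Fq C] {L : IntermediateField K C}
  {ι : Type*}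

/-- Given a basis `b` of `A` over `Fq`, a family `h` stands for the series `∑ᵢ bᵢ ⊗ hᵢ`. The
relation says that `h' = a · h` for the multiplication by `a` on the left tensor factor. -/
def IsLeftMul (E : AndersonModule Fq A L) (b : Module.Basis ι Fq A) (a : A)
    (h h' : ι → E.Points) : Prop :=
  ∀ j, HasSum (fun i => b.repr (a * b i) j • h i) (h' j)

/-- The special functions `sf(E)`: the elements `h = ∑ᵢ bᵢ ⊗ hᵢ` with `hᵢ → 0` (i.e. the elements
of `E(𝕋)`, the completion of `A ⊗ E(C)`) such that `φ_a(h) = a · h` for all `a`. Here `A` acts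
on the series through `φ` on all `hᵢ`. The basis `b` serves only to write down the elements. -/
def sf (E : AndersonModule Fq A L) (b : Module.Basis ι Fq A) : Submodule A (ι → E.Points) where
  carrier := {h | Tendsto h cofinite (𝓝 0) ∧ ∀ a : A, E.IsLeftMul b a h (a • h)}
  zero_mem' := by
    refine ⟨tendsto_const_nhds, fun a j => ?_⟩
    simp
  add_mem' := by
    rintro h h' ⟨h1, h2⟩ ⟨h1', h2'⟩
    refine ⟨by simpa [Pi.add_def] using h1.add h1', fun a j => ?_⟩
    have := (h2 a j).add (h2' a j)
    simpa [smul_add] using this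
  smul_mem' := by
    rintro c h ⟨h1, h2⟩
    refine ⟨?_, fun a j => ?_⟩
    · have := ((E.continuous_smul c).tendsto 0).comp h1
      simpa [Function.comp_def, Pi.smul_def] using this
    · have := (h2 a j).map (DistribSMul.toAddMonoidHom E.Points c) (E.continuous_smul c)
      simp only [Function.comp_def, DistribSMul.toAddMonoidHom_apply, Pi.smul_apply] at this ⊢
      simp only [smul_comm c] at this
      exact this

/-- The map on special functions induced by a morphism of Anderson modules. -/
def Hom.sfMap {E E' : AndersonModule Fq A L} (f : Hom E E') (b : Module.Basis ι Fq A)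
    (h : E.sf b) : E'.sf b :=
  ⟨fun i => f.toLinearMap (h.1 i), by
    refine ⟨?_, fun a j => ?_⟩
    · have := (f.continuous.tendsto 0).comp h.2.1
      simpa [Function.comp_def] using this
    · have := (h.2.2 a j).map f.toLinearMap.toAddMonoidHom f.continuous
      simpa [Function.comp_def, f.map_smul] using this⟩

end SpecialFunctions

end AndersonModule

/-! ### Local objects at a prime -/

section Local

variable (Fq : Type*) {A : Type*} (K : Type*) [Field Fq] [CommRing A] [IsDedekindDomain A]
  [Field K] [Algebra Fq A] [Algebra A K] [IsFractionRing A K] (v : HeightOneSpectrum A)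

/-- The structure map `Fq → A → A_𝔭`. -/
def constantsMap : Fq →+* v.adicCompletionIntegers K :=
  (algebraMap A (v.adicCompletionIntegers K)).comp (algebraMap Fq A)

/-- The copy of the residue field `F_𝔭` inside `A_𝔭` (the image of the unique `Fq`-algebra
section of `A_𝔭 → F_𝔭`), consisting of the elements that are algebraic over `Fq`. -/
def residueSubfield : Subring (v.adicCompletionIntegers K) where
  carrier := {x | (constantsMap Fq K v).IsIntegralElem x}
  zero_mem' := (constantsMap Fq K v).isIntegralElem_zero
  one_mem' := (constantsMap Fq K v).isIntegralElem_one
  add_mem' := fun hx hy => RingHom.IsIntegralElem.add _ hx hy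
  mul_mem' := fun hx hy => RingHom.IsIntegralElem.mul _ hx hy
  neg_mem' := fun hx => RingHom.IsIntegralElem.neg _ hx

instance : Algebra Fq (residueSubfield Fq K v) :=
  ((constantsMap Fq K v).codRestrict (residueSubfield Fq K v)
    fun _ => (constantsMap Fq K v).isIntegralElem_map).toAlgebra

/-- The continuous differentials of `A_𝔭` over `F_𝔭`: the adic completion of the module of
Kähler differentials. -/
abbrev ContDifferentials : Type _ :=
  AdicCompletion (IsLocalRing.maximalIdeal (v.adicCompletionIntegers K))
    (Ω[v.adicCompletionIntegers K⁄residueSubfield Fq K v])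

/-- The universal derivation, with values in the continuous differentials. -/
def contD (x : v.adicCompletionIntegers K) : ContDifferentials Fq K v :=
  AdicCompletion.of _ _ (KaehlerDifferential.D (residueSubfield Fq K v) _ x)

/-- `c ∈ F_𝔭` is the residue of the meromorphic differential `y ω`, computed by means of some
uniformizer `ϖ`: if `ω = g dϖ`, then `y g` is, up to an element of `A_𝔭`, a polynomial in `ϖ⁻¹`
over `F_𝔭`, and `c` is its coefficient at `ϖ⁻¹`. -/
def IsResidue (y : v.adicCompletion K) (ω : ContDifferentials Fq K v)
    (c : residueSubfield Fq K v) : Prop :=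
  ∃ ϖ g : v.adicCompletionIntegers K,
    IsLocalRing.maximalIdeal (v.adicCompletionIntegers K) = Ideal.span {ϖ} ∧
    ω = g • contD Fq K v ϖ ∧
    ∃ (P : (residueSubfield Fq K v)[X]) (r : v.adicCompletionIntegers K),
      y * (g : v.adicCompletion K) =
        (r : v.adicCompletion K) + Polynomial.aeval (ϖ : v.adicCompletion K)⁻¹ P ∧
      c = P.coeff 1

open scoped Classical in
/-- The residue `res_𝔭 (y ω) ∈ F_𝔭`; it exists and does not depend on the uniformizer. -/
def residue (y : v.adicCompletion K) (ω : ContDifferentials Fq K v) : residueSubfield Fq K v :=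
  if h : ∃ c, IsResidue Fq K v y ω c then h.choose else 0

/-- The `A_𝔭`-module `K_𝔭 / A_𝔭`. -/
abbrev LocalQuotient : Type _ :=
  v.adicCompletion K ⧸
    LinearMap.range (Algebra.linearMap (v.adicCompletionIntegers K) (v.adicCompletion K))

end Local

namespace AndersonModule

section Tate

variable {Fq A K C : Type*} [Field Fq] [CommRing A] [IsDedekindDomain A] [Field K]
  [NormedField C] [Algebra A K] [IsFractionRing A K] [Algebra K C] [Algebra Fq C]
  {L : IntermediateField K C}

/-- The `𝔭`-adic Tate module `T_𝔭(E) = Hom_A(K_𝔭 / A_𝔭, E(C))`. -/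
def TateModule (E : AndersonModule Fq A L) (v : HeightOneSpectrum A) : Type _ :=
  LocalQuotient K v →ₗ[A] E.Points

instance (E : AndersonModule Fq A L) (v : HeightOneSpectrum A) :
    AddCommGroup (E.TateModule v) :=
  inferInstanceAs (AddCommGroup (LocalQuotient K v →ₗ[A] E.Points))

instance (E : AndersonModule Fq A L) (v : HeightOneSpectrum A) :
    FunLike (E.TateModule v) (LocalQuotient K v) E.Points :=
  inferInstanceAs (FunLike (LocalQuotient K v →ₗ[A] E.Points) _ _)

/-- `A_𝔭` acts on `T_𝔭(E)` by `(α f)(x) = f(α x)`. -/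
instance (E : AndersonModule Fq A L) (v : HeightOneSpectrum A) :
    Module (v.adicCompletionIntegers K) (E.TateModule v) where
  smul α f := LinearMap.comp (M₂ := LocalQuotient K v) f
    (DistribSMul.toLinearMap A (LocalQuotient K v) α)
  one_smul f := LinearMap.ext fun x => congrArg f (one_smul _ x)
  mul_smul α β f := LinearMap.ext fun x => congrArg f (by
    show (α * β) • x = β • α • x
    rw [mul_comm, mul_smul])
  smul_zero α := rfl
  smul_add α f g := rfl
  add_smul α β f := LinearMap.ext fun x => by
    show f ((α + β) • x) = f (α • x) + f (β • x)
    rw [add_smul]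
    exact LinearMap.map_add (M := LocalQuotient K v) f _ _
  zero_smul f := LinearMap.ext fun x => by
    show f ((0 : v.adicCompletionIntegers K) • x) = 0
    rw [zero_smul]
    exact LinearMap.map_zero (M := LocalQuotient K v) f

end Tate

end AndersonModule

end

/-! Let `A^*` be the `Fq`-dual of `A` with the topology of pointwise convergence. A series `∑ bᵢ ⊗
hᵢ` with `hᵢ → 0` is the same thing as a continuous `Fq`-linear map `f : A^* → E(C)`, `l ↦ ∑ l(bᵢ)
hᵢ`, and the equations `φ_a(h) = a · h` say that `f(l(a ·)) = a • f(l)`. So `sf(E)` is the module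
`dualHom` of continuous `A`-linear maps `A^* → E(C)` (`sfEquiv`).

Fix `a ∈ A` of valuation one at `𝔭`, and write `ω = g da`. The trace of the residue gives an
`A`-linear map `Λ : K_𝔭 → A^*` that vanishes on `A_𝔭`, and the multiples of `l₀ = Λ(1/a)` are
exactly the functionals killing `𝔭` (`exists_residue_pairing`, `apply_inv_eq_zero_of_mem`). In these
terms `j_E(ω ⊗ h)(y) = f(Λ(y g))`.

The behaviour of `j_E` is decided modulo `𝔭`. Evaluation at `1/a` embeds `T/aT` into `E[𝔭]`, and
evaluation at `l₀` embeds `sf/𝔭 sf` into `E[𝔭]`, since a special function killing all functionals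
that kill `𝔭` lies in `𝔭 sf` (`mem_smul_top_of_forall_eq_zero`). Hence `j_E` is injective modulo the
maximal ideal (`exists_eq_smul_of_tateMap_eq_smul`). The Tate module is torsion-free, and it is
finitely generated because `E[a]` is finite. Once `sf(E)` is finitely generated too, Nakayama's
lemma gives injectivity of `j_E`; the cokernel is torsion-free over a discrete valuation ring, hence
free, so the image splits off.

Finite generation (`finite_dualHom`) is a descent. An element `t` with a pole at `∞` expands a
neighbourhood of the origin, so a small ball contains no nonzero `A`-submodule of `E(C)`. Filtering
special functions by the norm ball of `A` that controls their size, division by `t` lowers the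
filtration, the bottom step is zero, and `sf/t sf` is finite.

If `E` is uniformizable, the exponential map provides sequences of `a`-division points tending to
`0` above any point. The module `Hom_{Fq[a]}(A, Fq[a])` is projective over `A`, so such sequences
can be chosen `A`-linearly. This makes every point of `E[𝔭]` a value `f(l₀)`
(`IsUniformizable.exists_dualHom_apply_eq`). Therefore `sf/𝔭 sf ≅ E[𝔭]`, which yields both the rank
formula at every prime and the surjectivity of `j_E` by Nakayama's lemma. -/

namespace PowerSeries

/-! ### Power series evaluated in an adically complete ring -/

section AdicEval

variable {k R : Type*} [CommRing k] [CommRing R] [Algebra k R] (ϖ : R)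

/-- Truncation only discards multiples of `X ^ n`, and these evaluate to multiples of `ϖ ^ n`. -/
theorem mk_aeval_trunc_coe (n : ℕ) (p : k[X]) :
    Ideal.Quotient.mk (Ideal.span {ϖ} ^ n) (Polynomial.aeval ϖ (trunc n (p : k⟦X⟧))) =
      Ideal.Quotient.mk (Ideal.span {ϖ} ^ n) (Polynomial.aeval ϖ p) := by
  rw [Ideal.Quotient.eq, ← map_sub, Ideal.span_singleton_pow, Ideal.mem_span_singleton]
  have h : (Polynomial.X : k[X]) ^ n ∣ trunc n (p : k⟦X⟧) - p := by
    rw [Polynomial.X_pow_dvd_iff]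
    intro d hd
    simp [coeff_trunc, hd]
  simpa using map_dvd (Polynomial.aeval ϖ) h

/-- Evaluation of a power series at `ϖ` modulo `ϖ ^ n`. -/
noncomputable def evalMod (n : ℕ) : k⟦X⟧ →+* R ⧸ (Ideal.span {ϖ} ^ n) where
  toFun f := Ideal.Quotient.mk _ (Polynomial.aeval ϖ (trunc n f))
  map_zero' := by simp
  map_one' := by
    have := mk_aeval_trunc_coe (k := k) ϖ n 1
    simpa using this
  map_add' f g := by simp
  map_mul' f g := by
    rw [← trunc_trunc_mul_trunc, ← Polynomial.coe_mul, mk_aeval_trunc_coe, map_mul, map_mul]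

theorem evalMod_apply (n : ℕ) (f : k⟦X⟧) :
    evalMod ϖ n f = Ideal.Quotient.mk _ (Polynomial.aeval ϖ (trunc n f)) := rfl

theorem factorPow_comp_evalMod {m n : ℕ} (h : m ≤ n) :
    (Ideal.Quotient.factorPow (Ideal.span {ϖ}) h).comp (evalMod (k := k) ϖ n) = evalMod ϖ m := by
  ext f
  have h1 := mk_aeval_trunc_coe ϖ m (trunc n f)
  rw [trunc_trunc_of_le f h] at h1
  simp only [RingHom.comp_apply, evalMod_apply]
  rw [h1]
  rfl

variable [IsAdicComplete (Ideal.span {ϖ}) R]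

/-- Evaluation of power series at an element `ϖ` for which the ring is `ϖ`-adically complete. -/
noncomputable def adicEval : k⟦X⟧ →+* R :=
  IsAdicComplete.liftRingHom (Ideal.span {ϖ}) (evalMod ϖ) (factorPow_comp_evalMod ϖ)

theorem mk_adicEval (n : ℕ) (f : k⟦X⟧) :
    Ideal.Quotient.mk (Ideal.span {ϖ} ^ n) (adicEval ϖ f) =
      Ideal.Quotient.mk _ (Polynomial.aeval ϖ (trunc n f)) :=
  IsAdicComplete.mk_liftRingHom _ _ (factorPow_comp_evalMod ϖ) n f

theorem eq_of_forall_mk_eq {x y : R}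
    (h : ∀ n, Ideal.Quotient.mk (Ideal.span {ϖ} ^ n) x = Ideal.Quotient.mk _ y) : x = y := by
  rw [← sub_eq_zero]
  refine IsHausdorff.haus (I := Ideal.span {ϖ}) inferInstance _ fun n => ?_
  rw [SModEq.zero, smul_eq_mul, Ideal.mul_top]
  exact Ideal.Quotient.eq.1 (h n)

theorem adicEval_coe (p : k[X]) : adicEval ϖ (p : k⟦X⟧) = Polynomial.aeval ϖ p :=
  eq_of_forall_mk_eq ϖ fun n => by rw [mk_adicEval, mk_aeval_trunc_coe]

theorem adicEval_X : adicEval ϖ (X : k⟦X⟧) = ϖ := by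
  simpa using adicEval_coe (k := k) ϖ Polynomial.X

theorem adicEval_C (c : k) : adicEval ϖ (C c) = algebraMap k R c := by
  simpa using adicEval_coe (k := k) ϖ (Polynomial.C c)

theorem mk_adicEval_constantCoeff (f : k⟦X⟧) :
    Ideal.Quotient.mk (Ideal.span {ϖ}) (adicEval ϖ f) =
      Ideal.Quotient.mk _ (algebraMap k R (constantCoeff f)) := by
  have h := mk_adicEval ϖ 1 f
  rw [Ideal.Quotient.eq] at h ⊢
  simpa [trunc_one_left] using h

variable (hϖ : ϖ ∈ nonZeroDivisors R)
  (hk : Function.Bijective ((Ideal.Quotient.mk (Ideal.span {ϖ})).comp (algebraMap k R)))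
include hk

theorem adicEval_surjective : Function.Surjective (adicEval (k := k) ϖ) := by
  intro r
  -- Digit expansion: `k` supplies the remainder of `x` modulo `ϖ`, and iterating the quotient `y`
  -- produces all coefficients of the power series.
  have step : ∀ x : R, ∃ (c : k) (y : R), x = algebraMap k R c + ϖ * y := fun x => by
    obtain ⟨c, hc⟩ := hk.2 (Ideal.Quotient.mk _ x)
    rw [RingHom.comp_apply, eq_comm, Ideal.Quotient.eq, Ideal.mem_span_singleton] at hc
    obtain ⟨y, hy⟩ := hc
    exact ⟨c, y, by rw [← hy]; ring⟩
  choose c y hcy using step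
  let s : ℕ → R := fun n => y^[n] r
  refine ⟨mk fun n => c (s n), eq_of_forall_mk_eq ϖ fun n => ?_⟩
  rw [mk_adicEval]
  have : ∀ n, r = Polynomial.aeval ϖ (trunc n (mk fun n => c (s n))) + ϖ ^ n * s n := by
    intro n
    induction n with
    | zero => simp [s]
    | succ n ih =>
      rw [trunc_succ, map_add, coeff_mk, Polynomial.aeval_monomial]
      conv_lhs => rw [ih, hcy (s n)]
      rw [show s (n + 1) = y (s n) from Function.iterate_succ_apply' y n r]
      ring
  rw [Ideal.Quotient.eq, Ideal.span_singleton_pow, Ideal.mem_span_singleton]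
  exact ⟨-s n, by conv_lhs => rw [this n]
                  ring⟩

include hϖ in
theorem adicEval_injective : Function.Injective (adicEval (k := k) ϖ) := by
  rw [injective_iff_map_eq_zero]
  intro f hf
  by_contra hne
  -- After the largest power of `X` is split off, `ϖ ^ n` can be cancelled, and the nonzero constant
  -- coefficient of `g` survives modulo `ϖ`.
  obtain ⟨n, g, hg, rfl⟩ : ∃ (n : ℕ) (g : k⟦X⟧), constantCoeff g ≠ 0 ∧ f = X ^ n * g := by
    have hn : ∃ n, coeff n f ≠ 0 := by
      by_contra! h
      exact hne (ext h)
    classical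
    let m := Nat.find hn
    have hm : X ^ m ∣ f := X_pow_dvd_iff.2 fun i hi => by
      simpa using Nat.find_min hn hi
    obtain ⟨g, hg⟩ := hm
    refine ⟨m, g, ?_, hg⟩
    have h1 : coeff m f ≠ 0 := Nat.find_spec hn
    rw [hg] at h1
    have h2 := coeff_X_pow_mul g m 0
    rw [zero_add] at h2
    rwa [h2, coeff_zero_eq_constantCoeff_apply] at h1
  rw [map_mul, map_pow, adicEval_X] at hf
  have h0 : adicEval ϖ g = 0 := by
    have := pow_mem hϖ n
    exact (mul_left_mem_nonZeroDivisors_eq_zero_iff this).1 hf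
  have h1 := mk_adicEval_constantCoeff ϖ g
  rw [h0, map_zero] at h1
  exact hg (hk.1 (by rw [map_zero, RingHom.comp_apply, ← h1]))

/-- A ring that is complete with respect to a principal ideal and that has a coefficient ring is a
power series ring. -/
noncomputable def adicEvalEquiv : k⟦X⟧ ≃+* R :=
  RingEquiv.ofBijective (adicEval ϖ) ⟨adicEval_injective ϖ hϖ hk, adicEval_surjective ϖ hk⟩

end AdicEval

/-! ### Invariance of residues under a change of uniformizer -/

section Residue

/-- `X v^n v'` is `X (v^(n+1))' / (n+1)`, and the operator `X d/dX` multiplies the coefficient of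
`X^(n+1)` by `n+1`. Dividing by `n+1` needs torsion-freeness. -/
theorem coeff_pow_sub_X_mul_of_torsionFree {R : Type*} [CommRing R] [IsAddTorsionFree R]
    (v : R⟦X⟧) (n : ℕ) :
    coeff (n + 1) (v ^ (n + 1) - X * (v ^ n * derivative R v)) = 0 := by
  have h : ((n + 1 : ℕ) : R⟦X⟧) * (v ^ (n + 1) - X * (v ^ n * derivative R v)) =
      ((n + 1 : ℕ) : R⟦X⟧) * v ^ (n + 1) - X * derivative R (v ^ (n + 1)) := by
    rw [Derivation.leibniz_pow]
    simp only [Nat.add_sub_cancel, smul_eq_mul, nsmul_eq_mul]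
    ring
  have h2 : ((n + 1 : ℕ) : R) *
      coeff (n + 1) (v ^ (n + 1) - X * (v ^ n * derivative R v)) = 0 := by
    have h3 := congrArg (coeff (n + 1)) h
    have hC : ((n + 1 : ℕ) : R⟦X⟧) = C ((n + 1 : ℕ) : R) := by simp
    rw [hC, coeff_C_mul, map_sub (coeff (n + 1)) (C _ * _), coeff_C_mul, coeff_succ_X_mul,
      coeff_derivative] at h3
    rw [h3]
    push_cast
    ring
  rw [← nsmul_eq_mul] at h2
  exact (smul_eq_zero_iff_right (Nat.succ_ne_zero n)).1 h2

/-- The identity is polynomial in the coefficients of `v`, so it specializes from indeterminate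
coefficients over `ℤ`. This is what makes the residue calculus valid in characteristic `p`. -/
theorem coeff_pow_sub_X_mul {R : Type*} [CommRing R] (v : R⟦X⟧) (n : ℕ) :
    coeff (n + 1) (v ^ (n + 1) - X * (v ^ n * derivative R v)) = 0 := by
  let φ : MvPolynomial R ℤ →+* R := (MvPolynomial.aeval id : MvPolynomial R ℤ →ₐ[ℤ] R).toRingHom
  let w : (MvPolynomial R ℤ)⟦X⟧ := mk fun i => MvPolynomial.X (coeff i v)
  have hw : PowerSeries.map φ w = v := by
    ext i
    simp [w, φ]
  have hd : PowerSeries.map φ (derivative _ w) = derivative R v := by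
    ext i
    rw [coeff_map, coeff_derivative, coeff_derivative, map_mul, ← coeff_map, hw]
    simp
  have : IsAddTorsionFree (MvPolynomial R ℤ) := inferInstance
  have h := congrArg φ (coeff_pow_sub_X_mul_of_torsionFree w n)
  rw [← coeff_map] at h
  simpa [hw, hd] using h

/-- The residue of `t⁻ⁿ dt` for a uniformizer `t = X u`, where `v = u⁻¹`. -/
theorem coeff_inv_pow_mul_derivative {R : Type*} [CommRing R] {u v : R⟦X⟧} (huv : v * u = 1)
    (n : ℕ) :
    coeff n (v ^ (n + 1) * derivative R (X * u)) = if n = 0 then 1 else 0 := by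
  have hd : v * derivative R u = -(u * derivative R v) := by
    have := congrArg (derivative R) huv
    rw [Derivation.leibniz, Derivation.map_one_eq_zero, smul_eq_mul, smul_eq_mul] at this
    linear_combination this
  have hX : derivative R (X : R⟦X⟧) = 1 := derivative_X
  have key : v ^ (n + 1) * derivative R (X * u) = v ^ n + X * (v ^ (n + 1) * derivative R u) := by
    rw [Derivation.leibniz, hX, smul_eq_mul, smul_eq_mul]
    linear_combination (v ^ n) * huv
  rw [key]
  cases n with
  | zero => simp
  | succ n =>
    -- Logarithmic derivatives of `u` and `v = u⁻¹` are opposite, which brings the term with `u'`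
    -- into the form of `coeff_pow_sub_X_mul`.
    have h2 : v ^ (n + 1 + 1) * derivative R u = - (v ^ n * derivative R v) := by
      linear_combination v ^ (n + 1) * hd - v ^ n * derivative R v * huv
    rw [h2, mul_neg, ← sub_eq_add_neg, coeff_pow_sub_X_mul]
    simp

end Residue

end PowerSeries

/-! ### The complete discrete valuation ring at a prime -/

namespace IsDedekindDomain.HeightOneSpectrum

variable {A : Type*} (K : Type*) [CommRing A] [IsDedekindDomain A]
  [Field K] [Algebra A K] [IsFractionRing A K] (v : HeightOneSpectrum A)

theorem valued_algebraMap (a : A) :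
    Valued.v ((algebraMap A (v.adicCompletionIntegers K) a : v.adicCompletionIntegers K) :
      v.adicCompletion K) = v.intValuation a := by
  rw [algebraMap_adicCompletionIntegers_apply, valuedAdicCompletion_eq_valuation',
    valuation_of_algebraMap]

theorem mem_maximalIdeal_iff_valued (x : v.adicCompletionIntegers K) :
    x ∈ IsLocalRing.maximalIdeal (v.adicCompletionIntegers K) ↔
      Valued.v (x : v.adicCompletion K) < 1 := by
  rw [IsLocalRing.mem_maximalIdeal, mem_nonunits_iff,
    adicCompletionIntegers.isUnit_iff_valued_eq_one]
  exact ⟨fun h => lt_of_le_of_ne x.2 h, fun h => h.ne⟩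

theorem algebraMap_mem_maximalIdeal_iff (a : A) :
    algebraMap A (v.adicCompletionIntegers K) a ∈
      IsLocalRing.maximalIdeal (v.adicCompletionIntegers K) ↔ a ∈ v.asIdeal := by
  rw [mem_maximalIdeal_iff_valued, valued_algebraMap, intValuation_lt_one_iff_mem]

/-- Two approximations: `K` is dense in its completion, and an element of `K` that is integral at
`v` is congruent to an element of `A`. -/
theorem exists_algebraMap_sub_mem_maximalIdeal (x : v.adicCompletionIntegers K) :
    ∃ a : A, x - algebraMap A (v.adicCompletionIntegers K) a ∈
      IsLocalRing.maximalIdeal (v.adicCompletionIntegers K) := by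
  have hopen : {y : v.adicCompletion K | Valued.v (y - x) < 1} ∈ 𝓝 (x : v.adicCompletion K) := by
    rw [Valued.mem_nhds]
    refine ⟨1, fun y hy => ?_⟩
    simp only [Units.val_one, Set.mem_ofPred_eq] at hy ⊢
    have := MonoidWithZeroHom.ValueGroup₀.embedding_strictMono hy
    simpa using this
  obtain ⟨y, hy⟩ := (denseRange_algebraMap (R := A) (K := K) v).mem_nhds hopen
  rw [Set.mem_ofPred_eq] at hy
  have hy' : v.valuation K y ≤ 1 := by
    rw [← valuedAdicCompletion_eq_valuation']
    have : (y : v.adicCompletion K) = (algebraMap K (v.adicCompletion K) y - x) + x := by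
      rw [algebraMap_adicCompletion]; simp
    rw [this]
    exact (Valuation.map_add _ _ _).trans (max_le hy.le x.2)
  obtain ⟨a, ha⟩ := v.exists_valuation_sub_lt_of_integer hy' 1
  refine ⟨a, ?_⟩
  rw [mem_maximalIdeal_iff_valued]
  have h2 : Valued.v (algebraMap K (v.adicCompletion K) (algebraMap A K a - y)) < 1 := by
    rw [algebraMap_adicCompletion, Function.comp_apply, valuedAdicCompletion_eq_valuation']
    simpa using ha
  have h3 : ((x - algebraMap A (v.adicCompletionIntegers K) a : v.adicCompletionIntegers K) :
      v.adicCompletion K) = -(algebraMap K (v.adicCompletion K) y - x) -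
        algebraMap K (v.adicCompletion K) (algebraMap A K a - y) := by
    rw [map_sub]
    push_cast
    rw [algebraMap_adicCompletionIntegers_apply, algebraMap_adicCompletion]
    simp only [Function.comp_apply, Algebra.algebraMap_self_apply]
    ring
  rw [h3]
  refine (Valuation.map_sub _ _ _).trans_lt (max_lt ?_ h2)
  rwa [Valuation.map_neg]

/-- The value group is discrete: value less than `1` means value at most that of `a`. Thus a
uniformizer can be taken in `A`. -/
theorem maximalIdeal_eq_span_of_intValuation_eq {a : A}
    (ha : v.intValuation a = WithZero.exp (-1 : ℤ)) :
    IsLocalRing.maximalIdeal (v.adicCompletionIntegers K) =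
      Ideal.span {algebraMap A (v.adicCompletionIntegers K) a} := by
  ext x
  rw [mem_maximalIdeal_iff_valued, Ideal.mem_span_singleton,
    (adicCompletionIntegers.integers K v).dvd_iff_le]
  change _ ↔ Valued.v (x : v.adicCompletion K) ≤ Valued.v ((algebraMap A
    (v.adicCompletionIntegers K) a : v.adicCompletionIntegers K) : v.adicCompletion K)
  rw [valued_algebraMap, ha]
  by_cases h : Valued.v (x : v.adicCompletion K) = 0
  · simp [h]
  · rw [← WithZero.exp_log h, ← WithZero.exp_zero, WithZero.exp_lt_exp, WithZero.exp_le_exp]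
    omega

theorem valued_le_of_mem_maximalIdeal_pow (n : ℕ) {x : v.adicCompletionIntegers K}
    (hx : x ∈ IsLocalRing.maximalIdeal (v.adicCompletionIntegers K) ^ n) :
    Valued.v (x : v.adicCompletion K) ≤ WithZero.exp (-(n : ℤ)) := by
  obtain ⟨a, ha⟩ := v.intValuation_exists_uniformizer
  rw [maximalIdeal_eq_span_of_intValuation_eq K v ha, Ideal.span_singleton_pow,
    Ideal.mem_span_singleton] at hx
  obtain ⟨y, rfl⟩ := hx
  push_cast
  rw [map_mul, map_pow, valued_algebraMap, ha]
  refine (mul_le_of_le_one_right' y.2).trans (le_of_eq ?_)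
  rw [← WithZero.exp_nsmul]
  simp

/-- The valuation topology, for which the ring is closed in a complete field, coincides with the
adic topology of the maximal ideal. -/
instance isAdicComplete_adicCompletionIntegers :
    IsAdicComplete (IsLocalRing.maximalIdeal (v.adicCompletionIntegers K))
      (v.adicCompletionIntegers K) := by
  have hc : CompleteSpace (v.adicCompletionIntegers K) :=
    (Valued.isClosed_valuationSubring (v.adicCompletion K)).completeSpace_coe
  have : IsUniformAddGroup (v.adicCompletionIntegers K) :=
    inferInstanceAs (IsUniformAddGroup (v.adicCompletionIntegers K).toSubring.toAddSubgroup)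
  have : IsTopologicalRing (v.adicCompletionIntegers K) :=
    inferInstanceAs (IsTopologicalRing (v.adicCompletionIntegers K).toSubring)
  refine (IsAdic.isAdicComplete_iff (isAdic_iff.2 ⟨fun n => ?_, fun s hs => ?_⟩)).2
    ⟨hc, inferInstance⟩
  · obtain ⟨a, ha⟩ := v.intValuation_exists_uniformizer
    have ha0 : algebraMap A (v.adicCompletion K) a ≠ 0 := by
      intro h0
      have h1 := valued_algebraMap K v a
      rw [show ((algebraMap A (v.adicCompletionIntegers K) a : v.adicCompletionIntegers K) :
        v.adicCompletion K) = algebraMap A (v.adicCompletion K) a from rfl, h0, ha, map_zero] at h1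
      exact WithZero.exp_ne_zero h1.symm
    rw [maximalIdeal_eq_span_of_intValuation_eq K v ha, Ideal.span_singleton_pow]
    have hO := Valued.isOpen_valuationSubring (v.adicCompletion K)
    have hcont : Continuous fun x : v.adicCompletionIntegers K =>
        (algebraMap A (v.adicCompletion K) a ^ n)⁻¹ * (x : v.adicCompletion K) := by fun_prop
    -- Powers of the maximal ideal are open as preimages of the open valuation ring under
    -- multiplication by `a ^ (-n)`.
    suffices h : ((Ideal.span {algebraMap A (v.adicCompletionIntegers K) a ^ n} :
        Ideal (v.adicCompletionIntegers K)) : Set (v.adicCompletionIntegers K)) =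
        (fun x : v.adicCompletionIntegers K => (algebraMap A (v.adicCompletion K) a ^ n)⁻¹ *
          (x : v.adicCompletion K)) ⁻¹' (v.adicCompletionIntegers K : Set (v.adicCompletion K)) by
      rw [h]
      exact hO.preimage hcont
    refine Set.ext fun x => ?_
    rw [SetLike.mem_coe, Set.mem_preimage, Ideal.mem_span_singleton]
    constructor
    · rintro ⟨y, rfl⟩
      have : (algebraMap A (v.adicCompletion K) a ^ n)⁻¹ * ((algebraMap A
          (v.adicCompletionIntegers K) a ^ n * y : v.adicCompletionIntegers K) :
          v.adicCompletion K) = y := by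
        push_cast
        exact inv_mul_cancel_left₀ (pow_ne_zero n ha0) _
      rw [this]
      exact y.2
    · intro h
      refine ⟨⟨_, h⟩, Subtype.ext ?_⟩
      push_cast
      exact (mul_inv_cancel_left₀ (pow_ne_zero n ha0) _).symm
  · rw [nhds_subtype_eq_comap, mem_comap] at hs
    obtain ⟨t, ht, hts⟩ := hs
    rw [ZeroMemClass.coe_zero, Valued.mem_nhds_zero] at ht
    obtain ⟨γ, hγ⟩ := ht
    have hγ0 : MonoidWithZeroHom.ValueGroup₀.embedding
        (γ : MonoidWithZeroHom.ValueGroup₀ (.ofClass (Valued.v (R := v.adicCompletion K)))) ≠ 0 :=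
      fun h => γ.ne_zero (MonoidWithZeroHom.ValueGroup₀.embedding_strictMono.injective
        (by rw [h, map_zero]))
    -- The exponent exceeds `-log γ`, so the elements of this power have value strictly below `γ`.
    refine ⟨(-WithZero.log (MonoidWithZeroHom.ValueGroup₀.embedding
        (γ : MonoidWithZeroHom.ValueGroup₀ (.ofClass (Valued.v (R := v.adicCompletion K)))))
        + 1).toNat, fun x hx => hts (hγ ?_)⟩
    rw [Set.mem_ofPred_eq, Valuation.restrict_lt_iff_lt_embedding]
    refine (valued_le_of_mem_maximalIdeal_pow K v _ hx).trans_lt ?_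
    conv_rhs => rw [← WithZero.exp_log hγ0]
    rw [WithZero.exp_lt_exp]
    omega

end IsDedekindDomain.HeightOneSpectrum

namespace PowerSeries

/-! ### Laurent residues and differentials of a power series ring -/

section LaurentResidue

variable {k R F : Type*} [CommRing k] [CommRing R] [Algebra k R] [Field F]
  [Algebra R F] [FaithfulSMul R F] [Algebra k F] [IsScalarTower k R F] (ψ : k⟦X⟧ ≃ₐ[k] R)

/-- The coefficient `c` of `(ψ X)⁻¹` in the expansion of `z` in powers of `ψ X`. -/
def IsLaurentResidue (z : F) (c : k) : Prop :=
  ∃ (n : ℕ) (r : R), z * algebraMap R F (ψ X) ^ (n + 1) = algebraMap R F r ∧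
    c = coeff n (ψ.symm r)

variable {ψ}

-- Clearing denominators with a larger power of the uniformizer multiplies the numerator by `ψ X ^
-- m` and shifts the index of the coefficient by the same `m`.
omit [Algebra k F] [IsScalarTower k R F] in
theorem IsLaurentResidue.unique [Nontrivial k] {z : F} {c c' : k} (h : IsLaurentResidue ψ z c)
    (h' : IsLaurentResidue ψ z c') : c = c' := by
  wlog H : ∃ (n m : ℕ) (r r' : R), z * algebraMap R F (ψ X) ^ (n + 1) = algebraMap R F r ∧
    c = coeff n (ψ.symm r) ∧ z * algebraMap R F (ψ X) ^ (n + m + 1) = algebraMap R F r' ∧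
    c' = coeff (n + m) (ψ.symm r') generalizing c c'
  · obtain ⟨n, r, hr, hc⟩ := h
    obtain ⟨n', r', hr', hc'⟩ := h'
    rcases le_total n n' with hn | hn
    · obtain ⟨m, rfl⟩ := Nat.exists_eq_add_of_le hn
      exact absurd ⟨n, m, r, r', hr, hc, hr', hc'⟩ H
    · obtain ⟨m, rfl⟩ := Nat.exists_eq_add_of_le hn
      exact (this ⟨n', r', hr', hc'⟩ ⟨_, r, hr, hc⟩ ⟨n', m, r', r, hr', hc', hr, hc⟩).symm
  obtain ⟨n, m, r, r', hr, rfl, hr', rfl⟩ := H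
  have : r' = ψ X ^ m * r := by
    apply FaithfulSMul.algebraMap_injective R F
    rw [← hr', map_mul, map_pow, ← hr]
    ring
  rw [this, map_mul, map_pow, AlgEquiv.symm_apply_apply, coeff_X_pow_mul]

variable (ψ) (F) in
/-- Every element of `F` is the quotient of an element of `R` by a power of the uniformizer. -/
def HasFinitePoles : Prop :=
  ∀ z : F, ∃ (n : ℕ) (r : R), z * algebraMap R F (ψ X) ^ n = algebraMap R F r

variable (hF : HasFinitePoles F ψ)
include hF

omit [FaithfulSMul R F] [Algebra k F] [IsScalarTower k R F] in
theorem HasFinitePoles.exists_succ (z : F) :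
    ∃ n₀ : ℕ, ∀ n ≥ n₀, ∃ r : R, z * algebraMap R F (ψ X) ^ (n + 1) = algebraMap R F r := by
  obtain ⟨n, r, h⟩ := hF z
  refine ⟨n, fun m hm => ⟨r * ψ X ^ (m + 1 - n), ?_⟩⟩
  rw [map_mul, ← h, map_pow, mul_assoc, ← pow_add]
  congr 2
  omega

omit [FaithfulSMul R F] [Algebra k F] [IsScalarTower k R F] in
theorem HasFinitePoles.exists_isLaurentResidue (z : F) : ∃ c, IsLaurentResidue ψ z c := by
  obtain ⟨n, h⟩ := hF.exists_succ z
  obtain ⟨r, hr⟩ := h n le_rfl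
  exact ⟨_, n, r, hr, rfl⟩

variable [Nontrivial k]

/-- The coefficient of `(ψ X)⁻¹` in the expansion in powers of `ψ X`, as a linear map. -/
noncomputable def laurentResidue : F →ₗ[k] k where
  toFun z := (hF.exists_isLaurentResidue z).choose
  map_add' z w := by
    obtain ⟨n, hn⟩ := hF.exists_succ z
    obtain ⟨m, hm⟩ := hF.exists_succ w
    obtain ⟨r, hr⟩ := hn (max n m) (le_max_left _ _)
    obtain ⟨s, hs⟩ := hm (max n m) (le_max_right _ _)
    refine (hF.exists_isLaurentResidue (z + w)).choose_spec.unique ⟨max n m, r + s, ?_, ?_⟩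
    · rw [add_mul, hr, hs, map_add]
    · rw [map_add, map_add]
      congr 1
      · exact (hF.exists_isLaurentResidue z).choose_spec.unique ⟨_, r, hr, rfl⟩
      · exact (hF.exists_isLaurentResidue w).choose_spec.unique ⟨_, s, hs, rfl⟩
  map_smul' a z := by
    obtain ⟨n, hn⟩ := hF.exists_succ z
    obtain ⟨r, hr⟩ := hn n le_rfl
    refine (hF.exists_isLaurentResidue (a • z)).choose_spec.unique ⟨n, a • r, ?_, ?_⟩
    · rw [smul_mul_assoc, hr, Algebra.smul_def a r, map_mul, ← IsScalarTower.algebraMap_apply,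
        Algebra.smul_def]
    · rw [map_smul, map_smul, RingHom.id_apply]
      congr 1
      exact (hF.exists_isLaurentResidue z).choose_spec.unique ⟨_, r, hr, rfl⟩

theorem laurentResidue_eq {z : F} {n : ℕ} {r : R}
    (h : z * algebraMap R F (ψ X) ^ (n + 1) = algebraMap R F r) :
    laurentResidue hF z = coeff n (ψ.symm r) :=
  (hF.exists_isLaurentResidue z).choose_spec.unique ⟨n, r, h, rfl⟩

theorem laurentResidue_algebraMap (r : R) : laurentResidue hF (algebraMap R F r) = 0 := by
  rw [laurentResidue_eq hF (n := 0) (r := ψ X * r) (by rw [map_mul]; ring)]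
  simp

end LaurentResidue

section Derivation

variable {k R : Type*} [CommRing k] [CommRing R] [Algebra k R] (ψ : k⟦X⟧ ≃ₐ[k] R)

/-- The derivation `d/dX`, transported along an isomorphism with a power series ring. -/
noncomputable def transportDerivation : Derivation k R R :=
  Derivation.mk' (ψ.toLinearMap ∘ₗ (derivative k).toLinearMap ∘ₗ ψ.symm.toLinearMap) fun a b => by
    simp [Derivation.leibniz]

theorem transportDerivation_apply (r : R) :
    transportDerivation ψ r = ψ (derivative k (ψ.symm r)) := rfl

theorem transportDerivation_X : transportDerivation ψ (ψ X) = 1 := by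
  simp [transportDerivation_apply]

end Derivation

section ChangeOfUniformizer

variable {k R F : Type*} [CommRing k] [CommRing R] [Algebra k R] [Field F]
  [Algebra R F] [FaithfulSMul R F] [Algebra k F] [IsScalarTower k R F] {ψ : k⟦X⟧ ≃ₐ[k] R}
  (hF : HasFinitePoles F ψ) [Nontrivial k]

/-- Invariance of the residue: `ψ X * u` is an arbitrary uniformizer, and multiplication by `(ψ
X)^(n+1)` turns the claim into `coeff_inv_pow_mul_derivative`. For `i = 0` there is no pole. -/
theorem laurentResidue_inv_pow_mul_derivation {u u' : R} (hu : u' * u = 1) (i : ℕ) :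
    laurentResidue hF ((algebraMap R F (ψ X * u))⁻¹ ^ i *
      algebraMap R F (transportDerivation ψ (ψ X * u))) = if i = 1 then 1 else 0 := by
  cases i with
  | zero => rw [pow_zero, one_mul, laurentResidue_algebraMap, if_neg zero_ne_one]
  | succ n =>
    have hX : (X : k⟦X⟧) ≠ 0 := X_ne_zero
    have hX' : algebraMap R F (ψ X) ≠ 0 := fun h => hX (ψ.injective
      (FaithfulSMul.algebraMap_injective R F (by rw [h, map_zero, map_zero])))
    have hu' : algebraMap R F u' * algebraMap R F u = 1 := by rw [← map_mul, hu, map_one]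
    have hinv : (algebraMap R F (ψ X * u))⁻¹ * algebraMap R F (ψ X) = algebraMap R F u' := by
      have hu0 := right_ne_zero_of_mul_eq_one hu'
      rw [map_mul]
      field_simp
      linear_combination -hu'
    have key : (algebraMap R F (ψ X * u))⁻¹ ^ (n + 1) *
        algebraMap R F (transportDerivation ψ (ψ X * u)) * algebraMap R F (ψ X) ^ (n + 1) =
        algebraMap R F (u' ^ (n + 1) * transportDerivation ψ (ψ X * u)) := by
      rw [map_mul (algebraMap R F) (u' ^ _), map_pow, ← hinv]
      ring
    rw [laurentResidue_eq hF key, map_mul ψ.symm, map_pow, transportDerivation_apply,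
      AlgEquiv.symm_apply_apply, map_mul ψ.symm, AlgEquiv.symm_apply_apply,
      coeff_inv_pow_mul_derivative (by rw [← map_mul, hu, map_one])]
    simp

theorem laurentResidue_aeval_inv_mul_derivation {u u' : R} (hu : u' * u = 1) (P : k[X]) :
    laurentResidue hF (Polynomial.aeval (algebraMap R F (ψ X * u))⁻¹ P *
      algebraMap R F (transportDerivation ψ (ψ X * u))) = P.coeff 1 := by
  rw [Polynomial.aeval_eq_sum_range' (Nat.lt_succ_of_le (Nat.le_succ P.natDegree)), Finset.sum_mul,
    map_sum]
  simp_rw [smul_mul_assoc, map_smul, laurentResidue_inv_pow_mul_derivation hF hu]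
  simp

-- Induction on the order of the pole: the constant coefficient of the numerator is the leading
-- polar coefficient, and subtracting that term lowers the order.
include hF in
theorem exists_eq_add_aeval_inv (z : F) : ∃ (P : k[X]) (r : R),
    z = algebraMap R F r + Polynomial.aeval (algebraMap R F (ψ X))⁻¹ P := by
  obtain ⟨n, r, h⟩ := hF z
  have hX' : algebraMap R F (ψ X) ≠ 0 := fun h => (X_ne_zero : (X : k⟦X⟧) ≠ 0) (ψ.injective
    (FaithfulSMul.algebraMap_injective R F (by rw [h, map_zero, map_zero])))
  induction n generalizing r z with
  | zero => exact ⟨0, r, by simpa using h⟩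
  | succ n ih =>
    obtain ⟨f, rfl⟩ := ψ.surjective r
    obtain ⟨g, hg⟩ : X ∣ f - C (constantCoeff f) := by
      rw [X_dvd_iff]
      simp
    let c := constantCoeff f
    have hψ : ψ f = ψ X * ψ g + algebraMap k R c := by
      have hC : ψ (C (constantCoeff f)) = algebraMap k R c := ψ.commutes c
      rw [← map_mul, ← hg, map_sub, hC, sub_add_cancel]
    obtain ⟨P, s, hP⟩ := ih (z - algebraMap k F c * (algebraMap R F (ψ X))⁻¹ ^ (n + 1)) (ψ g) (by
      have hz : z = (algebraMap R F (ψ X) * algebraMap R F (ψ g) + algebraMap k F c) *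
          (algebraMap R F (ψ X))⁻¹ ^ (n + 1) := by
        rw [hψ, map_add, map_mul, ← IsScalarTower.algebraMap_apply] at h
        rw [← h, mul_assoc, ← mul_pow, mul_inv_cancel₀ hX', one_pow, mul_one]
      have h1 : (algebraMap R F (ψ X))⁻¹ ^ (n + 1) * algebraMap R F (ψ X) ^ n =
          (algebraMap R F (ψ X))⁻¹ := by
        rw [pow_succ', mul_assoc, ← mul_pow, inv_mul_cancel₀ hX', one_pow, mul_one]
      rw [hz, ← sub_mul, add_sub_cancel_right, mul_assoc, h1, mul_right_comm,
        mul_inv_cancel₀ hX', one_mul])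
    refine ⟨P + Polynomial.monomial (n + 1) c, s, ?_⟩
    rw [map_add, Polynomial.aeval_monomial, ← add_assoc, ← hP]
    ring

end ChangeOfUniformizer

end PowerSeries

/-! ### Completed differentials of a power series ring -/

section CompletedDifferentials

open PowerSeries

variable {k R : Type*} [CommRing k] [CommRing R] [Algebra k R] (ψ : k⟦X⟧ ≃ₐ[k] R)
  (I : Ideal R) [IsAdicComplete I R]

/-- The functional on the completed differentials of a power series ring that is dual to the
differential of the uniformizer. -/
noncomputable def differentialCoord : AdicCompletion I (Ω[R⁄k]) →ₗ[R] R :=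
  (AdicCompletion.ofLinearEquiv I R).symm.toLinearMap ∘ₗ
    (AdicCompletion.map I (transportDerivation ψ).liftKaehlerDifferential).restrictScalars R

theorem differentialCoord_of_D (x : R) :
    differentialCoord ψ I (AdicCompletion.of I _ (KaehlerDifferential.D k R x)) =
      transportDerivation ψ x := by
  simp only [differentialCoord, LinearMap.comp_apply, LinearMap.restrictScalars_apply,
    AdicCompletion.map_of, Derivation.liftKaehlerDifferential_comp_D]
  exact (AdicCompletion.ofLinearEquiv I R).symm_apply_apply _

-- A power series is a polynomial in the uniformizer up to a high power of it, and the differential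
-- of a polynomial is a multiple of `d(ψ X)`. The argument works only modulo powers of `I`; this is
-- why the differentials have to be completed.
omit [IsAdicComplete I R] in
theorem exists_sub_smul_D_mem (hI : I = Ideal.span {ψ X}) (n : ℕ) (ω : Ω[R⁄k]) :
    ∃ g : R, ω - g • KaehlerDifferential.D k R (ψ X) ∈ (I ^ n • ⊤ : Submodule R (Ω[R⁄k])) := by
  have hω : ω ∈ Submodule.span R (Set.range (KaehlerDifferential.D k R)) := by
    rw [KaehlerDifferential.span_range_derivation]; trivial
  induction hω using Submodule.span_induction with
  | zero => exact ⟨0, by simp⟩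
  | add x y _ _ hx hy =>
    obtain ⟨g, hg⟩ := hx
    obtain ⟨h, hh⟩ := hy
    refine ⟨g + h, ?_⟩
    have := add_mem hg hh
    rwa [show x + y - (g + h) • KaehlerDifferential.D k R (ψ X) =
      x - g • KaehlerDifferential.D k R (ψ X) + (y - h • KaehlerDifferential.D k R (ψ X)) by
      rw [add_smul]; abel]
  | smul a x _ hx =>
    obtain ⟨g, hg⟩ := hx
    refine ⟨a * g, ?_⟩
    have := Submodule.smul_mem _ a hg
    rwa [smul_sub, smul_smul] at this
  | mem x hx =>
    obtain ⟨y, rfl⟩ := hx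
    obtain ⟨f, rfl⟩ := ψ.surjective y
    -- Order `n + 1` is needed because the Leibniz rule costs one power of the uniformizer.
    obtain ⟨h, hh⟩ : X ^ (n + 1) ∣ f - (trunc (n + 1) f : k⟦X⟧) := by
      rw [X_pow_dvd_iff]
      intro m hm
      simp [coeff_trunc, hm]
    have hψ : ψ f = Polynomial.aeval (ψ X) (trunc (n + 1) f) + ψ X ^ (n + 1) * ψ h := by
      rw [← map_pow, ← map_mul, ← hh, map_sub]
      have : ∀ p : k[X], ψ (p : k⟦X⟧) = Polynomial.aeval (ψ X) p := by
        intro p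
        have := Polynomial.aeval_algHom_apply (ψ : k⟦X⟧ →ₐ[k] R) X p
        simp only [AlgEquiv.coe_toAlgHom] at this
        rw [this]
        congr 1
        clear this
        induction p using Polynomial.induction_on' with
        | add p q hp hq => rw [Polynomial.coe_add, hp, hq, map_add]
        | monomial m a =>
          rw [Polynomial.coe_monomial, Polynomial.aeval_monomial, monomial_eq_C_mul_X_pow]
          rfl
      rw [this]
      ring
    refine ⟨Polynomial.aeval (ψ X) (Polynomial.derivative (trunc (n + 1) f)), ?_⟩
    have hpow : ψ X ^ n ∈ I ^ n := Ideal.pow_mem_pow (hI ▸ Ideal.mem_span_singleton_self _) n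
    rw [hψ, map_add, Derivation.leibniz, Derivation.leibniz_pow,
      Derivation.map_aeval, add_sub_cancel_left]
    refine add_mem ?_ ?_
    · rw [pow_succ, mul_smul]
      exact Submodule.smul_mem_smul hpow trivial
    · refine Submodule.smul_mem _ _ ?_
      rw [Nat.add_sub_cancel, ← Nat.cast_smul_eq_nsmul R]
      exact Submodule.smul_mem _ _ (Submodule.smul_mem_smul hpow trivial)

/-- At level `n` a differential is `g d(ψ X)`, and its image under `d/dX` is `g`. If this lies in `I
^ n`, so does the differential. -/
theorem differentialCoord_injective (hI : I = Ideal.span {ψ X}) :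
    Function.Injective (differentialCoord ψ I) := by
  rw [injective_iff_map_eq_zero]
  intro ω hω
  have h0 : AdicCompletion.map I (transportDerivation ψ).liftKaehlerDifferential ω = 0 := by
    apply (AdicCompletion.ofLinearEquiv I R).symm.injective
    rw [map_zero]
    exact hω
  apply AdicCompletion.ext
  intro n
  obtain ⟨x, hx⟩ := Submodule.Quotient.mk_surjective _ (ω.val n)
  obtain ⟨g, hg⟩ := exists_sub_smul_D_mem ψ I hI n x
  have h1 : (AdicCompletion.map I (transportDerivation ψ).liftKaehlerDifferential ω).val n = 0 := by
    rw [h0]; rfl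
  rw [AdicCompletion.map_val_apply, ← hx, LinearMap.reduceModIdeal_apply,
    Submodule.Quotient.mk_eq_zero] at h1
  have h2 : (transportDerivation ψ).liftKaehlerDifferential
      (x - g • KaehlerDifferential.D k R (ψ X)) ∈ (I ^ n • ⊤ : Submodule R R) := by
    have := Submodule.mem_map_of_mem (f := (transportDerivation ψ).liftKaehlerDifferential) hg
    rw [Submodule.map_smul''] at this
    exact Submodule.smul_mono le_rfl le_top this
  rw [map_sub, map_smul, Derivation.liftKaehlerDifferential_comp_D, transportDerivation_X,
    smul_eq_mul g 1, mul_one] at h2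
  have h3 : g ∈ I ^ n := by
    have := sub_mem h1 h2
    rwa [sub_sub_cancel, smul_eq_mul, Ideal.mul_top] at this
  have h4 : x ∈ (I ^ n • ⊤ : Submodule R (Ω[R⁄k])) := by
    have := add_mem hg (Submodule.smul_mem_smul h3
      (Submodule.mem_top (x := KaehlerDifferential.D k R (ψ X))))
    rwa [sub_add_cancel] at this
  rw [← hx, (Submodule.Quotient.mk_eq_zero _).2 h4]
  rfl

/-- The completed differentials of a power series ring are free on the differential of the
uniformizer. -/
noncomputable def differentialEquiv (hI : I = Ideal.span {ψ X}) :
    AdicCompletion I (Ω[R⁄k]) ≃ₗ[R] R :=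
  LinearEquiv.ofBijective (differentialCoord ψ I) ⟨differentialCoord_injective ψ I hI, fun g =>
    ⟨g • AdicCompletion.of I _ (KaehlerDifferential.D k R (ψ X)), by
      rw [map_smul, differentialCoord_of_D, transportDerivation_X, smul_eq_mul, mul_one]⟩⟩

theorem differentialEquiv_of_D (hI : I = Ideal.span {ψ X}) (x : R) :
    differentialEquiv ψ I hI (AdicCompletion.of I _ (KaehlerDifferential.D k R x)) =
      transportDerivation ψ x :=
  differentialCoord_of_D ψ I x

end CompletedDifferentials

/-! ### Finite residue rings and the trace form -/

section FiniteQuotient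

/-- Nonzero primes are maximal, so the quotient is Artinian; an Artinian algebra of finite type over
a field is finite over it. -/
theorem finite_quotient_of_finiteType (Fq : Type*) {A : Type*} [Field Fq] [Finite Fq] [CommRing A]
    [IsDedekindDomain A] [Algebra Fq A] [Algebra.FiniteType Fq A] {I : Ideal A} (hI : I ≠ ⊥) :
    Finite (A ⧸ I) := by
  have : IsArtinianRing (A ⧸ I) := by
    rw [isArtinianRing_iff_isNoetherianRing_krullDimLE_zero]
    refine ⟨inferInstance,
      Ideal.krullDimLE_zero_quotient_iff_forall_minimalPrimes_isMaximal.2 fun J hJ => ?_⟩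
    exact hJ.1.1.isMaximal fun h => hI (le_bot_iff.1 (h ▸ hJ.1.2))
  have : Module.Finite Fq (A ⧸ I) := (Module.finite_iff_isArtinianRing Fq (A ⧸ I)).2 this
  exact Module.finite_of_finite Fq

end FiniteQuotient

section Trace

/-- Nondegeneracy of the trace form. Being a field is a hypothesis on `k` because the residue field
enters as a subring of the completion. -/
theorem exists_trace_mul_eq {F k : Type*} [Field F] [Finite F] [CommRing k] [Finite k]
    (hk : IsField k) [Algebra F k] (f : k →ₗ[F] F) : ∃ c : k, ∀ x, f x = Algebra.trace F k (c * x) := by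
  let : Field k := hk.toField
  have : Module.Finite F k := inferInstance
  obtain ⟨c, hc⟩ := ((Algebra.traceForm F k).toDual (traceForm_nondegenerate F k)).surjective f
  exact ⟨c, fun x => by rw [← hc, LinearMap.BilinForm.toDual_def, Algebra.traceForm_apply]⟩

end Trace

/-! ### The coefficient field of the completion -/

section Local

open IsLocalRing HeightOneSpectrum

variable (Fq : Type*) {A : Type*} (K : Type*) [Field Fq] [CommRing A] [IsDedekindDomain A]
  [Field K] [Algebra Fq A] [Algebra A K] [IsFractionRing A K] (v : HeightOneSpectrum A)

theorem mk_comp_algebraMap_surjective :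
    Function.Surjective ((Ideal.Quotient.mk (maximalIdeal (v.adicCompletionIntegers K))).comp
      (algebraMap A (v.adicCompletionIntegers K))) := by
  intro x
  obtain ⟨x, rfl⟩ := Ideal.Quotient.mk_surjective x
  obtain ⟨a, ha⟩ := exists_algebraMap_sub_mem_maximalIdeal K v x
  exact ⟨a, ((Ideal.Quotient.eq).2 ha).symm⟩

theorem finite_quotient_maximalIdeal [Finite (A ⧸ v.asIdeal)] :
    Finite (v.adicCompletionIntegers K ⧸ maximalIdeal (v.adicCompletionIntegers K)) := by
  have hle : v.asIdeal ≤ RingHom.ker ((Ideal.Quotient.mk (maximalIdeal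
      (v.adicCompletionIntegers K))).comp (algebraMap A (v.adicCompletionIntegers K))) := by
    intro a ha
    rw [RingHom.mem_ker, RingHom.comp_apply, Ideal.Quotient.eq_zero_iff_mem]
    exact (algebraMap_mem_maximalIdeal_iff K v a).2 ha
  exact Finite.of_surjective (Ideal.Quotient.lift _ _ hle)
    (Ideal.Quotient.lift_surjective_of_surjective _ hle (mk_comp_algebraMap_surjective K v))

/-- Teichmüller lifts: with `Q` the order of the residue field, Hensel's lemma applies to `X^Q - X`,
whose derivative is `-1` modulo the maximal ideal. The lift is integral over `Fq` because it is a
root of this polynomial. -/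
theorem mk_comp_residueSubfield_surjective [Finite (A ⧸ v.asIdeal)] :
    Function.Surjective ((Ideal.Quotient.mk (maximalIdeal (v.adicCompletionIntegers K))).comp
      (algebraMap (residueSubfield Fq K v) (v.adicCompletionIntegers K))) := by
  intro x
  obtain ⟨a₀, rfl⟩ := Ideal.Quotient.mk_surjective x
  have := finite_quotient_maximalIdeal K v
  let : Field (v.adicCompletionIntegers K ⧸ maximalIdeal (v.adicCompletionIntegers K)) :=
    Ideal.Quotient.field _
  let := Fintype.ofFinite (v.adicCompletionIntegers K ⧸ maximalIdeal (v.adicCompletionIntegers K))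
  let Q := Fintype.card (v.adicCompletionIntegers K ⧸ maximalIdeal (v.adicCompletionIntegers K))
  have hQ : 1 < Q := Fintype.one_lt_card
  have hQ0 : Ideal.Quotient.mk (maximalIdeal (v.adicCompletionIntegers K))
      ((Q : ℕ) : v.adicCompletionIntegers K) = 0 := by
    rw [map_natCast]
    exact FiniteField.cast_card_eq_zero _
  let f : (v.adicCompletionIntegers K)[X] := Polynomial.X ^ Q - Polynomial.X
  have hf : f.Monic := Polynomial.monic_X_pow_sub (by rw [Polynomial.degree_X]; exact_mod_cast hQ)
  obtain ⟨a, ha, ha'⟩ := HenselianRing.is_henselian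
    (I := maximalIdeal (v.adicCompletionIntegers K)) f hf a₀ (by
      rw [← Ideal.Quotient.eq_zero_iff_mem]
      simp only [f, Polynomial.eval_sub, Polynomial.eval_pow, Polynomial.eval_X, map_sub, map_pow]
      rw [FiniteField.pow_card, sub_self]) (by
      simp only [f, Polynomial.derivative_X_pow, Polynomial.derivative_X,
        Polynomial.eval_sub, Polynomial.eval_mul, Polynomial.eval_pow, Polynomial.eval_X,
        Polynomial.eval_one, Polynomial.eval_C, map_sub, map_mul, hQ0, zero_mul, zero_sub, map_one]
      exact isUnit_one.neg)
  refine ⟨⟨a, Polynomial.X ^ Q - Polynomial.X,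
    Polynomial.monic_X_pow_sub (by rw [Polynomial.degree_X]; exact_mod_cast hQ), ?_⟩, ?_⟩
  · simpa [f] using ha
  · exact (Ideal.Quotient.eq).2 ha'

/-- A nonzero element integral over `Fq` cannot lie in the maximal ideal: its minimal equation would
put the constant coefficient, a unit, there as well. -/
theorem mk_comp_residueSubfield_injective :
    Function.Injective ((Ideal.Quotient.mk (maximalIdeal (v.adicCompletionIntegers K))).comp
      (algebraMap (residueSubfield Fq K v) (v.adicCompletionIntegers K))) := by
  rw [injective_iff_map_eq_zero]
  rintro ⟨x, hx⟩ h
  rw [RingHom.comp_apply, Ideal.Quotient.eq_zero_iff_mem] at h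
  change x ∈ _ at h
  by_contra hne
  have hx0 : x ≠ 0 := fun h0 => hne (Subtype.ext h0)
  let := (constantsMap Fq K v).toAlgebra
  have hint : IsIntegral Fq x := hx
  have h0 := minpoly.coeff_zero_ne_zero hint hx0
  have h1 := minpoly.aeval Fq x
  obtain ⟨p, hp⟩ := Polynomial.X_dvd_sub_C (p := minpoly Fq x)
  rw [sub_eq_iff_eq_add] at hp
  rw [hp, map_add, map_mul, Polynomial.aeval_X, Polynomial.aeval_C] at h1
  have h2 : algebraMap Fq (v.adicCompletionIntegers K) ((minpoly Fq x).coeff 0) ∈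
      maximalIdeal (v.adicCompletionIntegers K) := by
    rw [eq_neg_of_add_eq_zero_right h1]
    exact neg_mem (Ideal.mul_mem_right _ _ h)
  exact h2 ((isUnit_iff_ne_zero.2 h0).map (algebraMap Fq (v.adicCompletionIntegers K)))

theorem mk_comp_residueSubfield_bijective [Finite (A ⧸ v.asIdeal)] :
    Function.Bijective ((Ideal.Quotient.mk (maximalIdeal (v.adicCompletionIntegers K))).comp
      (algebraMap (residueSubfield Fq K v) (v.adicCompletionIntegers K))) :=
  ⟨mk_comp_residueSubfield_injective Fq K v, mk_comp_residueSubfield_surjective Fq K v⟩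

theorem residueSubfield_isField [Finite (A ⧸ v.asIdeal)] : IsField (residueSubfield Fq K v) :=
  (RingEquiv.ofBijective _ (mk_comp_residueSubfield_bijective Fq K v)).toMulEquiv.isField
    (Ideal.Quotient.field _).toIsField

theorem finite_residueSubfield [Finite (A ⧸ v.asIdeal)] : Finite (residueSubfield Fq K v) :=
  have := finite_quotient_maximalIdeal K v
  Finite.of_injective _ (mk_comp_residueSubfield_injective Fq K v)

variable {K v} in
/-- A uniformizer identifies `A_𝔭` with the power series ring over its residue field. -/
theorem exists_powerSeries_algEquiv [Finite (A ⧸ v.asIdeal)] {ϖ : v.adicCompletionIntegers K}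
    (hϖ : maximalIdeal (v.adicCompletionIntegers K) = Ideal.span {ϖ}) :
    ∃ ψ : PowerSeries (residueSubfield Fq K v) ≃ₐ[residueSubfield Fq K v]
      v.adicCompletionIntegers K, ψ PowerSeries.X = ϖ := by
  have hϖ0 : ϖ ∈ nonZeroDivisors (v.adicCompletionIntegers K) := by
    refine mem_nonZeroDivisors_of_ne_zero fun h => ?_
    rw [h, Ideal.span_singleton_eq_bot.2 rfl] at hϖ
    exact IsDiscreteValuationRing.not_a_field _ hϖ
  have hb := mk_comp_residueSubfield_bijective Fq K v
  have hc : IsAdicComplete (maximalIdeal (v.adicCompletionIntegers K))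
    (v.adicCompletionIntegers K) := inferInstance
  rw [hϖ] at hb hc
  exact ⟨AlgEquiv.ofRingEquiv (f := PowerSeries.adicEvalEquiv ϖ hϖ0 hb)
    fun c => PowerSeries.adicEval_C ϖ c, PowerSeries.adicEval_X ϖ⟩

end Local

/-! ### Residues and the trace pairing with `A` -/

section Residues

open IsLocalRing HeightOneSpectrum PowerSeries

variable {Fq : Type*} {A : Type*} {K : Type*} [Field Fq] [CommRing A] [IsDedekindDomain A]
  [Field K] [Algebra Fq A] [Algebra A K] [IsFractionRing A K] {v : HeightOneSpectrum A}

theorem hasFinitePoles_adicCompletion {ψ : PowerSeries (residueSubfield Fq K v)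
    ≃ₐ[residueSubfield Fq K v] v.adicCompletionIntegers K}
    (hψ : maximalIdeal (v.adicCompletionIntegers K) = Ideal.span {ψ X}) :
    HasFinitePoles (v.adicCompletion K) ψ := by
  intro z
  obtain ⟨r, s, hs, rfl⟩ := IsFractionRing.div_surjective (A := v.adicCompletionIntegers K) z
  have hs0 := nonZeroDivisors.ne_zero hs
  have hirr : Irreducible (ψ X) :=
    (IsDiscreteValuationRing.irreducible_iff_uniformizer _).2 hψ
  obtain ⟨n, u, hu⟩ := IsDiscreteValuationRing.eq_unit_mul_pow_irreducible hs0 hirr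
  refine ⟨n, r * (u⁻¹ : (v.adicCompletionIntegers K)ˣ), ?_⟩
  have hu' : algebraMap _ (v.adicCompletion K) ((u⁻¹ : (v.adicCompletionIntegers K)ˣ) :
      v.adicCompletionIntegers K) * algebraMap _ (v.adicCompletion K) s =
      algebraMap _ (v.adicCompletion K) (ψ X) ^ n := by
    rw [← map_mul, hu, Units.inv_mul_cancel_left, map_pow]
  have hs1 : algebraMap _ (v.adicCompletion K) s ≠ 0 :=
    fun h => hs0 (FaithfulSMul.algebraMap_injective _ (v.adicCompletion K) (by rw [h, map_zero]))
  rw [map_mul, ← hu']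
  field_simp

variable {ψ : PowerSeries (residueSubfield Fq K v)
    ≃ₐ[residueSubfield Fq K v] v.adicCompletionIntegers K}
    (hψ : maximalIdeal (v.adicCompletionIntegers K) = Ideal.span {ψ X})

variable (ψ) in
/-- The coordinate `g` of `g dϖ`. -/
noncomputable def contDifferentialsEquiv
    (hψ : maximalIdeal (v.adicCompletionIntegers K) = Ideal.span {ψ X}) :
    ContDifferentials Fq K v ≃ₗ[v.adicCompletionIntegers K] v.adicCompletionIntegers K :=
  differentialEquiv ψ _ hψ

theorem contDifferentialsEquiv_contD (x : v.adicCompletionIntegers K) :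
    contDifferentialsEquiv ψ hψ (contD Fq K v x) = transportDerivation ψ x :=
  differentialEquiv_of_D ψ _ hψ x

/-- `IsResidue` admits every uniformizer, so the forward direction is the invariance of residues;
the converse uses the fixed uniformizer `ψ X`. -/
theorem isResidue_iff (y : v.adicCompletion K) (ω : ContDifferentials Fq K v)
    (c : residueSubfield Fq K v) : IsResidue Fq K v y ω c ↔
      c = laurentResidue (hasFinitePoles_adicCompletion hψ)
        (y * (contDifferentialsEquiv ψ hψ ω : v.adicCompletionIntegers K)) := by
  constructor
  · rintro ⟨ϖ, g, hϖ, rfl, P, r, hP, rfl⟩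
    obtain ⟨u, hu⟩ := Ideal.span_singleton_eq_span_singleton.1 (hψ.symm.trans hϖ)
    have key := laurentResidue_aeval_inv_mul_derivation (hasFinitePoles_adicCompletion hψ)
      (u.inv_mul) P
    rw [hu] at key
    rw [← key, map_smul, contDifferentialsEquiv_contD, smul_eq_mul]
    have h2 : y * ((g * transportDerivation ψ ϖ : v.adicCompletionIntegers K) :
        v.adicCompletion K) = algebraMap (v.adicCompletionIntegers K) (v.adicCompletion K)
          (r * transportDerivation ψ ϖ) + Polynomial.aeval (algebraMap (v.adicCompletionIntegers K)
          (v.adicCompletion K) ϖ)⁻¹ P * algebraMap (v.adicCompletionIntegers K)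
          (v.adicCompletion K) (transportDerivation ψ ϖ) := by
      rw [map_mul, ← add_mul]
      push_cast
      rw [← mul_assoc, hP]
      rfl
    rw [h2, map_add, laurentResidue_algebraMap, zero_add]
  · rintro rfl
    obtain ⟨P, r, h⟩ := exists_eq_add_aeval_inv (hasFinitePoles_adicCompletion hψ)
        (y * (contDifferentialsEquiv ψ hψ ω : v.adicCompletionIntegers K))
    refine ⟨ψ X, contDifferentialsEquiv ψ hψ ω, hψ, ?_, P, r, h, ?_⟩
    · apply (contDifferentialsEquiv ψ hψ).injective
      rw [map_smul, contDifferentialsEquiv_contD, transportDerivation_X, smul_eq_mul, mul_one]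
    · have key := laurentResidue_aeval_inv_mul_derivation (hasFinitePoles_adicCompletion hψ)
        (one_mul (1 : v.adicCompletionIntegers K)) P
      rw [mul_one, transportDerivation_X, map_one, mul_one] at key
      rw [h, map_add, laurentResidue_algebraMap, zero_add, key]

theorem residue_eq (y : v.adicCompletion K) (ω : ContDifferentials Fq K v) :
    _root_.residue Fq K v y ω = laurentResidue (hasFinitePoles_adicCompletion hψ)
        (y * (contDifferentialsEquiv ψ hψ ω : v.adicCompletionIntegers K)) := by
  have h : ∃ c, IsResidue Fq K v y ω c := ⟨_, (isResidue_iff hψ y ω _).2 rfl⟩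
  rw [_root_.residue, dif_pos h]
  exact (isResidue_iff hψ y ω _).1 h.choose_spec

variable (ψ) in
/-- The constant coefficient of the expansion of an element of `A` in powers of a uniformizer. -/
noncomputable def constantTerm : A →+* residueSubfield Fq K v :=
  (constantCoeff).comp ((ψ.symm : v.adicCompletionIntegers K →+* _).comp
    (algebraMap A (v.adicCompletionIntegers K)))

theorem constantTerm_algebraMap (c : Fq) :
    constantTerm ψ (algebraMap Fq A c) = algebraMap Fq (residueSubfield Fq K v) c :=
  (congrArg constantCoeff (ψ.symm.commutes (algebraMap Fq (residueSubfield Fq K v) c))).trans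
    (constantCoeff_C _)

include hψ in
theorem constantCoeff_symm_eq_zero_iff (r : v.adicCompletionIntegers K) :
    constantCoeff (ψ.symm r) = 0 ↔ r ∈ maximalIdeal (v.adicCompletionIntegers K) := by
  obtain ⟨f, rfl⟩ := ψ.surjective r
  rw [AlgEquiv.symm_apply_apply, ← X_dvd_iff, hψ, Ideal.mem_span_singleton, map_dvd_iff]

include hψ in
theorem constantTerm_eq_zero_iff (x : A) : constantTerm ψ x = 0 ↔ x ∈ v.asIdeal :=
  (constantCoeff_symm_eq_zero_iff hψ _).trans (algebraMap_mem_maximalIdeal_iff K v x)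

include hψ in
theorem constantTerm_surjective : Function.Surjective (constantTerm ψ) := by
  intro c
  obtain ⟨x, hx⟩ := exists_algebraMap_sub_mem_maximalIdeal K v
    (algebraMap (residueSubfield Fq K v) (v.adicCompletionIntegers K) c)
  rw [← constantCoeff_symm_eq_zero_iff hψ, map_sub, map_sub, sub_eq_zero, AlgEquiv.commutes] at hx
  exact ⟨x, hx.symm.trans (constantCoeff_C c)⟩

variable (ψ) in
/-- The functional `x ↦ tr (res (x z dϖ))` on `A`. -/
noncomputable def residuePairing
    (hψ : maximalIdeal (v.adicCompletionIntegers K) = Ideal.span {ψ X}) :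
    v.adicCompletion K →+ Module.Dual Fq A where
  toFun z :=
    { toFun x := Algebra.trace Fq (residueSubfield Fq K v)
        (laurentResidue (hasFinitePoles_adicCompletion hψ) (algebraMap A (v.adicCompletion K) x * z))
      map_add' x y := by rw [map_add, add_mul, map_add, map_add]
      map_smul' c x := by
        have : algebraMap A (v.adicCompletion K) (c • x) =
            (algebraMap Fq (residueSubfield Fq K v) c) • algebraMap A (v.adicCompletion K) x := by
          rw [Algebra.smul_def, map_mul]
          rfl
        rw [this, smul_mul_assoc, map_smul, smul_eq_mul, ← Algebra.smul_def, map_smul]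
        rfl }
  map_zero' := by ext x; simp
  map_add' z w := by ext x; simp [mul_add]

theorem residuePairing_apply (z : v.adicCompletion K) (x : A) :
    residuePairing ψ hψ z x = Algebra.trace Fq (residueSubfield Fq K v)
      (laurentResidue (hasFinitePoles_adicCompletion hψ)
        (algebraMap A (v.adicCompletion K) x * z)) := rfl

theorem residuePairing_integer (r : v.adicCompletionIntegers K) :
    residuePairing ψ hψ r = 0 := by
  ext x
  have : algebraMap A (v.adicCompletion K) x * r = algebraMap (v.adicCompletionIntegers K)
      (v.adicCompletion K) (algebraMap A _ x * r) := rfl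
  rw [residuePairing_apply, this, laurentResidue_algebraMap, map_zero]
  rfl

theorem residuePairing_mul (x y : A) (z : v.adicCompletion K) :
    residuePairing ψ hψ (algebraMap A (v.adicCompletion K) x * z) y =
      residuePairing ψ hψ z (x * y) := by
  rw [residuePairing_apply, residuePairing_apply, map_mul (algebraMap A _), ← mul_assoc,
    mul_comm (algebraMap A _ y)]

theorem residuePairing_residue (y : v.adicCompletion K) (ω : ContDifferentials Fq K v) (x : A) :
    Algebra.trace Fq (residueSubfield Fq K v)
      (_root_.residue Fq K v (y * algebraMap A (v.adicCompletion K) x) ω) =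
        residuePairing ψ hψ (y * (contDifferentialsEquiv ψ hψ ω : v.adicCompletionIntegers K)) x := by
  rw [residue_eq hψ, mul_right_comm, mul_comm, residuePairing_apply]

/-- The differential has at most a simple pole, so its residue is the constant term of the
numerator. The pairing becomes the trace form of the residue field. -/
theorem residuePairing_inv_uniformizer {a : A}
    (hψa : ψ X = algebraMap A (v.adicCompletionIntegers K) a)
    (ha : algebraMap A (v.adicCompletion K) a ≠ 0) (u x : A) :
    residuePairing ψ hψ (algebraMap A (v.adicCompletion K) u *
      (algebraMap A (v.adicCompletion K) a)⁻¹) x =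
      Algebra.trace Fq (residueSubfield Fq K v) (constantTerm ψ u * constantTerm ψ x) := by
  have hz : algebraMap A (v.adicCompletion K) x * (algebraMap A (v.adicCompletion K) u *
      (algebraMap A (v.adicCompletion K) a)⁻¹) * algebraMap (v.adicCompletionIntegers K)
      (v.adicCompletion K) (ψ X) ^ (0 + 1) = algebraMap (v.adicCompletionIntegers K)
      (v.adicCompletion K) (algebraMap A _ (u * x)) := by
    rw [hψa]
    change algebraMap A (v.adicCompletion K) x * _ * algebraMap A (v.adicCompletion K) a ^ (0 + 1)
      = algebraMap A (v.adicCompletion K) (u * x)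
    rw [map_mul, mul_assoc, mul_assoc, zero_add, pow_one, inv_mul_cancel₀ ha, mul_one, mul_comm]
  have hmul : constantTerm ψ u * constantTerm ψ x =
      coeff 0 (ψ.symm (algebraMap A (v.adicCompletionIntegers K) (u * x))) :=
    (map_mul (constantTerm ψ) u x).symm.trans (coeff_zero_eq_constantCoeff_apply _).symm
  rw [hmul, residuePairing_apply, laurentResidue_eq (hasFinitePoles_adicCompletion hψ) hz]

/-- A functional killing `𝔭` factors through the residue field, where it is `tr(c ·)` for some `c`;
a lift of `c` to `A` is the required `u`. -/
theorem exists_eq_residuePairing [Finite Fq] [Finite (A ⧸ v.asIdeal)] {a : A}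
    (hψa : ψ X = algebraMap A (v.adicCompletionIntegers K) a)
    (ha : algebraMap A (v.adicCompletion K) a ≠ 0) {l : Module.Dual Fq A}
    (hl : ∀ x ∈ v.asIdeal, l x = 0) : ∃ u : A, l = residuePairing ψ hψ
      (algebraMap A (v.adicCompletion K) u * (algebraMap A (v.adicCompletion K) a)⁻¹) := by
  let π : A →ₗ[Fq] residueSubfield Fq K v :=
    { constantTerm ψ with
      map_smul' c x := by
        change constantTerm ψ (c • x) = c • constantTerm ψ x
        rw [Algebra.smul_def, Algebra.smul_def, map_mul, constantTerm_algebraMap] }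
  have hπ : Function.Surjective π := constantTerm_surjective hψ
  have hker : LinearMap.ker π ≤ LinearMap.ker l := fun x hx =>
    hl x ((constantTerm_eq_zero_iff hψ x).1 hx)
  have := finite_residueSubfield Fq K v
  obtain ⟨c, hc⟩ := exists_trace_mul_eq (residueSubfield_isField Fq K v)
    ((LinearMap.ker π).liftQ l hker ∘ₗ (π.quotKerEquivOfSurjective hπ).symm.toLinearMap)
  obtain ⟨u, rfl⟩ := hπ c
  refine ⟨u, LinearMap.ext fun x => ?_⟩
  have h1 := hc (π x)
  have h2 : (π.quotKerEquivOfSurjective hπ).symm (π x) = Submodule.Quotient.mk x := by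
    rw [LinearEquiv.symm_apply_eq]
    rfl
  rw [LinearMap.comp_apply, LinearEquiv.coe_toLinearMap, h2, Submodule.liftQ_apply] at h1
  rw [h1, residuePairing_inv_uniformizer hψ hψa ha]
  rfl

variable (Fq K v) in
/-- The residue pairing in terms of a coordinate on the differentials. -/
theorem exists_residue_pairing [Finite Fq] [Finite (A ⧸ v.asIdeal)] {a : A}
    (ha : v.intValuation a = WithZero.exp (-1 : ℤ)) :
    ∃ (G : ContDifferentials Fq K v ≃ₗ[v.adicCompletionIntegers K] v.adicCompletionIntegers K)
      (Λ : v.adicCompletion K →+ Module.Dual Fq A),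
      (∀ y ω x, Algebra.trace Fq (residueSubfield Fq K v)
        (_root_.residue Fq K v (y * algebraMap A (v.adicCompletion K) x) ω) =
          Λ (y * (G ω : v.adicCompletionIntegers K)) x) ∧
      (∀ r : v.adicCompletionIntegers K, Λ r = 0) ∧
      (∀ (x y : A) (z : v.adicCompletion K), Λ (algebraMap A (v.adicCompletion K) x * z) y =
        Λ z (x * y)) ∧
      (∀ l : Module.Dual Fq A, (∀ x ∈ v.asIdeal, l x = 0) → ∃ u : A,
        l = Λ (algebraMap A (v.adicCompletion K) u * (algebraMap A (v.adicCompletion K) a)⁻¹)) := by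
  obtain ⟨ψ, hψa⟩ := exists_powerSeries_algEquiv Fq (maximalIdeal_eq_span_of_intValuation_eq K v ha)
  have hψ : maximalIdeal (v.adicCompletionIntegers K) = Ideal.span {ψ X} := by
    rw [hψa, maximalIdeal_eq_span_of_intValuation_eq K v ha]
  have ha0 : algebraMap A (v.adicCompletion K) a ≠ 0 := by
    intro h0
    have h3 := valued_algebraMap K v a
    rw [show ((algebraMap A (v.adicCompletionIntegers K) a : v.adicCompletionIntegers K) :
      v.adicCompletion K) = algebraMap A (v.adicCompletion K) a from rfl, h0, ha, map_zero] at h3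
    exact WithZero.exp_ne_zero h3.symm
  exact ⟨contDifferentialsEquiv ψ hψ, residuePairing ψ hψ, residuePairing_residue hψ,
    residuePairing_integer hψ, residuePairing_mul hψ,
    fun l hl => exists_eq_residuePairing hψ hψa ha0 hl⟩

end Residues

/-! ### Continuous linear maps on the dual of `A` -/

section DualContinuous

variable {Fq A V : Type*} [Field Fq] [CommRing A] [Algebra Fq A] [AddCommGroup V]
  [TopologicalSpace V] [Module Fq V]

/-- Continuity at `0` of a linear map on the dual space of `A`, for the topology of pointwise
convergence. -/
def IsDualContinuous (f : Module.Dual Fq A →ₗ[Fq] V) : Prop :=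
  ∀ U ∈ 𝓝 (0 : V), ∃ s : Finset A, ∀ l : Module.Dual Fq A, (∀ x ∈ s, l x = 0) → f l ∈ U

/-- The partial sums of `∑ l(bᵢ) bᵢ^*` agree with `l` on a given finite set as soon as they involve
all basis vectors occurring there, so they converge pointwise to `l`. -/
theorem IsDualContinuous.hasSum [IsTopologicalAddGroup V] {f : Module.Dual Fq A →ₗ[Fq] V}
    (hf : IsDualContinuous f)
    {ι : Type*} (b : Module.Basis ι Fq A) (l : Module.Dual Fq A) :
    HasSum (fun i => l (b i) • f (b.coord i)) (f l) := by
  classical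
  rw [HasSum, SummationFilter.unconditional_filter, ← tendsto_sub_nhds_zero_iff]
  intro U hU
  obtain ⟨s, hs⟩ := hf U hU
  rw [mem_map, mem_atTop_sets]
  refine ⟨s.biUnion fun x => (b.repr x).support, fun S hS => ?_⟩
  have : (∑ i ∈ S, l (b i) • f (b.coord i)) - f l = f ((∑ i ∈ S, l (b i) • b.coord i) - l) := by
    simp
  rw [Set.mem_preimage, this]
  apply hs
  intro x hx
  have h1 : l x = ∑ i ∈ S, b.repr x i * l (b i) := by
    conv_lhs => rw [← b.linearCombination_repr x, Finsupp.linearCombination_apply, map_finsuppSum,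
      Finsupp.sum]
    simp only [map_smul, smul_eq_mul]
    refine Finset.sum_subset (fun i hi => hS (Finset.mem_biUnion.2 ⟨x, hx, hi⟩)) fun i _ hi => ?_
    rw [Finsupp.notMem_support_iff.1 hi, zero_mul]
  rw [LinearMap.sub_apply, h1, LinearMap.sum_apply, sub_eq_zero]
  exact Finset.sum_congr rfl fun i _ => mul_comm _ _

theorem IsDualContinuous.eq_zero [IsTopologicalAddGroup V] [T2Space V]
    {f : Module.Dual Fq A →ₗ[Fq] V} (hf : IsDualContinuous f)
    {ι : Type*} (b : Module.Basis ι Fq A) (h : ∀ i, f (b.coord i) = 0) : f = 0 := by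
  ext l
  refine (hf.hasSum b l).unique ?_
  simp only [h, smul_zero]
  exact hasSum_zero

theorem IsDualContinuous.comp_dualMap {f : Module.Dual Fq A →ₗ[Fq] V} (hf : IsDualContinuous f)
    (g : A →ₗ[Fq] A) : IsDualContinuous (f ∘ₗ g.dualMap) := by
  classical
  intro U hU
  obtain ⟨s, hs⟩ := hf U hU
  exact ⟨s.image g, fun l hl => hs _ fun x hx => hl _ (Finset.mem_image_of_mem g hx)⟩

theorem IsDualContinuous.add [IsTopologicalAddGroup V] {f g : Module.Dual Fq A →ₗ[Fq] V}
    (hf : IsDualContinuous f)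
    (hg : IsDualContinuous g) : IsDualContinuous (f + g) := by
  classical
  intro U hU
  have h : Tendsto (fun p : V × V => p.1 + p.2) (𝓝 (0, 0)) (𝓝 0) := by
    simpa using (continuous_add (M := V)).tendsto (0, 0)
  have h2 := h hU
  rw [mem_map, nhds_prod_eq, mem_prod_iff] at h2
  obtain ⟨U₁, hU₁, U₂, hU₂, hsub⟩ := h2
  obtain ⟨s, hs⟩ := hf U₁ hU₁
  obtain ⟨t, ht⟩ := hg U₂ hU₂
  exact ⟨s ∪ t, fun l hl => hsub (a := (f l, g l)) ⟨hs l fun x hx => hl x (Finset.mem_union_left _ hx),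
    ht l fun x hx => hl x (Finset.mem_union_right _ hx)⟩⟩

theorem IsDualContinuous.smul {S : Type*} [Monoid S] [DistribMulAction S V] [SMulCommClass Fq S V]
    [ContinuousConstSMul S V] {f : Module.Dual Fq A →ₗ[Fq] V} (hf : IsDualContinuous f) (c : S) :
    IsDualContinuous (c • f) := by
  intro U hU
  have h : Tendsto (fun x : V => c • x) (𝓝 0) (𝓝 0) := by
    simpa using (continuous_const_smul c).tendsto (0 : V)
  obtain ⟨s, hs⟩ := hf _ (h hU)
  exact ⟨s, fun l hl => hs l hl⟩

theorem IsDualContinuous.tendsto_coord {f : Module.Dual Fq A →ₗ[Fq] V} (hf : IsDualContinuous f)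
    {ι : Type*} (b : Module.Basis ι Fq A) : Tendsto (fun i => f (b.coord i)) cofinite (𝓝 0) := by
  classical
  intro U hU
  obtain ⟨s, hs⟩ := hf U hU
  have hfin : ((s.biUnion fun x => (b.repr x).support : Finset ι) : Set ι).Finite :=
    Finset.finite_toSet _
  refine mem_map.2 (mem_of_superset hfin.compl_mem_cofinite fun i hi => hs _ fun x hx => ?_)
  by_contra hne
  exact hi (Finset.mem_coe.2 (Finset.mem_biUnion.2 ⟨x, hx, Finsupp.mem_support_iff.2 hne⟩))

theorem isDualContinuous_zero : IsDualContinuous (0 : Module.Dual Fq A →ₗ[Fq] V) :=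
  fun _ hU => ⟨∅, fun _ _ => mem_of_mem_nhds hU⟩

section OfBasis

variable [NonarchimedeanAddGroup V] [Finite Fq]
  [ContinuousConstSMul Fq V]

/-- `Fq` is finite, so the preimages of an open subgroup under all scalars still intersect in a
neighbourhood of `0`. This makes `c i • h i` small uniformly in the coefficients. -/
theorem exists_openAddSubgroup_forall_smul_mem {U : Set V} (hU : U ∈ 𝓝 0) :
    ∃ (W : OpenAddSubgroup V) (W' : Set V), (W : Set V) ⊆ U ∧ W' ∈ 𝓝 0 ∧
      ∀ x ∈ W', ∀ c : Fq, c • x ∈ W := by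
  obtain ⟨W, hW⟩ := NonarchimedeanAddGroup.is_nonarchimedean U hU
  refine ⟨W, ⋂ c : Fq, {x | c • x ∈ W}, hW, ?_, fun x hx c => Set.mem_iInter.1 hx c⟩
  refine (Filter.iInter_mem).2 fun c => ?_
  have h : Tendsto (fun x : V => c • x) (𝓝 0) (𝓝 0) := by
    simpa using (continuous_const_smul c).tendsto (0 : V)
  exact h W.mem_nhds_zero

theorem tendsto_smul_cofinite_zero {ι : Type*} {h : ι → V} (hh : Tendsto h cofinite (𝓝 0))
    (c : ι → Fq) : Tendsto (fun i => c i • h i) cofinite (𝓝 0) := by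
  intro U hU
  obtain ⟨W, W', hWU, hW', hW⟩ := exists_openAddSubgroup_forall_smul_mem (Fq := Fq) hU
  have h1 : {i | h i ∈ W'} ∈ cofinite := hh hW'
  refine mem_map.2 (mem_of_superset h1 fun i hi => ?_)
  exact hWU (hW _ hi _)

end OfBasis

end DualContinuous

section EvalBasis

variable {Fq A V : Type*} [Field Fq] [CommRing A] [Algebra Fq A] [AddCommGroup V]
  [UniformSpace V] [Module Fq V] [IsUniformAddGroup V] [NonarchimedeanAddGroup V] [T2Space V]
  [CompleteSpace V] [Finite Fq] [ContinuousConstSMul Fq V]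
  {ι : Type*} (b : Module.Basis ι Fq A) {h : ι → V} (hh : Tendsto h cofinite (𝓝 0))

omit [T2Space V] in
include hh in
theorem summable_dual_smul (l : Module.Dual Fq A) : Summable fun i => l (b i) • h i :=
  NonarchimedeanAddGroup.summable_of_tendsto_cofinite_zero
    (tendsto_smul_cofinite_zero hh fun i => l (b i))

/-- The continuous linear map on the dual of `A` with prescribed values on the dual basis. -/
noncomputable def dualEval : Module.Dual Fq A →ₗ[Fq] V where
  toFun l := ∑' i, l (b i) • h i
  map_add' l l' := by
    rw [← (summable_dual_smul b hh l).tsum_add (summable_dual_smul b hh l')]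
    simp only [LinearMap.add_apply, add_smul]
  map_smul' c l := by
    rw [RingHom.id_apply, ← (summable_dual_smul b hh l).tsum_const_smul c]
    simp only [LinearMap.smul_apply, smul_assoc]

theorem dualEval_hasSum (l : Module.Dual Fq A) :
    HasSum (fun i => l (b i) • h i) (dualEval b hh l) :=
  (summable_dual_smul b hh l).hasSum

theorem dualEval_coord (i : ι) : dualEval b hh (b.coord i) = h i := by
  classical
  refine (dualEval_hasSum b hh _).unique ?_
  convert hasSum_ite_eq i (h i) using 2 with j
  by_cases hij : j = i
  · subst hij; simp
  · simp [hij]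

/-- Only finitely many `h i` are not small. A functional vanishing at those `b i` has all its terms
in an open subgroup, which is closed and so contains the sum. -/
theorem isDualContinuous_dualEval : IsDualContinuous (dualEval b hh) := by
  classical
  intro U hU
  obtain ⟨W, W', hWU, hW', hW⟩ := exists_openAddSubgroup_forall_smul_mem (Fq := Fq) hU
  have hfin : {i | h i ∉ W'}.Finite := hh hW'
  refine ⟨hfin.toFinset.image b, fun l hl => hWU ?_⟩
  refine W.isClosed.mem_of_tendsto (dualEval_hasSum b hh l) (Eventually.of_forall fun S => ?_)
  refine W.toAddSubgroup.sum_mem fun i _ => ?_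
  by_cases hi : h i ∈ W'
  · exact hW _ hi _
  · rw [hl _ (Finset.mem_image_of_mem b (hfin.mem_toFinset.2 hi)), zero_smul]
    exact W.zero_mem

end EvalBasis

/-! ### Continuous `A`-linear maps on the dual and their reduction at a prime -/

section DualHom

variable (Fq A V : Type*) [Field Fq] [CommRing A] [Algebra Fq A] [AddCommGroup V]
  [TopologicalSpace V] [IsTopologicalAddGroup V] [Module Fq V] [Module A V] [SMulCommClass Fq A V]
  [ContinuousConstSMul A V]

/-- The continuous `A`-linear maps from the `Fq`-dual of `A` to `V`. -/
def dualHom : Submodule A (Module.Dual Fq A →ₗ[Fq] V) where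
  carrier := {f | IsDualContinuous f ∧
    ∀ (a : A) (l : Module.Dual Fq A), f ((LinearMap.mulLeft Fq a).dualMap l) = a • f l}
  zero_mem' := ⟨isDualContinuous_zero, fun a l => by simp⟩
  add_mem' := fun hf hg => ⟨hf.1.add hg.1, fun a l => by
    rw [LinearMap.add_apply, LinearMap.add_apply, hf.2, hg.2, smul_add]⟩
  smul_mem' := fun c f hf => ⟨hf.1.smul c, fun a l => by
    rw [LinearMap.smul_apply, LinearMap.smul_apply, hf.2, smul_comm]⟩

variable {Fq A V}

/-- Scalar multiplication by an element of `A` detected on functionals killing its multiples. -/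
theorem exists_smul_eq_of_forall_eq_zero [IsDomain A] {f : Module.Dual Fq A →ₗ[Fq] V}
    (hf : f ∈ dualHom Fq A V) {a : A} (ha : a ≠ 0)
    (h : ∀ l : Module.Dual Fq A, (∀ x, l (a * x) = 0) → f l = 0) :
    ∃ g ∈ dualHom Fq A V, f = a • g := by
  -- `ρ` is a division by `a` that is only `Fq`-linear. The functionals `l(c ρ(·))` and `l(ρ(c ·))`
  -- agree on `aA`, so `f` does not see their difference and `f ∘ ρ^*` is `A`-linear.
  obtain ⟨ρ, hρ⟩ := (LinearMap.mulLeft Fq a).exists_leftInverse_of_injective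
    (LinearMap.ker_eq_bot.2 (mul_right_injective₀ ha))
  have hρ' : ∀ x, ρ (a * x) = x := fun x => LinearMap.congr_fun hρ x
  refine ⟨f ∘ₗ ρ.dualMap, ⟨hf.1.comp_dualMap ρ, fun c l => ?_⟩, ?_⟩
  · rw [LinearMap.comp_apply, LinearMap.comp_apply, ← hf.2, ← sub_eq_zero, ← map_sub]
    refine h _ fun x => ?_
    rw [LinearMap.sub_apply]
    simp only [LinearMap.dualMap_apply, LinearMap.mulLeft_apply]
    rw [mul_left_comm, hρ', hρ', sub_self]
  · ext l
    rw [LinearMap.smul_apply, LinearMap.comp_apply, ← hf.2]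
    congr 1
    ext x
    simp [hρ']

/-- Write `(a) = 𝔭 J` with `J` prime to `𝔭` and choose `s ∈ J` congruent to `1` modulo `𝔭`. The
factor `s` compensates for the other prime divisors of `a`, since `𝔭` need not be principal. -/
theorem exists_mem_and_forall_mul_mem_span [IsDedekindDomain A] (v : HeightOneSpectrum A) {a : A}
    (ha : v.intValuation a = WithZero.exp (-1 : ℤ)) :
    a ∈ v.asIdeal ∧ ∃ s : A, 1 - s ∈ v.asIdeal ∧ ∀ x ∈ v.asIdeal, ∃ y, s * x = a * y := by
  have h1 : v.asIdeal ^ 1 ∣ Ideal.span {a} :=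
    (v.intValuation_le_pow_iff_dvd a 1).1 (by rw [ha]; rfl)
  have h2 : ¬ v.asIdeal ^ 2 ∣ Ideal.span {a} := by
    rw [← v.intValuation_le_pow_iff_dvd a 2, ha, not_le, WithZero.exp_lt_exp]
    norm_num
  rw [pow_one] at h1
  have ha' : a ∈ v.asIdeal := (Ideal.dvd_span_singleton).1 h1
  obtain ⟨J, hJ⟩ := h1
  have hJv : ¬ J ≤ v.asIdeal := fun h => h2 (by
    rw [hJ, pow_two]
    exact mul_dvd_mul_left _ (Ideal.dvd_iff_le.2 h))
  have hmax : v.asIdeal.IsMaximal := v.isMaximal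
  have htop : v.asIdeal ⊔ J = ⊤ := hmax.1.2 _ (lt_of_le_of_ne le_sup_left
    fun h => hJv (h ▸ le_sup_right))
  obtain ⟨p, hp, s, hs, hps⟩ := Submodule.mem_sup.1 (htop ▸ Submodule.mem_top (x := (1 : A)))
  refine ⟨ha', s, by rw [← hps]; simpa using hp, fun x hx => ?_⟩
  have : x * s ∈ Ideal.span {a} := by
    rw [hJ]
    exact Ideal.mul_mem_mul hx hs
  obtain ⟨y, hy⟩ := Ideal.mem_span_singleton.1 this
  exact ⟨y, by rw [← hy, mul_comm]⟩

/-- If `l` kills `aA`, then `l(s ·)` kills `𝔭`; hence `s f` kills all such `l` and is divisible by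
`a`. Then `f = s f + (1 - s) f` with `1 - s ∈ 𝔭`. -/
theorem mem_smul_top_of_forall_eq_zero [IsDedekindDomain A] (v : HeightOneSpectrum A)
    (f : dualHom Fq A V)
    (h : ∀ l : Module.Dual Fq A, (∀ x ∈ v.asIdeal, l x = 0) → f.1 l = 0) :
    f ∈ (v.asIdeal • ⊤ : Submodule A (dualHom Fq A V)) := by
  obtain ⟨a, ha⟩ := v.intValuation_exists_uniformizer
  obtain ⟨ha', s, hs, hsx⟩ := exists_mem_and_forall_mul_mem_span v ha
  have ha0 : a ≠ 0 := by
    rintro rfl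
    rw [map_zero] at ha
    exact WithZero.exp_ne_zero ha.symm
  obtain ⟨g, hg, hfg⟩ := exists_smul_eq_of_forall_eq_zero (s • f).2 ha0 fun l hl => by
    change s • f.1 l = 0
    rw [← f.2.2]
    refine h _ fun x hx => ?_
    obtain ⟨y, hy⟩ := hsx x hx
    rw [LinearMap.dualMap_apply, LinearMap.mulLeft_apply, hy, hl]
  have : f = a • (⟨g, hg⟩ : dualHom Fq A V) + (1 - s) • f := by
    have hsub : (1 - s) • f = f - s • f := by
      ext l
      change (1 - s) • f.1 l = f.1 l - s • f.1 l
      rw [sub_smul, one_smul]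
    have : s • f = a • (⟨g, hg⟩ : dualHom Fq A V) := Subtype.ext hfg
    rw [hsub, this]
    abel
  rw [this]
  exact add_mem (Submodule.smul_mem_smul ha' trivial) (Submodule.smul_mem_smul hs trivial)

theorem eq_zero_of_mem_smul_top {I : Ideal A} {f : dualHom Fq A V}
    (hf : f ∈ (I • ⊤ : Submodule A (dualHom Fq A V))) {l : Module.Dual Fq A}
    (hl : ∀ x ∈ I, l x = 0) : f.1 l = 0 := by
  induction hf using Submodule.smul_induction_on' with
  | smul a ha g _ =>
    change a • g.1 l = 0
    rw [← g.2.2]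
    have : (LinearMap.mulLeft Fq a).dualMap l = 0 := by
      ext x
      exact hl _ (I.mul_mem_right x ha)
    rw [this, map_zero]
  | add g _ g' _ h h' =>
    change g.1 l + g'.1 l = 0
    rw [h, h', add_zero]

end DualHom

/-! ### Special functions as continuous `A`-linear maps -/

namespace AndersonModule

section SpecialFunctions

variable {Fq A K C : Type*} [Field Fq] [Finite Fq] [CommRing A] [Field K] [NormedField C]
  [Algebra Fq A] [Algebra A K] [Algebra K C] [Algebra Fq C] {L : IntermediateField K C}

instance (E : AndersonModule Fq A L) : SMulCommClass Fq A E.Points :=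
  SMulCommClass.symm _ _ _

instance (E : AndersonModule Fq A L) : ContinuousConstSMul A E.Points :=
  ⟨E.continuous_smul⟩

instance (E : AndersonModule Fq A L) : ContinuousConstSMul Fq E.Points :=
  ⟨fun c => continuous_pi fun i => by
    change Continuous fun x : Fin E.dim → C => c • x i
    simp only [Algebra.smul_def]
    fun_prop⟩

instance (E : AndersonModule Fq A L) [CompleteSpace C] : CompleteSpace E.Points :=
  inferInstanceAs (CompleteSpace (Fin E.dim → C))

instance (E : AndersonModule Fq A L) [IsUltrametricDist C] : IsUltrametricDist E.Points :=
  inferInstanceAs (IsUltrametricDist (Fin E.dim → C))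

variable [CompleteSpace C] [IsUltrametricDist C] {ι : Type*}

/-- A special function is a continuous `A`-linear map from the dual of `A` to the points. -/
noncomputable def sfEquiv (E : AndersonModule Fq A L) (b : Module.Basis ι Fq A) :
    E.sf b ≃ₗ[A] dualHom Fq A E.Points where
  toFun h := ⟨dualEval b h.2.1, isDualContinuous_dualEval b h.2.1, fun a l => by
    -- The defect of `a`-linearity is continuous, so it vanishes once it vanishes on the dual basis;
    -- there the claim is the defining relation of a special function.
    let u : Module.Dual Fq A →ₗ[Fq] E.Points :=
      dualEval b h.2.1 ∘ₗ (LinearMap.mulLeft Fq a).dualMap + (-a) • dualEval b h.2.1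
    have hu : IsDualContinuous u := ((isDualContinuous_dualEval b h.2.1).comp_dualMap _).add
      ((isDualContinuous_dualEval b h.2.1).smul _)
    have h0 : u = 0 := hu.eq_zero b fun j => by
      change dualEval b h.2.1 _ + (-a) • dualEval b h.2.1 _ = 0
      rw [dualEval_coord, neg_smul, add_neg_eq_zero]
      refine (dualEval_hasSum b h.2.1 _).unique ?_
      simpa [IsLeftMul] using h.2.2 a j
    have := LinearMap.congr_fun h0 l
    change dualEval b h.2.1 _ + (-a) • dualEval b h.2.1 _ = 0 at this
    rwa [neg_smul, add_neg_eq_zero] at this⟩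
  map_add' h h' := by
    ext l
    refine (dualEval_hasSum b (h + h').2.1 l).unique ?_
    have := (dualEval_hasSum b h.2.1 l).add (dualEval_hasSum b h'.2.1 l)
    simp only [← smul_add] at this
    exact this
  map_smul' a h := by
    ext l
    refine (dualEval_hasSum b (a • h).2.1 l).unique ?_
    have := (dualEval_hasSum b h.2.1 l).const_smul a
    simp only [smul_comm a] at this
    exact this
  invFun f := ⟨fun i => f.1 (b.coord i), f.2.1.tendsto_coord b,
    fun a j => by
      have := f.2.1.hasSum b ((LinearMap.mulLeft Fq a).dualMap (b.coord j))
      rw [f.2.2] at this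
      simpa using this⟩
  left_inv h := Subtype.ext (funext fun i => dualEval_coord b h.2.1 i)
  right_inv f := by
    ext l
    exact (dualEval_hasSum b (f.2.1.tendsto_coord b) l).unique (f.2.1.hasSum b l)

theorem sfEquiv_hasSum (E : AndersonModule Fq A L) (b : Module.Basis ι Fq A) (h : E.sf b)
    (l : Module.Dual Fq A) : HasSum (fun i => l (b i) • h.1 i) ((E.sfEquiv b h).1 l) :=
  dualEval_hasSum b h.2.1 l

end SpecialFunctions

end AndersonModule

/-! ### Finiteness of torsion -/

section FiniteZeros

variable {F σ : Type*} [Field F] [Finite σ]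

/-- A system of polynomial equations with constant invertible Jacobian has finitely many zeros. -/
theorem MvPolynomial.finite_zeros_of_isUnit_jacobian [Fintype σ] [DecidableEq σ]
    (p : σ → MvPolynomial σ F) (M : Matrix σ σ F) (hM : IsUnit M)
    (hp : ∀ i j, MvPolynomial.pderiv j (p i) = MvPolynomial.C (M i j)) :
    {x : σ → F | ∀ i, MvPolynomial.eval x (p i) = 0}.Finite := by
  let I : Ideal (MvPolynomial σ F) := Ideal.span (Set.range p)
  let R := MvPolynomial σ F ⧸ I
  let D : Derivation F (MvPolynomial σ F) (Ω[R⁄F]) :=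
    (KaehlerDifferential.D F R).compAlgebraMap (MvPolynomial σ F)
  have hD : ∀ q, D q = KaehlerDifferential.D F R (Ideal.Quotient.mk I q) := fun q => rfl
  have hDδ : ∀ q, D q = ∑ j, MvPolynomial.pderiv j q • D (MvPolynomial.X j) := by
    intro q
    let δ : Derivation F (MvPolynomial σ F) (Ω[R⁄F]) :=
      ∑ j, (LinearMap.toSpanSingleton (MvPolynomial σ F) (Ω[R⁄F])
        (D (MvPolynomial.X j))).compDer (MvPolynomial.pderiv j)
    have hδ : ∀ q, δ q = ∑ j, MvPolynomial.pderiv j q • D (MvPolynomial.X j) := by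
      intro q
      have h := congrFun (map_sum Derivation.coeFnAddMonoidHom (fun j =>
        (LinearMap.toSpanSingleton (MvPolynomial σ F) (Ω[R⁄F])
          (D (MvPolynomial.X j))).compDer (MvPolynomial.pderiv (R := F) j)) Finset.univ) q
      rw [Finset.sum_apply] at h
      exact h
    rw [← hδ]
    congr 1
    refine MvPolynomial.derivation_ext fun j => ?_
    rw [hδ]
    simp [MvPolynomial.pderiv_X, Pi.single_apply, Finset.sum_ite_eq]
  -- The relations `∑ M i k dX_k = 0` are solved with the inverse of the constant Jacobian.
  have hX : ∀ j, D (MvPolynomial.X j) = 0 := by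
    intro j
    have h0 : ∀ i, ∑ k, M i k • D (MvPolynomial.X k) = 0 := by
      intro i
      have h1 : D (p i) = 0 := by
        rw [hD, Ideal.Quotient.eq_zero_iff_mem.2 (Ideal.subset_span (Set.mem_range_self i)), map_zero]
      rw [hDδ] at h1
      rw [← h1]
      refine Finset.sum_congr rfl fun k _ => ?_
      rw [hp, ← MvPolynomial.algebraMap_eq, algebraMap_smul]
    have h2 : ∑ i, M⁻¹ j i • ∑ k, M i k • D (MvPolynomial.X k) = D (MvPolynomial.X j) := by
      simp_rw [Finset.smul_sum, smul_smul]
      rw [Finset.sum_comm]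
      simp_rw [← Finset.sum_smul, ← Matrix.mul_apply]
      rw [Matrix.nonsing_inv_mul _ ((Matrix.isUnit_iff_isUnit_det _).1 hM)]
      simp [Matrix.one_apply]
    rw [← h2]
    simp [h0]
  have hΩ : Subsingleton (Ω[R⁄F]) := by
    refine subsingleton_of_forall_eq 0 fun ω => ?_
    have hω : ω ∈ Submodule.span R (Set.range (KaehlerDifferential.D F R)) := by
      rw [KaehlerDifferential.span_range_derivation]; trivial
    have : Set.range (KaehlerDifferential.D F R) ⊆ {0} := by
      rintro _ ⟨x, rfl⟩
      obtain ⟨q, rfl⟩ := Ideal.Quotient.mk_surjective x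
      rw [← hD, hDδ]
      simp [hX]
    have h3 := Submodule.span_mono this hω
    rwa [Submodule.span_zero_singleton, Submodule.mem_bot] at h3
  -- An unramified algebra of finite type over a field is finite, so the `j`-th coordinate of a zero
  -- is a root of the minimal polynomial of the class of `X j`.
  have hunr : Algebra.FormallyUnramified F R := ⟨hΩ⟩
  have hft : Algebra.FiniteType F R := inferInstance
  have hfin : Module.Finite F R := Algebra.FormallyUnramified.finite_of_free F R
  refine (Set.Finite.pi (t := fun j => {y | Polynomial.IsRoot
    (minpoly F (Ideal.Quotient.mk I (MvPolynomial.X j) : R)) y}) fun j => ?_).subset ?_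
  · exact Polynomial.finite_setOfPred_isRoot (minpoly.ne_zero (Algebra.IsIntegral.isIntegral _))
  · intro x hx j _
    have hle : ∀ q ∈ I, MvPolynomial.aeval x q = (0 : F) := by
      intro q hq
      have : I ≤ RingHom.ker (MvPolynomial.aeval x : MvPolynomial σ F →ₐ[F] F) := by
        rw [Ideal.span_le]
        rintro _ ⟨i, rfl⟩
        simpa [MvPolynomial.aeval_eq_eval] using hx i
      exact this hq
    let ev : R →ₐ[F] F := Ideal.Quotient.liftₐ I (MvPolynomial.aeval x) hle
    have hev : ev (Ideal.Quotient.mk I (MvPolynomial.X j)) = x j := by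
      change (MvPolynomial.aeval x : MvPolynomial σ F →ₐ[F] F) (MvPolynomial.X j) = x j
      simp
    have := congrArg ev (minpoly.aeval F (Ideal.Quotient.mk I (MvPolynomial.X j) : R))
    rw [← Polynomial.aeval_algHom_apply, hev, map_zero, Polynomial.coe_aeval_eq_eval] at this
    exact this

end FiniteZeros

namespace AndersonModule

section Torsion

variable {Fq A K C : Type*} [Field Fq] [Finite Fq] [CommRing A] [Field K]
  [NormedField C] [Algebra A K] [FaithfulSMul A K] [Algebra K C] [Algebra Fq C]
  {L : IntermediateField K C}

-- Generic characteristic: the scalar `a` is nonzero in `L`, and a commuting nilpotent perturbation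
-- keeps it invertible.
omit [Finite Fq] in
theorem isUnit_coeff_zero (E : AndersonModule Fq A L) {a : A} (ha : a ≠ 0) :
    IsUnit (E.coeff a 0) := by
  have h := E.isNilpotent a
  have hu : IsUnit (Matrix.scalar (Fin E.dim) (algebraMap K L (algebraMap A K a))) := by
    refine IsUnit.map _ (isUnit_iff_ne_zero.2 ?_)
    rw [Ne, map_eq_zero_iff _ (algebraMap K L).injective,
      map_eq_zero_iff _ (FaithfulSMul.algebraMap_injective A K)]
    exact ha
  have hc : Commute (Matrix.scalar (Fin E.dim) (algebraMap K L (algebraMap A K a)))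
      (E.coeff a 0 - Matrix.scalar (Fin E.dim) (algebraMap K L (algebraMap A K a))) :=
    Matrix.scalar_commute _ (fun r => Commute.all _ _) _
  have := IsNilpotent.isUnit_add_left_of_commute h hu hc.symm
  rwa [add_sub_cancel] at this

/-- The powers `x^(q^k)` with `k > 0` have derivative zero in characteristic `p`, so the Jacobian is
the constant matrix `M 0`. -/
theorem finite_setOf_twistedEval_eq_zero {n : ℕ} (M : ℕ →₀ Matrix (Fin n) (Fin n) L)
    (hM : IsUnit (M 0)) : {x : Fin n → C | twistedEval (Nat.card Fq) M x = 0}.Finite := by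
  have hq : ((Nat.card Fq : ℕ) : C) = 0 := by
    have := Fintype.ofFinite Fq
    rw [← map_natCast (algebraMap Fq C), Nat.card_eq_fintype_card, FiniteField.cast_card_eq_zero,
      map_zero]
  let p : Fin n → MvPolynomial (Fin n) C := fun i => M.sum fun k Mk =>
    ∑ j, MvPolynomial.C (algebraMap L C (Mk i j)) * MvPolynomial.X j ^ Nat.card Fq ^ k
  refine (MvPolynomial.finite_zeros_of_isUnit_jacobian p ((M 0).map (algebraMap L C))
    (hM.map (algebraMap L C).mapMatrix) fun i j => ?_).subset fun x hx i => ?_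
  · simp only [p, Finsupp.sum, map_sum]
    have hterm : ∀ k l, MvPolynomial.pderiv j (MvPolynomial.C (algebraMap L C (M k i l)) *
        MvPolynomial.X l ^ Nat.card Fq ^ k) =
        if k = 0 ∧ l = j then MvPolynomial.C (algebraMap L C (M k i l)) else 0 := by
      intro k l
      rw [MvPolynomial.pderiv_C_mul, Derivation.leibniz_pow, MvPolynomial.pderiv_X]
      rcases Nat.eq_zero_or_pos k with rfl | hk
      · by_cases hl : l = j
        · subst hl; simp
        · simp [hl]
      · have : ((Nat.card Fq ^ k : ℕ) : MvPolynomial (Fin n) C) = 0 := by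
          rw [← map_natCast MvPolynomial.C, Nat.cast_pow, hq, zero_pow hk.ne', map_zero]
        rw [nsmul_eq_mul, this]
        simp [hk.ne']
    simp only [hterm]
    rw [Finset.sum_eq_single 0]
    · simp
    · intro k _ hk
      simp [hk]
    · intro h0
      rw [Finsupp.notMem_support_iff.1 h0]
      simp
  · have := congrFun hx i
    simp only [twistedEval, Finsupp.sum, Finset.sum_apply, Matrix.mulVec, dotProduct,
      Matrix.map_apply, Pi.zero_apply] at this
    simpa [p, Finsupp.sum] using this

theorem finite_setOf_smul_eq_zero (E : AndersonModule Fq A L) {a : A} (ha : a ≠ 0) :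
    {x : E.Points | a • x = 0}.Finite := by
  refine (finite_setOf_twistedEval_eq_zero (Fq := Fq) (E.coeff a) (E.isUnit_coeff_zero ha)).subset
    fun x hx => ?_
  rw [Set.mem_ofPred_eq, ← E.φ_apply]
  exact hx

end Torsion

end AndersonModule

/-! ### Functions on the curve and their poles at infinity -/

/-- An element of all valuation rings containing a subring is integral over it. -/
theorem RingHom.isIntegralElem_of_forall_mem_valuationSubring {S K : Type*} [CommRing S] [Field K]
    (f : S →+* K) (hf : Function.Injective f) {x : K}
    (h : ∀ V : ValuationSubring K, (∀ r, f r ∈ V) → x ∈ V) : f.IsIntegralElem x := by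
  have hx : x ∈ (integralClosure (Subring.closure (Set.range f)) K).toSubring := by
    rw [← iInf_valuationSubring_superset, Subring.mem_iInf]
    exact fun V => h V.1 fun r => V.2 (Set.mem_range_self r)
  have hx' : _root_.IsIntegral ↥(Subring.closure (Set.range f)) x := hx
  have hle : Subring.closure (Set.range f) ≤ f.range := by
    rw [Subring.closure_le]; exact subset_of_eq f.coe_range.symm
  let e : S ≃+* f.range := RingEquiv.ofBijective f.rangeRestrict
    ⟨fun a b hab => hf (congrArg Subtype.val hab), f.rangeRestrict_surjective⟩
  let φ : Subring.closure (Set.range f) →+* S := (e.symm : f.range →+* S).comp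
    (Subring.inclusion hle)
  have hφ : f.comp φ = (Subring.closure (Set.range f)).subtype := by
    ext r
    exact congrArg Subtype.val (e.apply_symm_apply (Subring.inclusion hle r))
  obtain ⟨p, hp, hpx⟩ := hx'
  refine ⟨p.map φ, hp.map φ, ?_⟩
  rw [Polynomial.eval₂_map, hφ]
  exact hpx

namespace IsPuncturedCurve

variable {Fq A K : Type*} [Field Fq] [CommRing A] [IsDedekindDomain A]
  [Field K] [Algebra Fq A] [Algebra A K] [Algebra Fq K] [IsScalarTower Fq A K]
  [IsFractionRing A K] {Oinf : ValuationSubring K}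

/-- A function that is also regular at `∞` lies in every valuation ring of `K`, hence is integral
over `Fq`, hence constant. -/
theorem exists_algebraMap_eq (hA : IsPuncturedCurve Fq A K Oinf) {a : A}
    (ha : algebraMap A K a ∈ Oinf) : ∃ c : Fq, algebraMap Fq A c = a := by
  have hint : (algebraMap Fq K).IsIntegralElem (algebraMap A K a) := by
    refine RingHom.isIntegralElem_of_forall_mem_valuationSubring _ (algebraMap Fq K).injective
      fun V _ => ?_
    by_cases h1 : V = ⊤
    · rw [h1]; trivial
    by_cases h2 : V = Oinf
    · rwa [h2]
    exact (hA.mem_iff _).1 ⟨a, rfl⟩ V h1 h2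
  obtain ⟨c, hc⟩ := hA.constants _ (IsIntegral.isAlgebraic (R := Fq) hint)
  exact ⟨c, IsFractionRing.injective A K (by rw [← IsScalarTower.algebraMap_apply, hc])⟩

theorem notMem_of_mem_ideal (hA : IsPuncturedCurve Fq A K Oinf) {I : Ideal A} (hI : I ≠ ⊤) {a : A}
    (ha : a ∈ I) (ha0 : a ≠ 0) : algebraMap A K a ∉ Oinf := by
  intro h
  obtain ⟨c, rfl⟩ := hA.exists_algebraMap_eq h
  have hc : c ≠ 0 := by
    rintro rfl
    exact ha0 (map_zero _)
  exact hI (Ideal.eq_top_of_isUnit_mem _ ha ((isUnit_iff_ne_zero.2 hc).map _))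

theorem _root_.ValuationSubring.algebraMap_mem_of_finite (Fq : Type*) {K : Type*} [Field Fq]
    [Finite Fq] [Field K] [Algebra Fq K] (V : ValuationSubring K) (c : Fq) :
    algebraMap Fq K c ∈ V := by
  rcases eq_or_ne c 0 with rfl | hc
  · rw [map_zero]
    exact V.zero_mem
  obtain ⟨n, hn, hcn⟩ := (isOfFinOrder_of_finite (Units.mk0 c hc)).exists_pow_eq_one
  rw [← V.valuation_le_one_iff]
  by_contra! h
  have h1 := one_lt_pow₀ h hn.ne'
  have h2 : c ^ n = 1 := congrArg Units.val hcn
  rw [← map_pow, ← map_pow, h2, map_one, map_one] at h1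
  exact lt_irrefl _ h1

theorem aeval_injective [Finite Fq] (hA : IsPuncturedCurve Fq A K Oinf) {t : A}
    (ht : algebraMap A K t ∉ Oinf) :
    Function.Injective (Polynomial.aeval t : Fq[X] →ₐ[Fq] A) := by
  rw [← transcendental_iff_injective]
  intro h
  obtain ⟨c, hc⟩ := hA.constants _ (IsAlgebraic.algebraMap (A := K) h)
  refine ht ?_
  rw [← hc]
  exact Oinf.algebraMap_mem_of_finite Fq c

/-- A valuation ring containing `Fq[t]` is not the one at `∞`, where `t` has a pole, so it contains
`A`. Thus `A` is integral over `Fq[t]`, and it is of finite type. -/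
theorem finite_aeval [Finite Fq] (hA : IsPuncturedCurve Fq A K Oinf) {t : A}
    (ht : algebraMap A K t ∉ Oinf) :
    (Polynomial.aeval t : Fq[X] →ₐ[Fq] A).toRingHom.Finite := by
  have hint : (Polynomial.aeval t : Fq[X] →ₐ[Fq] A).toRingHom.IsIntegral := by
    intro x
    obtain ⟨p, hp, hpx⟩ := RingHom.isIntegralElem_of_forall_mem_valuationSubring
      ((algebraMap A K).comp (Polynomial.aeval t : Fq[X] →ₐ[Fq] A).toRingHom)
      ((IsFractionRing.injective A K).comp (hA.aeval_injective ht))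
      (x := algebraMap A K x) fun V hV => by
        by_cases h1 : V = ⊤
        · rw [h1]; trivial
        refine (hA.mem_iff _).1 ⟨x, rfl⟩ V h1 ?_
        rintro rfl
        exact ht (by simpa using hV Polynomial.X)
    refine ⟨p, hp, IsFractionRing.injective A K ?_⟩
    rw [Polynomial.hom_eval₂, map_zero]
    exact hpx
  refine hint.to_finite (RingHom.FiniteType.of_comp_finiteType (f := Polynomial.C) ?_)
  have : (Polynomial.aeval t : Fq[X] →ₐ[Fq] A).toRingHom.comp Polynomial.C = algebraMap Fq A := by
    ext c; simp
  rw [this]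
  exact (RingHom.finiteType_algebraMap).2 hA.finiteType

end IsPuncturedCurve

/-! ### The action near the origin -/

namespace AndersonModule

section LinearPart

variable {Fq A K C : Type*} [Field Fq] [Finite Fq] [CommRing A] [Field K]
  [NormedField C] [Algebra A K] [Algebra K C] [Algebra Fq C] {L : IntermediateField K C}

/-- A suitable power of the linear part of the action of `a` is a scalar. -/
theorem exists_coeff_zero_pow_eq (E : AndersonModule Fq A L) (a : A) :
    ∃ k, 0 < k ∧ ((E.coeff a 0).map (algebraMap L C)) ^ (Nat.card Fq ^ k) =
      Matrix.scalar _ (algebraMap K C (algebraMap A K a) ^ (Nat.card Fq ^ k)) := by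
  have := Fintype.ofFinite Fq
  obtain ⟨p, hp⟩ := CharP.exists Fq
  have : Fact p.Prime := ⟨CharP.char_is_prime Fq p⟩
  obtain ⟨m, _, hm⟩ := FiniteField.card Fq p
  have hL : CharP C p := charP_of_injective_algebraMap (algebraMap Fq C).injective p
  obtain ⟨n, hn⟩ := E.isNilpotent a
  set N := (E.coeff a 0 - Matrix.scalar (Fin E.dim) (algebraMap K L (algebraMap A K a))).map
    (algebraMap L C) with hN
  have hNn : N ^ n = 0 := by
    have := congrArg (algebraMap L C).mapMatrix hn
    rw [map_pow, map_zero (algebraMap L C).mapMatrix] at this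
    exact this
  have hsplit : (E.coeff a 0).map (algebraMap L C) =
      Matrix.scalar _ (algebraMap K C (algebraMap A K a)) + N := by
    ext i j
    simp only [hN, Matrix.map_apply, Matrix.add_apply, Matrix.sub_apply, map_sub]
    have : algebraMap L C (Matrix.scalar (Fin E.dim) (algebraMap K L (algebraMap A K a)) i j) =
        Matrix.scalar (Fin E.dim) (algebraMap K C (algebraMap A K a)) i j := by
      simp only [Matrix.scalar_apply, Matrix.diagonal_apply]
      split_ifs
      · rw [← IsScalarTower.algebraMap_apply K L C]
      · rw [map_zero]
    rw [this]
    ring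
  -- With `n` the nilpotency exponent of `N`, one has `n ≤ q^(n+1)`, so the Frobenius power of
  -- `scalar + N` loses the nilpotent part.
  refine ⟨n + 1, n.succ_pos, ?_⟩
  have hcard : Nat.card Fq ^ (n + 1) = p ^ (m * (n + 1)) := by
    rw [Nat.card_eq_fintype_card, hm, pow_mul]
  have hle : n ≤ Nat.card Fq ^ (n + 1) :=
    ((Nat.lt_pow_self Finite.one_lt_card).le.trans
      (Nat.pow_le_pow_right Finite.card_pos n.le_succ))
  -- In dimension zero the matrix ring is trivial and does not have characteristic `p`.
  have hE : CharP (Matrix (Fin E.dim) (Fin E.dim) C) p ∨ E.dim = 0 := by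
    rcases Nat.eq_zero_or_pos E.dim with h | h
    · exact Or.inr h
    · have : NeZero E.dim := ⟨h.ne'⟩
      exact Or.inl inferInstance
  rcases hE with hE | hE
  · rw [hsplit, hcard, add_pow_char_pow_of_commute _ _
      (Matrix.scalar_commute _ (fun r => Commute.all _ _) _), ← hcard,
      pow_eq_zero_of_le hle hNn, add_zero, map_pow]
  · ext i
    exact absurd i.2 (by omega)


end LinearPart

section Derivative

variable {Fq A K C : Type*} [Field Fq] [Finite Fq] [CommRing A] [Field K]
  [NontriviallyNormedField C] [CompleteSpace C] [Algebra A K] [Algebra K C]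
  [Algebra Fq C] {L : IntermediateField K C}

omit [Field Fq] [Finite Fq] [Algebra Fq C] in
/-- The linear part of a system of twisted polynomials is its derivative at the origin. -/
theorem hasFDerivAt_twistedEval {q m n : ℕ} (hq : 1 < q) (M : ℕ →₀ Matrix (Fin m) (Fin n) L) :
    HasFDerivAt (twistedEval (C := C) q M)
      (LinearMap.toContinuousLinearMap ((M 0).map (algebraMap L C)).mulVecLin) 0 := by
  classical
  have hterm : ∀ k, HasFDerivAt
      (fun x : Fin n → C => ((M k).map (algebraMap L C)).mulVec fun i => x i ^ q ^ k)
      (if k = 0 then LinearMap.toContinuousLinearMap ((M 0).map (algebraMap L C)).mulVecLin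
        else 0) 0 := by
    intro k
    split_ifs with hk
    · subst hk
      simpa using (LinearMap.toContinuousLinearMap
        ((M 0).map (algebraMap L C)).mulVecLin).hasFDerivAt (x := (0 : Fin n → C))
    · have h1 : HasFDerivAt (fun (x : Fin n → C) i => x i ^ q ^ k)
          (0 : (Fin n → C) →L[C] (Fin n → C)) 0 := by
        rw [hasFDerivAt_pi']
        intro i
        have h2 := (hasFDerivAt_apply (𝕜 := C) (F' := fun _ : Fin n => C) i 0).pow
          (q ^ k)
        have h3 : 1 < q ^ k := Nat.one_lt_pow hk hq
        have h5 : (0 : Fin n → C) i ^ (q ^ k - 1) = 0 := zero_pow (Nat.sub_ne_zero_of_lt h3)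
        refine h2.congr_fderiv ?_
        rw [h5, smul_zero, ContinuousLinearMap.comp_zero]
        exact zero_smul C (ContinuousLinearMap.proj (R := C) (φ := fun _ : Fin n => C) i)
      have h4 := ((LinearMap.toContinuousLinearMap
        ((M k).map (algebraMap L C)).mulVecLin).hasFDerivAt).comp (0 : Fin n → C) h1
      rw [ContinuousLinearMap.comp_zero] at h4
      exact h4
  have h := HasFDerivAt.fun_sum (u := insert 0 M.support) fun k _ => hterm k
  rw [Finset.sum_ite_eq' _ 0, if_pos (Finset.mem_insert_self _ _)] at h
  refine h.congr_of_eventuallyEq (Eventually.of_forall fun x => ?_)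
  exact Finsupp.sum_of_support_subset _ (Finset.subset_insert _ _) _ fun k _ => by
    ext; simp [Matrix.mulVec]

theorem hasFDerivAt_φ (E : AndersonModule Fq A L) (a : A) : HasFDerivAt (E.φ a)
    (LinearMap.toContinuousLinearMap ((E.coeff a 0).map (algebraMap L C)).mulVecLin) 0 := by
  have h : (E.φ a : (Fin E.dim → C) → Fin E.dim → C) = twistedEval (Nat.card Fq) (E.coeff a) :=
    funext fun x => E.φ_apply a x
  rw [h]
  exact hasFDerivAt_twistedEval Finite.one_lt_card _

/-- An element of norm larger than `1` expands the points near the origin, up to a power. -/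
theorem exists_pow_smul_norm_le (E : AndersonModule Fq A L) {t : A}
    (ht : 1 < ‖algebraMap K C (algebraMap A K t)‖) :
    ∃ n, ∃ r > (1 : ℝ), ∃ ε > (0 : ℝ), ∀ x : Fin E.dim → C,
      ‖x‖ < ε → r * ‖x‖ ≤ ‖E.φ (t ^ n) x‖ := by
  obtain ⟨k, _, hk⟩ := E.exists_coeff_zero_pow_eq t
  set n := Nat.card Fq ^ k with hn
  set c := algebraMap K C (algebraMap A K t) ^ n with hc
  have hn0 : n ≠ 0 := (pow_pos Finite.card_pos _).ne'
  have hc1 : 1 < ‖c‖ := by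
    rw [hc, norm_pow]; exact one_lt_pow₀ ht hn0
  -- The derivative of the `n`-th iterate at `0` is the scalar `c`. An error of at most `(‖c‖ -
  -- 1)/2` relative to `‖x‖` leaves the expansion factor `(‖c‖ + 1)/2 > 1`.
  have hd := (E.hasFDerivAt_φ t).iterate (map_zero _) n
  rw [hasFDerivAt_iff_isLittleO_nhds_zero] at hd
  have hr : 0 < (‖c‖ - 1) / 2 := by linarith
  have hev := hd.def hr
  obtain ⟨ε, hε, hball⟩ := Metric.eventually_nhds_iff.1 hev
  refine ⟨n, (‖c‖ + 1) / 2, by linarith, ε, hε, fun x hx => ?_⟩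
  have h1 := hball (y := x) (by rwa [dist_zero_right])
  have h2 : (E.φ t)^[n] x = E.φ (t ^ n) x := by
    rw [map_pow, Module.End.pow_apply]
  have h3 : ∀ m (y : Fin E.dim → C), ((LinearMap.toContinuousLinearMap
      ((E.coeff t 0).map (algebraMap L C)).mulVecLin) ^ m) y =
      (((E.coeff t 0).map (algebraMap L C)) ^ m).mulVec y := by
    intro m
    induction m with
    | zero => simp
    | succ m ih =>
      intro y
      rw [pow_succ, pow_succ, ← Matrix.mulVec_mulVec, ← ih]
      rfl
  have h4 : (Matrix.scalar (Fin E.dim) c).mulVec x = c • x := by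
    ext i
    simp [Matrix.mulVec_diagonal]
  rw [h3, hk, h4, zero_add, h2] at h1
  have h5 : (E.φ t)^[n] 0 = 0 :=
    Function.iterate_fixed (map_zero _) n
  rw [h5, sub_zero] at h1
  have h6 : ‖c • x‖ - ‖E.φ (t ^ n) x‖ ≤ ‖E.φ (t ^ n) x - c • x‖ := by
    rw [norm_sub_rev]
    exact norm_sub_norm_le _ _
  have h7 := h6.trans h1
  rw [norm_smul] at h7
  linarith

end Derivative

section SmallBall

variable {Fq A K C : Type*} [Field Fq] [Finite Fq] [CommRing A] [Field K]
  [NormedField C] [CompleteSpace C] [Algebra A K] [Algebra K C]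
  [Algebra Fq C] {L : IntermediateField K C}

/-- The points have no small `A`-submodules. -/
theorem exists_ball_eq_zero (E : AndersonModule Fq A L) {t : A}
    (ht : 1 < ‖algebraMap K C (algebraMap A K t)‖) :
    ∃ ε > (0 : ℝ), ∀ x : E.Points, (∀ a : A, ‖a • x‖ < ε) → x = 0 := by
  let _ : NontriviallyNormedField C := { ‹NormedField C› with non_trivial := ⟨_, ht⟩ }
  obtain ⟨n, r, hr, ε, hε, h⟩ := E.exists_pow_smul_norm_le ht
  refine ⟨ε, hε, fun x hx => ?_⟩
  by_contra hx0
  have hpos : 0 < ‖x‖ := norm_pos_iff.2 hx0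
  -- As long as the orbit stays in the ball, each application of `t ^ n` expands by `r`, so a
  -- nonzero point must eventually leave it.
  have hpow : ∀ m, r ^ m * ‖x‖ ≤ ‖(t ^ n) ^ m • x‖ := by
    intro m
    induction m with
    | zero => simp
    | succ m ih =>
      rw [pow_succ', pow_succ' (t ^ n), mul_smul, mul_assoc]
      exact (mul_le_mul_of_nonneg_left ih (by linarith)).trans (h _ (hx _))
  obtain ⟨m, hm⟩ := pow_unbounded_of_one_lt (ε / ‖x‖) hr
  rw [div_lt_iff₀ hpos] at hm
  exact absurd (hm.trans_le (hpow m)) (not_lt.2 (hx _).le)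

end SmallBall

end AndersonModule

/-! ### Finite generation of the special functions -/

theorem norm_algebraMap_of_finite (Fq : Type*) {C : Type*} [Field Fq] [Finite Fq] [NormedField C]
    [Algebra Fq C] {c : Fq} (hc : c ≠ 0) : ‖algebraMap Fq C c‖ = 1 := by
  obtain ⟨n, hn, hcn⟩ := (isOfFinOrder_of_finite (Units.mk0 c hc)).exists_pow_eq_one
  have h2 : c ^ n = 1 := congrArg Units.val hcn
  refine (pow_eq_one_iff_of_nonneg (norm_nonneg _) hn.ne').1 ?_
  rw [← norm_pow, ← map_pow, h2, map_one, norm_one]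

section NormBall

variable (Fq A K C : Type*) [Field Fq] [Finite Fq] [CommRing A] [Field K]
  [NormedField C] [IsUltrametricDist C] [Algebra Fq A] [Algebra A K] [Algebra Fq K]
  [IsScalarTower Fq A K] [Algebra K C] [Algebra Fq C] [IsScalarTower Fq K C]

/-- The elements of `A` of norm smaller than a positive bound. -/
def normBall (r : ℝ) (hr : 0 < r) : Submodule Fq A where
  carrier := {x | ‖algebraMap K C (algebraMap A K x)‖ < r}
  zero_mem' := by simpa using hr
  add_mem' {x y} hx hy := by
    simp only [Set.mem_ofPred_eq, map_add] at *
    exact (IsUltrametricDist.norm_add_le_max _ _).trans_lt (max_lt hx hy)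
  smul_mem' c x hx := by
    simp only [Set.mem_ofPred_eq, Algebra.smul_def, map_mul, norm_mul] at *
    rw [← IsScalarTower.algebraMap_apply Fq A K, ← IsScalarTower.algebraMap_apply Fq K C]
    rcases eq_or_ne c 0 with rfl | hc
    · simpa using hr
    · rwa [norm_algebraMap_of_finite Fq hc, one_mul]

variable {Fq A K C}

theorem mem_normBall {r : ℝ} {hr : 0 < r} {x : A} :
    x ∈ normBall Fq A K C r hr ↔ ‖algebraMap K C (algebraMap A K x)‖ < r := Iff.rfl

/-- A functional vanishing on a ball extends along multiplication by `t` to a functional vanishing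
on the larger ball. -/
theorem exists_dual_mul_eq {r s : ℝ} {hr : 0 < r} {hs : 0 < s} {t : A}
    (ht : 0 < ‖algebraMap K C (algebraMap A K t)‖)
    (hrs : ‖algebraMap K C (algebraMap A K t)‖ * r = s) {l : Module.Dual Fq A}
    (hl : ∀ x ∈ normBall Fq A K C r hr, l x = 0) :
    ∃ l' : Module.Dual Fq A, (∀ x ∈ normBall Fq A K C s hs, l' x = 0) ∧ ∀ x, l' (t * x) = l x := by
  let g : A →ₗ[Fq] A ⧸ normBall Fq A K C s hs :=
    (normBall Fq A K C s hs).mkQ ∘ₗ LinearMap.mulLeft Fq t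
  -- The kernel of `x ↦ t x` modulo the larger ball lies in the smaller ball, where `l` vanishes.
  have hg : l ∈ LinearMap.range g.dualMap := by
    rw [LinearMap.range_dualMap_eq_dualAnnihilator_ker, Submodule.mem_dualAnnihilator]
    intro x hx
    refine hl x ?_
    have h1 : t * x ∈ normBall Fq A K C s hs := (Submodule.Quotient.mk_eq_zero _).1 hx
    rw [mem_normBall, map_mul, map_mul, norm_mul, ← hrs] at h1
    exact lt_of_mul_lt_mul_left h1 ht.le
  obtain ⟨l', hl'⟩ := hg
  refine ⟨l' ∘ₗ (normBall Fq A K C s hs).mkQ, fun x hx => ?_, fun x => ?_⟩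
  · rw [LinearMap.comp_apply, Submodule.mkQ_apply, (Submodule.Quotient.mk_eq_zero _).2 hx, map_zero]
  · rw [← hl']; rfl

end NormBall

namespace AndersonModule

variable {Fq A K C : Type*} [Field Fq] [Finite Fq] [CommRing A] [IsDedekindDomain A]
  [Field K] [NormedField C] [Algebra Fq A] [Algebra A K] [Algebra Fq K] [IsScalarTower Fq A K]
  [IsFractionRing A K] [Algebra K C] [Algebra Fq C] [IsScalarTower Fq K C]
  {Oinf : ValuationSubring K} {L : IntermediateField K C}

omit [Algebra Fq K] [IsScalarTower Fq A K] [IsScalarTower Fq K C] in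
/-- Modulo a nonzero element of `A`, there are finitely many special functions. -/
theorem exists_finite_range_forall_eq_smul [Algebra.FiniteType Fq A] (E : AndersonModule Fq A L)
    {t : A} (ht : t ≠ 0) :
    ∃ r : dualHom Fq A E.Points → {l : Module.Dual Fq A // ∀ x, l (t * x) = 0} → E.Points,
      (Set.range r).Finite ∧
      ∀ f f', r f = r f' → ∃ g : dualHom Fq A E.Points, f - f' = t • g := by
  let D := {l : Module.Dual Fq A // ∀ x, l (t * x) = 0}
  have hQ : Finite (A ⧸ Ideal.span {t}) := finite_quotient_of_finiteType Fq (by simpa using ht)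
  -- Such functionals live on the finite ring `A/(t)`, and `f` sends them to the finite set of
  -- `t`-torsion points. So `r f`, the restriction of `f` to them, takes finitely many values.
  have hD : Finite D := by
    refine Finite.of_injective (fun (l : D) (x : A ⧸ Ideal.span {t}) => l.1 x.out) fun l l' h => ?_
    refine Subtype.ext (LinearMap.ext fun x => ?_)
    have hx : ∀ l : D, l.1 x = l.1 (Quotient.out (Ideal.Quotient.mk (Ideal.span {t}) x)) := by
      intro l
      have : Ideal.Quotient.mk (Ideal.span {t}) x =
          Ideal.Quotient.mk _ (Quotient.out (Ideal.Quotient.mk (Ideal.span {t}) x)) :=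
        (Quotient.out_eq _).symm
      rw [Ideal.Quotient.eq, Ideal.mem_span_singleton] at this
      obtain ⟨y, hy⟩ := this
      rw [← sub_eq_zero, ← map_sub, hy, l.2]
    rw [hx, hx l']
    exact congrFun h _
  have htor := E.finite_setOf_smul_eq_zero ht
  refine ⟨fun f l => f.1 l.1, ?_, fun f f' h => ?_⟩
  · refine (Set.Finite.pi' fun _ : D => htor).subset ?_
    rintro _ ⟨f, rfl⟩ l
    change t • f.1 l.1 = 0
    rw [← f.2.2]
    have : (LinearMap.mulLeft Fq t).dualMap l.1 = 0 := LinearMap.ext l.2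
    rw [this, map_zero]
  · obtain ⟨g, hg, h1⟩ := exists_smul_eq_of_forall_eq_zero (f - f').2 ht fun l hl => by
      have := congrFun h ⟨l, hl⟩
      exact sub_eq_zero.2 this
    exact ⟨⟨g, hg⟩, Subtype.ext h1⟩

/-- The special functions form a finitely generated module. -/
theorem finite_dualHom (hA : IsPuncturedCurve Fq A K Oinf) (hC : IsCompletedAlgClosure K C Oinf)
    (E : AndersonModule Fq A L) {t : A} (ht : algebraMap A K t ∉ Oinf) :
    Module.Finite A (dualHom Fq A E.Points) := by
  have := hC.ultrametric
  have := hC.complete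
  have := hA.finiteType
  have ht1 : 1 < ‖algebraMap K C (algebraMap A K t)‖ := by
    rwa [← not_le, hC.norm_le_one_iff]
  have ht0 : t ≠ 0 := by
    rintro rfl
    exact ht (by simp)
  have hpow : ∀ m, 0 < ‖algebraMap K C (algebraMap A K t)‖ ^ m := fun m => pow_pos (by linarith) m
  obtain ⟨ε, hε, hball⟩ := E.exists_ball_eq_zero ht1
  obtain ⟨r, hr, hrf⟩ := E.exists_finite_range_forall_eq_smul ht0
  let W : ℕ → Submodule Fq A := fun m => normBall Fq A K C _ (hpow m)
  have hW : ∀ m n, m ≤ n → W m ≤ W n := fun m n hmn x hx =>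
    lt_of_lt_of_le hx (pow_le_pow_right₀ ht1.le hmn)
  -- `f ∈ V m` says that `f` is small on functionals killing the elements of norm less than `‖t‖ ^
  -- m`; this plays the role of a bound on a height.
  let V : ℕ → Set (dualHom Fq A E.Points) := fun m =>
    {f | ∀ l : Module.Dual Fq A, (∀ x ∈ W m, l x = 0) → ‖f.1 l‖ < ε}
  have hV : ∀ m n, m ≤ n → V m ⊆ V n := fun m n hmn f hf l hl =>
    hf l fun x hx => hl x (hW m n hmn hx)
  have hsub : ∀ m, ∀ f ∈ V m, ∀ f' ∈ V m, f - f' ∈ V m := fun m f hf f' hf' l hl => by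
    have := IsUltrametricDist.norm_add_le_max (f.1 l) (-f'.1 l)
    rw [norm_neg, ← sub_eq_add_neg] at this
    exact this.trans_lt (max_lt (hf l hl) (hf' l hl))
  -- An element of `A` of norm less than `1` is a constant, hence zero. So `f` is small everywhere,
  -- and the `A`-submodule generated by each value `f l` lies in the ball that contains no nonzero
  -- one.
  have hV0 : ∀ f ∈ V 0, f = 0 := by
    intro f hf
    refine Subtype.ext (LinearMap.ext fun l => hball _ fun a => ?_)
    rw [← f.2.2]
    refine hf _ fun x hx => ?_
    have hx1 : ‖algebraMap K C (algebraMap A K x)‖ < 1 := by simpa [W, mem_normBall] using hx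
    obtain ⟨c, rfl⟩ := hA.exists_algebraMap_eq ((hC.norm_le_one_iff _).1 hx1.le)
    rcases eq_or_ne c 0 with rfl | hc
    · rw [map_zero, map_zero]
    · rw [← IsScalarTower.algebraMap_apply Fq A K, ← IsScalarTower.algebraMap_apply Fq K C,
        norm_algebraMap_of_finite Fq hc] at hx1
      exact absurd hx1 (lt_irrefl _)
  have hdiv : ∀ m g, t • g ∈ V (m + 1) → g ∈ V m := by
    intro m g hg l hl
    obtain ⟨l', hl', hll'⟩ := exists_dual_mul_eq (hs := hpow (m + 1)) (by linarith)
      (pow_succ' _ m).symm hl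
    have h1 := hg l' hl'
    change ‖t • g.1 l'‖ < ε at h1
    rw [← g.2.2] at h1
    have h2 : (LinearMap.mulLeft Fq t).dualMap l' = l := LinearMap.ext hll'
    rwa [h2] at h1
  -- Two elements of `V (m + 1)` in the same class modulo `t` differ by `t g` with `g ∈ V m`, and
  -- there are finitely many classes.
  have hfin : ∀ m, (V m).Finite := by
    intro m
    induction m with
    | zero => exact (Set.finite_singleton 0).subset hV0
    | succ m ih =>
      refine Set.Finite.of_finite_fibers r (hr.subset (Set.image_subset_range _ _)) ?_
      rintro _ ⟨f, hf, rfl⟩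
      refine (ih.image fun g => f + t • g).subset ?_
      rintro f' ⟨hf', hff'⟩
      obtain ⟨g, hg⟩ := hrf _ _ hff'
      refine ⟨g, hdiv m g (hg ▸ hsub _ _ hf' _ hf), ?_⟩
      change f + t • g = f'
      rw [← hg]; abel
  have hex : ∀ f, ∃ m, f ∈ V m := by
    intro f
    obtain ⟨s, hs⟩ := f.2.1 _ (Metric.ball_mem_nhds 0 hε)
    have : ∀ x : A, ∃ m, x ∈ W m := fun x => pow_unbounded_of_one_lt _ ht1
    choose m hm using this
    refine ⟨s.sup m, fun l hl => ?_⟩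
    have := hs l fun x hx => hl x (hW _ _ (Finset.le_sup hx) (hm x))
    rwa [mem_ball_zero_iff] at this
  -- One representative for each of the finitely many values of `r`; `m₀` bounds the levels of all
  -- of them.
  obtain ⟨m₀, hm₀⟩ : ∃ m₀, ∀ f, ∃ f' ∈ V m₀, r f = r f' := by
    choose m hm using hex
    choose! σ hσ using fun y (hy : y ∈ Set.range r) => hy
    refine ⟨hr.toFinset.sup fun y => m (σ y), fun f => ⟨σ (r f), ?_, (hσ _ ⟨f, rfl⟩).symm⟩⟩
    exact hV _ _ (Finset.le_sup (f := fun y => m (σ y)) (hr.mem_toFinset.2 ⟨f, rfl⟩)) (hm _)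
  -- Descent: above level `m₀`, subtracting a representative and dividing by `t` lowers the level by
  -- one.
  have hspan : ∀ n, V n ⊆ Submodule.span A (V m₀) := by
    intro n
    induction n with
    | zero =>
      intro f hf
      rw [hV0 f hf]
      exact Submodule.zero_mem _
    | succ n ih =>
      intro f hf
      rcases le_total (n + 1) m₀ with h | h
      · exact Submodule.subset_span (hV _ _ h hf)
      · obtain ⟨f', hf', hff'⟩ := hm₀ f
        obtain ⟨g, hg⟩ := hrf _ _ hff'
        have hg' : g ∈ V n := hdiv n g (hg ▸ hsub _ _ hf _ (hV _ _ h hf'))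
        rw [← sub_add_cancel f f', hg]
        exact add_mem (Submodule.smul_mem _ _ (ih hg')) (Submodule.subset_span hf')
  refine ⟨⟨(hfin m₀).toFinset, ?_⟩⟩
  rw [Set.Finite.coe_toFinset, eq_top_iff]
  rintro f -
  obtain ⟨n, hn⟩ := hex f
  exact hspan n hn

end AndersonModule

/-! ### The exponential map and division points -/

theorem HasSum.norm_le_of_forall_norm_le {V ι : Type*} [NormedAddCommGroup V] [IsUltrametricDist V]
    {f : ι → V} {a : V} (h : HasSum f a) {M : ℝ} (hM : 0 ≤ M) (hf : ∀ i, ‖f i‖ ≤ M) : ‖a‖ ≤ M := by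
  have hclosed : IsClosed {x : V | ‖x‖ ≤ M} := isClosed_le continuous_norm continuous_const
  refine hclosed.mem_of_tendsto h (Eventually.of_forall fun s => ?_)
  exact IsUltrametricDist.norm_sum_le_of_forall_le_of_nonneg hM fun i _ => hf i

namespace AndersonModule

variable {Fq A K C : Type*} [Field Fq] [Finite Fq] [CommRing A] [Field K]
  [NormedField C] [Algebra A K] [Algebra K C] [Algebra Fq C] {L : IntermediateField K C}

omit [Finite Fq] in
/-- An everywhere convergent `q`-power series is continuous along scalar multiples. -/
theorem exists_norm_exp_smul_le [IsUltrametricDist C] {q d : ℕ} (hq : 0 < q)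
    {e : ℕ → Matrix (Fin d) (Fin d) C} {exp : (Fin d → C) → Fin d → C}
    (hexp : ∀ x, HasSum (fun n => (e n).mulVec fun i => x i ^ q ^ n) (exp x)) (z : Fin d → C) :
    ∃ M, 0 ≤ M ∧ ∀ c : C, ‖c‖ ≤ 1 → ‖exp (c • z)‖ ≤ ‖c‖ * M := by
  have h0 := (hexp z).summable.tendsto_cofinite_zero
  rw [Nat.cofinite_eq_atTop] at h0
  obtain ⟨M, hM⟩ := (Metric.isBounded_range_of_tendsto _ h0).exists_norm_le
  have hM0 : 0 ≤ M := (norm_nonneg _).trans (hM _ ⟨0, rfl⟩)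
  refine ⟨M, hM0, fun c hc => (hexp (c • z)).norm_le_of_forall_norm_le (by positivity) fun n => ?_⟩
  have : (fun i => (c • z) i ^ q ^ n) = c ^ q ^ n • fun i => z i ^ q ^ n := by
    ext i; simp [mul_pow]
  rw [this, Matrix.mulVec_smul, norm_smul, norm_pow]
  refine mul_le_mul ?_ (hM _ ⟨n, rfl⟩) (norm_nonneg _) (norm_nonneg _)
  exact pow_le_of_le_one (norm_nonneg _) hc (pow_pos hq n).ne'

/-- A point of a uniformizable module has a sequence of `t`-division points converging to `0`. -/
theorem IsUniformizable.exists_division_sequence [IsUltrametricDist C] {E : AndersonModule Fq A L}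
    (hE : E.IsUniformizable) {t : A} (ht : 1 < ‖algebraMap K C (algebraMap A K t)‖)
    (w : E.Points) :
    ∃ s : ℕ → E.Points, s 0 = w ∧ (∀ n, t • s (n + 1) = s n) ∧ Tendsto s atTop (𝓝 0) := by
  obtain ⟨e, exp, -, hexp, hφ, hsurj⟩ := hE
  obtain ⟨y, hy⟩ := hsurj w
  obtain ⟨k, -, hk⟩ := E.exists_coeff_zero_pow_eq t
  set T := (E.coeff t 0).map (algebraMap L C) with hT
  set c := algebraMap K C (algebraMap A K t)
  set N := Nat.card Fq ^ k
  have hN : 0 < N := pow_pos Finite.card_pos _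
  have hc : c ≠ 0 := norm_pos_iff.1 (by linarith)
  have hTu : IsUnit T := by
    rw [← isUnit_pow_iff hN.ne', hk]
    exact (isUnit_iff_ne_zero.2 (pow_ne_zero _ hc)).map _
  have hTS : T * T⁻¹ = 1 := Matrix.mul_nonsing_inv _ ((Matrix.isUnit_iff_isUnit_det _).1 hTu)
  have hSN : T⁻¹ ^ N = Matrix.scalar _ ((c ^ N)⁻¹) := by
    refine (left_inv_eq_right_inv (a := T ^ N) ?_ ?_)
    · have hcomm : Commute T⁻¹ T :=
        (Matrix.nonsing_inv_mul _ ((Matrix.isUnit_iff_isUnit_det _).1 hTu)).trans hTS.symm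
      rw [← hcomm.mul_pow, hcomm.eq, hTS, one_pow]
    · rw [hk, ← map_mul, mul_inv_cancel₀ (pow_ne_zero _ hc), map_one]
  -- Division by `t` on the module corresponds to the inverse of the linear part `T` on the Lie
  -- algebra.
  refine ⟨fun n => exp ((T⁻¹ ^ n).mulVec y), ?_, fun n => ?_, ?_⟩
  · refine Eq.trans ?_ hy
    exact congrArg exp (by rw [pow_zero, Matrix.one_mulVec])
  · change E.φ t _ = _
    rw [hφ, Matrix.mulVec_mulVec, pow_succ', ← mul_assoc, hTS, one_mul]
  -- Since `T⁻¹ ^ N` is the scalar `c ^ (-N)`, the sequence splits by residues modulo `N`, and along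
  -- each residue class the argument of `exp` is a fixed vector times powers of a small scalar.
  · choose M hM0 hM using fun r => exists_norm_exp_smul_le (Finite.card_pos (α := Fq)) hexp
      ((T⁻¹ ^ r).mulVec y)
    have hc1 : ‖(c ^ N)⁻¹‖ < 1 := by
      rw [norm_inv, norm_pow]
      exact inv_lt_one_of_one_lt₀ (one_lt_pow₀ ht hN.ne')
    refine squeeze_zero_norm (a := fun n => ‖(c ^ N)⁻¹‖ ^ (n / N) * ∑ r ∈ Finset.range N, M r)
      (fun n => ?_) ?_
    · have h1 : (T⁻¹ ^ n).mulVec y = ((c ^ N)⁻¹ ^ (n / N)) • (T⁻¹ ^ (n % N)).mulVec y := by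
        conv_lhs => rw [← Nat.div_add_mod n N, pow_add, pow_mul, hSN, ← map_pow,
          ← Matrix.mulVec_mulVec]
        ext i
        simp [Matrix.mulVec_diagonal]
      have h2 := hM (n % N) ((c ^ N)⁻¹ ^ (n / N)) (by
        rw [norm_pow]; exact pow_le_one₀ (norm_nonneg _) hc1.le)
      rw [← h1, norm_pow] at h2
      refine h2.trans (mul_le_mul_of_nonneg_left ?_ (by positivity))
      exact Finset.single_le_sum (fun r _ => hM0 r) (Finset.mem_range.2 (Nat.mod_lt _ hN))
    · have h3 := ((tendsto_pow_atTop_nhds_zero_of_lt_one (norm_nonneg _) hc1).comp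
        (Nat.tendsto_div_const_atTop hN.ne')).mul_const (∑ r ∈ Finset.range N, M r)
      rwa [zero_mul] at h3

/-- On a uniformizable module, the constants act through the structure of vector space. -/
theorem IsUniformizable.algebraMap_smul [CompleteSpace C] [Algebra Fq A] [Algebra Fq K]
    [IsScalarTower Fq A K] [IsScalarTower Fq K C] {E : AndersonModule Fq A L}
    (hE : E.IsUniformizable) {t : K} (ht : 1 < ‖algebraMap K C t‖) (c : Fq) (x : E.Points) :
    algebraMap Fq A c • x = c • x := by
  let _ : NontriviallyNormedField C := { ‹NormedField C› with non_trivial := ⟨_, ht⟩ }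
  obtain ⟨e, exp, -, hexp, hφ, hsurj⟩ := hE
  have hcard : ∀ n, c ^ Nat.card Fq ^ n = c := by
    have := Fintype.ofFinite Fq
    intro n
    rw [Nat.card_eq_fintype_card, FiniteField.pow_card_pow]
  set T := (E.coeff (algebraMap Fq A c) 0).map (algebraMap L C) with hT
  -- As `c^(q^k) = c`, the action of `c` equals its own `q^k`-th iterate. Comparing derivatives
  -- gives `T = T^(q^k)`, which is the scalar `c^(q^k) = c`.
  have hTc : ∀ y, T.mulVec y = algebraMap Fq C c • y := by
    obtain ⟨k, -, hk⟩ := E.exists_coeff_zero_pow_eq (algebraMap Fq A c)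
    have h1 := E.hasFDerivAt_φ (algebraMap Fq A c)
    have h2 := h1.iterate (map_zero _) (Nat.card Fq ^ k)
    rw [← Module.End.coe_pow, ← map_pow, ← map_pow, hcard] at h2
    intro y
    have h3 := congrArg (fun f : (Fin E.dim → C) →L[C] (Fin E.dim → C) => f y) (h1.unique h2)
    have h4 : ∀ m (y : Fin E.dim → C), ((LinearMap.toContinuousLinearMap T.mulVecLin) ^ m) y =
        (T ^ m).mulVec y := by
      intro m
      induction m with
      | zero => simp
      | succ m ih =>
        intro y
        rw [pow_succ, pow_succ, ← Matrix.mulVec_mulVec, ← ih]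
        rfl
    change T.mulVec y = ((LinearMap.toContinuousLinearMap T.mulVecLin) ^ _) y at h3
    rw [h3, h4, hk, ← IsScalarTower.algebraMap_apply Fq A K, ← IsScalarTower.algebraMap_apply Fq K C,
      ← map_pow, hcard]
    ext i
    simp [Matrix.mulVec_diagonal]
  obtain ⟨y, rfl⟩ := hsurj x
  change E.φ _ (exp y) = c • exp y
  rw [hφ, ← hT, hTc]
  refine (hexp _).unique ?_
  have h1 := (hexp y).const_smul (algebraMap Fq C c)
  have h2 : c • exp y = algebraMap Fq C c • exp y := by
    ext i
    simp [Algebra.smul_def]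
  rw [h2]
  convert h1 using 2 with n
  rw [← Matrix.mulVec_smul]
  congr 1
  ext i
  simp only [Pi.smul_apply, smul_eq_mul, mul_pow]
  rw [← map_pow, hcard]

end AndersonModule

/-! ### The polynomial dual of `A` -/

/-- The dual of an algebra `A` over `P`, with `A` acting through multiplication on the argument. -/
def AlgDual (P A : Type*) [CommRing P] [CommRing A] [Algebra P A] : Type _ := A →ₗ[P] P

namespace AlgDual

section Basic

variable {P A : Type*} [CommRing P] [CommRing A] [Algebra P A]

instance : AddCommGroup (AlgDual P A) := inferInstanceAs (AddCommGroup (A →ₗ[P] P))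

instance : Module P (AlgDual P A) := inferInstanceAs (Module P (A →ₗ[P] P))

/-- An element of the dual as a linear map. -/
def toLin : AlgDual P A ≃ₗ[P] (A →ₗ[P] P) := LinearEquiv.refl P _

theorem ext {l l' : AlgDual P A} (h : ∀ x, l.toLin x = l'.toLin x) : l = l' := LinearMap.ext h

instance : SMul A (AlgDual P A) := ⟨fun a l => toLin.symm (l.toLin.comp (LinearMap.mulLeft P a))⟩

theorem smul_toLin (a : A) (l : AlgDual P A) (x : A) : (a • l).toLin x = l.toLin (a * x) := rfl

instance : Module A (AlgDual P A) where
  one_smul l := ext fun x => by rw [smul_toLin, one_mul]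
  mul_smul a b l := ext fun x => by rw [smul_toLin, smul_toLin, smul_toLin, mul_left_comm, mul_assoc]
  smul_zero a := rfl
  smul_add a l l' := rfl
  add_smul a b l := ext fun x => by
    rw [map_add, LinearMap.add_apply, smul_toLin, smul_toLin, smul_toLin, add_mul, map_add]
  zero_smul l := ext fun x => by
    rw [smul_toLin, zero_mul, map_zero, map_zero, LinearMap.zero_apply]

instance : IsScalarTower P A (AlgDual P A) :=
  ⟨fun p a l => ext fun x => by
    rw [LinearEquiv.map_smul, LinearMap.smul_apply, smul_toLin, smul_toLin, smul_mul_assoc,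
      LinearMap.map_smul]⟩

end Basic

section Projective

variable {P A : Type*} [CommRing P] [IsDomain P] [IsPrincipalIdealRing P] [CommRing A]
  [IsDedekindDomain A] [Algebra P A] [Module.Finite P A] [Module.IsTorsionFree P A]

instance : Module.Finite A (AlgDual P A) :=
  have : Module.Free P A := inferInstance
  have : Module.Finite P (AlgDual P A) := inferInstanceAs (Module.Finite P (A →ₗ[P] P))
  Module.Finite.of_restrictScalars_finite P A _

instance : Module.IsTorsionFree A (AlgDual P A) := by
  refine .of_smul_eq_zero fun a l h => ?_
  by_contra! hne
  -- A nonzero `a` divides a nonzero `p ∈ P` by integrality, and `P` acts without torsion on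
  -- functionals with values in the domain `P`.
  have hc := Ideal.comap_ne_bot_of_integral_mem (R := P) hne.1 (Ideal.mem_span_singleton_self a)
    (Algebra.IsIntegral.isIntegral a)
  obtain ⟨p, hp, hp0⟩ := Submodule.exists_mem_ne_zero_of_ne_bot hc
  obtain ⟨y, hy⟩ := Ideal.mem_span_singleton.1 (Ideal.mem_comap.1 hp)
  refine hne.2 (AlgDual.ext fun x => ?_)
  have h1 : p * l.toLin x = 0 := by
    rw [← smul_eq_mul, ← map_smul, Algebra.smul_def, hy, mul_assoc, ← smul_toLin, h]
    rfl
  exact (mul_eq_zero.1 h1).resolve_left hp0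

/-- Over a Dedekind domain torsion-free modules are flat, and finitely presented flat modules are
projective. Projectivity later allows an `A`-linear choice of division sequences. -/
instance : Module.Projective A (AlgDual P A) :=
  have : Module.FinitePresentation A (AlgDual P A) := Module.finitePresentation_of_finite _ _
  Module.Flat.projective_of_finitePresentation

end Projective

section Coefficients

variable {Fq A : Type*} [Field Fq] [CommRing A] [Algebra Fq A] [Algebra Fq[X] A]
  [IsScalarTower Fq Fq[X] A]

/-- The functional obtained by taking a coefficient of a polynomial valued functional. -/
noncomputable def coeffDual (n : ℕ) : AlgDual Fq[X] A →+ Module.Dual Fq A where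
  toFun δ := Polynomial.lcoeff Fq n ∘ₗ δ.toLin.restrictScalars Fq
  map_zero' := LinearMap.ext fun _ => Polynomial.coeff_zero n
  map_add' _ _ := LinearMap.ext fun _ => Polynomial.coeff_add _ _ n

theorem coeffDual_apply (n : ℕ) (δ : AlgDual Fq[X] A) (x : A) :
    coeffDual n δ x = (δ.toLin x).coeff n := rfl

theorem coeffDual_smul (n : ℕ) (a : A) (δ : AlgDual Fq[X] A) :
    coeffDual n (a • δ) = (LinearMap.mulLeft Fq a).dualMap (coeffDual n δ) := rfl

theorem coeffDual_X_smul_zero (δ : AlgDual Fq[X] A) :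
    coeffDual 0 ((Polynomial.X : Fq[X]) • δ) = 0 := by
  ext x
  simp [coeffDual_apply]

theorem coeffDual_X_smul_succ (n : ℕ) (δ : AlgDual Fq[X] A) :
    coeffDual (n + 1) ((Polynomial.X : Fq[X]) • δ) = coeffDual n δ := by
  ext x
  simp [coeffDual_apply]

/-- A functional killing `X A` is determined by its values on an `Fq[X]`-basis of `A`; extending
these values `Fq[X]`-linearly, as constants, gives `δ`. -/
theorem exists_coeffDual_zero_eq {κ : Type*} [Finite κ] (c : Module.Basis κ Fq[X] A)
    {l : Module.Dual Fq A} (hl : ∀ x, l (algebraMap Fq[X] A Polynomial.X * x) = 0) :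
    ∃ δ : AlgDual Fq[X] A, coeffDual 0 δ = l := by
  have := Fintype.ofFinite κ
  refine ⟨toLin.symm (∑ i, Polynomial.C (l (c i)) • c.coord i), LinearMap.ext fun x => ?_⟩
  have hp : ∀ (p : Fq[X]) y, l (p • y) = p.coeff 0 * l y := by
    intro p y
    conv_lhs => rw [← Polynomial.divX_mul_X_add p, add_smul, map_add, mul_comm, mul_smul,
      Algebra.smul_def Polynomial.X, hl, zero_add, ← Polynomial.algebraMap_eq, algebraMap_smul,
      map_smul, smul_eq_mul]
  conv_rhs => rw [← c.sum_repr x, map_sum]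
  rw [coeffDual_apply, LinearEquiv.apply_symm_apply, LinearMap.sum_apply,
    Polynomial.finsetSum_coeff]
  refine Finset.sum_congr rfl fun i _ => ?_
  rw [hp, LinearMap.smul_apply, Module.Basis.coord_apply, smul_eq_mul, Polynomial.coeff_C_mul,
    mul_comm]

end Coefficients

end AlgDual

/-! ### Special functions from division sequences -/

section NullSequences

variable {A : Type*} (V : Type*) [CommRing A] [AddCommGroup V] [TopologicalSpace V]
  [IsTopologicalAddGroup V] [Module A V] [ContinuousConstSMul A V]

/-- The sequences converging to `0` of successive `t`-division points of `0`. -/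
def nullDivisionSequences (t : A) : Submodule A (ℕ → V) where
  carrier := {s | (∀ n, t • s (n + 1) = s n) ∧ t • s 0 = 0 ∧ Tendsto s atTop (𝓝 0)}
  zero_mem' := ⟨fun n => smul_zero t, smul_zero t, tendsto_const_nhds⟩
  add_mem' := fun {s s'} hs hs' => ⟨fun n => by
      rw [Pi.add_apply, Pi.add_apply, smul_add, hs.1, hs'.1], by
      rw [Pi.add_apply, smul_add, hs.2.1, hs'.2.1, add_zero], by
      simpa [Pi.add_def] using hs.2.2.add hs'.2.2⟩
  smul_mem' := fun a s hs => ⟨fun n => by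
      rw [Pi.smul_apply, Pi.smul_apply, smul_comm, hs.1], by
      rw [Pi.smul_apply, smul_comm, hs.2.1, smul_zero], by
      simpa [Pi.smul_def] using hs.2.2.const_smul a⟩

end NullSequences

section Construction

variable {Fq A V : Type*} [Field Fq] [Finite Fq] [CommRing A] [Algebra Fq A] [Algebra Fq[X] A]
  [IsScalarTower Fq Fq[X] A] [AddCommGroup V] [UniformSpace V] [IsUniformAddGroup V]
  [NonarchimedeanAddGroup V] [T2Space V] [CompleteSpace V] [Module Fq V] [ContinuousConstSMul Fq V]
  [Module A V] [SMulCommClass Fq A V] [IsScalarTower Fq A V] [ContinuousConstSMul A V]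

/-- A continuous `A`-linear map on the dual of `A` is determined by sequences of division points. -/
theorem exists_dualHom_coeffDual_eq {κ : Type*} [Finite κ] (c : Module.Basis κ Fq[X] A)
    (G : AlgDual Fq[X] A →ₗ[A]
      nullDivisionSequences V (algebraMap Fq[X] A Polynomial.X)) :
    ∃ f ∈ dualHom Fq A V, ∀ δ n, f (AlgDual.coeffDual n δ) = (G δ).1 n := by
  let B : Module.Basis (ℕ × κ) Fq A := (Polynomial.basisMonomials Fq).smulTower c
  let γ : κ → AlgDual Fq[X] A := fun i => AlgDual.toLin.symm (c.coord i)
  have hB : ∀ n i, B.coord (n, i) = AlgDual.coeffDual n (γ i) := by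
    intro n i
    ext x
    rw [Module.Basis.coord_apply, Module.Basis.smulTower_repr]
    rfl
  let h : ℕ × κ → V := fun p => (G (γ p.2)).1 p.1
  have hh : Tendsto h cofinite (𝓝 0) := by
    intro U hU
    have h1 : ∀ i, {n | (G (γ i)).1 n ∉ U}.Finite := fun i => by
      have := (G (γ i)).2.2.2 hU
      rw [← Nat.cofinite_eq_atTop] at this
      exact this
    refine ((Set.finite_iUnion fun i => (h1 i).image fun n => (n, i))).subset ?_
    rintro ⟨n, i⟩ hn
    exact Set.mem_iUnion.2 ⟨i, n, hn, rfl⟩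
  let f := dualEval B hh
  have hf : IsDualContinuous f := isDualContinuous_dualEval B hh
  have hfγ : ∀ n i, f (AlgDual.coeffDual n (γ i)) = (G (γ i)).1 n := fun n i => by
    rw [← hB]
    exact dualEval_coord B hh (n, i)
  -- The `γ i` span over `Fq[X]`. Compatibility passes through multiplication by `X`, which shifts
  -- coefficients; at `n = 0` this is the condition `t • s 0 = 0`.
  have hfδ : ∀ δ n, f (AlgDual.coeffDual n δ) = (G δ).1 n := by
    have hsmul : ∀ (p : Fq[X]) δ, (∀ n, f (AlgDual.coeffDual n δ) = (G δ).1 n) →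
        ∀ n, f (AlgDual.coeffDual n (p • δ)) = (G (p • δ)).1 n := by
      intro p
      have hadd : ∀ p q : Fq[X], ∀ δ,
          (∀ n, f (AlgDual.coeffDual n (p • δ)) = (G (p • δ)).1 n) →
          (∀ n, f (AlgDual.coeffDual n (q • δ)) = (G (q • δ)).1 n) →
          ∀ n, f (AlgDual.coeffDual n ((p + q) • δ)) = (G ((p + q) • δ)).1 n := by
        intro p q δ hp hq n
        rw [add_smul, map_add, map_add, hp, hq, map_add]
        rfl
      have hC : ∀ (a : Fq) δ, (∀ n, f (AlgDual.coeffDual n δ) = (G δ).1 n) →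
          ∀ n, f (AlgDual.coeffDual n (Polynomial.C a • δ)) =
            (G (Polynomial.C a • δ)).1 n := by
        intro a δ hδ n
        have h1 : AlgDual.coeffDual n (Polynomial.C a • δ) = a • AlgDual.coeffDual n δ := by
          ext x; simp [AlgDual.coeffDual_apply]
        have h2 : Polynomial.C a • δ = algebraMap Fq A a • δ := by
          rw [IsScalarTower.algebraMap_apply Fq Fq[X] A, algebraMap_smul]
          rfl
        rw [h1, map_smul, hδ, h2, map_smul]
        exact (algebraMap_smul A a ((G δ).1 n)).symm
      have hX : ∀ δ, (∀ n, f (AlgDual.coeffDual n δ) = (G δ).1 n) →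
          ∀ n, f (AlgDual.coeffDual n ((Polynomial.X : Fq[X]) • δ)) =
            (G ((Polynomial.X : Fq[X]) • δ)).1 n := by
        intro δ hδ n
        have h2 : (Polynomial.X : Fq[X]) • δ = algebraMap Fq[X] A Polynomial.X • δ :=
          (algebraMap_smul A _ _).symm
        have h3 : (G ((Polynomial.X : Fq[X]) • δ)).1 n =
            algebraMap Fq[X] A Polynomial.X • (G δ).1 n := by
          rw [h2, map_smul]
          rfl
        rw [h3]
        cases n with
        | zero => rw [AlgDual.coeffDual_X_smul_zero, map_zero, (G δ).2.2.1]
        | succ n => rw [AlgDual.coeffDual_X_smul_succ, hδ, (G δ).2.1]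
      induction p using Polynomial.induction_on' with
      | add p q hp hq => exact fun δ hδ => hadd p q δ (hp δ hδ) (hq δ hδ)
      | monomial n a =>
        induction n with
        | zero => exact hC a
        | succ n ih =>
          intro δ hδ
          rw [← Polynomial.monomial_mul_X, mul_smul]
          exact ih _ (hX δ hδ)
    intro δ
    have := Fintype.ofFinite κ
    have hδ : δ = ∑ i, δ.toLin (c i) • γ i := by
      refine AlgDual.ext fun x => ?_
      have h1 : AlgDual.toLin (∑ i, δ.toLin (c i) • γ i) = ∑ i, δ.toLin (c i) • c.coord i := by
        rw [map_sum]; rfl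
      rw [h1, LinearMap.sum_apply]
      conv_lhs => rw [← c.sum_repr x, map_sum]
      refine Finset.sum_congr rfl fun i _ => ?_
      rw [map_smul, LinearMap.smul_apply, Module.Basis.coord_apply, smul_eq_mul, smul_eq_mul,
        mul_comm]
    intro n
    rw [hδ, map_sum, map_sum, map_sum, Submodule.coe_sum, Finset.sum_apply]
    exact Finset.sum_congr rfl fun i _ => hsmul _ _ (fun n => hfγ n i) n
  refine ⟨f, ⟨hf, fun a l => ?_⟩, hfδ⟩
  let u : Module.Dual Fq A →ₗ[Fq] V := f ∘ₗ (LinearMap.mulLeft Fq a).dualMap + (-a) • f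
  have hu : IsDualContinuous u := (hf.comp_dualMap _).add (hf.smul _)
  have h0 : u = 0 := hu.eq_zero B fun ⟨n, i⟩ => by
    change f ((LinearMap.mulLeft Fq a).dualMap (B.coord (n, i))) + (-a) • f (B.coord (n, i)) = 0
    rw [hB, ← AlgDual.coeffDual_smul, hfδ, hfδ, map_smul, neg_smul]
    exact add_neg_cancel _
  have := LinearMap.congr_fun h0 l
  change f ((LinearMap.mulLeft Fq a).dualMap l) + (-a) • f l = 0 at this
  rwa [neg_smul, add_neg_eq_zero] at this

end Construction

/-! ### Torsion points as values of special functions -/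

namespace AndersonModule

variable {Fq A K C : Type*} [Field Fq] [Finite Fq] [CommRing A] [IsDedekindDomain A]
  [Field K] [NormedField C] [Algebra Fq A] [Algebra A K] [Algebra Fq K] [IsScalarTower Fq A K]
  [IsFractionRing A K] [Algebra K C] [Algebra Fq C] [IsScalarTower Fq K C]
  {Oinf : ValuationSubring K} {L : IntermediateField K C}

omit [Finite Fq] in
/-- A functional generating the dual of the residue field has the prime as annihilator. -/
theorem _root_.mem_of_forall_mul_eq_zero {v : HeightOneSpectrum A} {l₀ : Module.Dual Fq A}
    (hl₀ : ∀ x ∈ v.asIdeal, l₀ x = 0)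
    (hgen : ∀ l : Module.Dual Fq A, (∀ x ∈ v.asIdeal, l x = 0) → ∃ u, ∀ x, l x = l₀ (u * x))
    {u : A} (hu : ∀ x, l₀ (u * x) = 0) : u ∈ v.asIdeal := by
  by_contra hmem
  have hmax : v.asIdeal.IsMaximal := v.isMaximal
  obtain ⟨u', p, hp, hu'⟩ := hmax.exists_inv hmem
  have h0 : ∀ x, l₀ x = 0 := by
    intro x
    have : x = u * (u' * x) + p * x := by linear_combination (-x) * hu'
    rw [this, map_add, hu, hl₀ _ (v.asIdeal.mul_mem_right x hp), add_zero]
  have hne : (Ideal.Quotient.mk v.asIdeal 1) ≠ 0 := by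
    rw [Ne, Ideal.Quotient.eq_zero_iff_mem]
    exact fun h => hmax.ne_top ((Ideal.eq_top_iff_one _).2 h)
  refine hne ((Module.forall_dual_apply_eq_zero_iff Fq _).1 fun g => ?_)
  obtain ⟨w, hw⟩ := hgen (g ∘ₗ (Ideal.Quotient.mkₐ Fq v.asIdeal).toLinearMap) fun x hx => by
    have : Ideal.Quotient.mkₐ Fq v.asIdeal x = 0 := Ideal.Quotient.eq_zero_iff_mem.2 hx
    rw [LinearMap.comp_apply, AlgHom.toLinearMap_apply, this, map_zero]
  exact (hw 1).trans (h0 _)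

/-- Torsion points of a uniformizable module are values of special functions. -/
theorem IsUniformizable.exists_dualHom_apply_eq (hA : IsPuncturedCurve Fq A K Oinf)
    (hC : IsCompletedAlgClosure K C Oinf) {E : AndersonModule Fq A L} (hE : E.IsUniformizable)
    {v : HeightOneSpectrum A} {l₀ : Module.Dual Fq A}
    (hl₀ : ∀ x ∈ v.asIdeal, l₀ x = 0)
    (hgen : ∀ l : Module.Dual Fq A, (∀ x ∈ v.asIdeal, l x = 0) → ∃ u, ∀ x, l x = l₀ (u * x))
    {w : E.Points} (hw : ∀ x ∈ v.asIdeal, x • w = 0) :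
    ∃ f ∈ dualHom Fq A E.Points, f l₀ = w := by
  have := hC.ultrametric
  have := hC.complete
  obtain ⟨a, ha⟩ := v.intValuation_exists_uniformizer
  obtain ⟨hav, s, hs, hsx⟩ := exists_mem_and_forall_mul_mem_span v ha
  have ha0 : a ≠ 0 := by
    rintro rfl
    rw [map_zero] at ha
    exact WithZero.exp_ne_zero ha.symm
  have hainf := hA.notMem_of_mem_ideal v.isPrime.ne_top hav ha0
  have ha1 : 1 < ‖algebraMap K C (algebraMap A K a)‖ := by
    rwa [← not_le, hC.norm_le_one_iff]
  have htower : IsScalarTower Fq A E.Points := ⟨fun c x y => by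
    rw [Algebra.smul_def, mul_smul, hE.algebraMap_smul ha1]⟩
  let _ : Algebra Fq[X] A := (Polynomial.aeval a : Fq[X] →ₐ[Fq] A).toAlgebra
  have hX : algebraMap Fq[X] A Polynomial.X = a := Polynomial.aeval_X a
  have : IsScalarTower Fq Fq[X] A := IsScalarTower.of_algebraMap_eq fun c =>
    ((Polynomial.aeval a : Fq[X] →ₐ[Fq] A).commutes c).symm
  have : Module.Finite Fq[X] A := hA.finite_aeval hainf
  have : FaithfulSMul Fq[X] A :=
    (faithfulSMul_iff_algebraMap_injective _ _).2 (hA.aeval_injective hainf)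
  have : Module.IsTorsionFree Fq[X] A := inferInstance
  -- The constant coefficient of `δ` kills `aA` (it need not kill `𝔭`); after multiplication by `s`
  -- it kills `𝔭` and is therefore a multiple of `l₀`.
  have hmul : ∀ δ : AlgDual Fq[X] A, ∃ u : A, ∀ x, AlgDual.coeffDual 0 δ (s * x) = l₀ (u * x) := by
    intro δ
    refine hgen ((LinearMap.mulLeft Fq s).dualMap (AlgDual.coeffDual 0 δ)) fun x hx => ?_
    obtain ⟨y, hy⟩ := hsx x hx
    rw [LinearMap.dualMap_apply, LinearMap.mulLeft_apply, hy, ← hX]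
    have := LinearMap.congr_fun (AlgDual.coeffDual_X_smul_zero (Fq := Fq) (A := A) δ) y
    rwa [← _root_.algebraMap_smul A (Polynomial.X : Fq[X]) δ, AlgDual.coeffDual_smul] at this
  choose u hu using hmul
  have huw : ∀ u u' : A, (∀ x, l₀ (u * x) = l₀ (u' * x)) → u • w = u' • w := by
    intro u u' h
    rw [← sub_eq_zero, ← sub_smul]
    refine hw _ (mem_of_forall_mul_eq_zero hl₀ hgen fun x => ?_)
    rw [sub_mul, map_sub, h, sub_self]
  -- The multiplier `u δ` is unique only modulo `𝔭`, which annihilates `w`; so `δ ↦ u δ • w` is well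
  -- defined and linear.
  let g : AlgDual Fq[X] A →ₗ[A] Submodule.torsionBy A E.Points a :=
    { toFun := fun δ => ⟨u δ • w, by
        rw [Submodule.mem_torsionBy_iff, smul_comm, hw a hav, smul_zero]⟩
      map_add' := fun δ δ' => Subtype.ext (by
        change u (δ + δ') • w = u δ • w + u δ' • w
        rw [← add_smul]
        refine huw _ _ fun x => ?_
        rw [← hu, map_add, LinearMap.add_apply, hu, hu, add_mul, map_add])
      map_smul' := fun b δ => Subtype.ext (by
        change u (b • δ) • w = b • u δ • w
        rw [← mul_smul]
        refine huw _ _ fun x => ?_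
        rw [← hu, AlgDual.coeffDual_smul, LinearMap.dualMap_apply, LinearMap.mulLeft_apply,
          mul_left_comm, hu]
        ring_nf) }
  let π : nullDivisionSequences E.Points (algebraMap Fq[X] A Polynomial.X) →ₗ[A]
      Submodule.torsionBy A E.Points a :=
    { toFun := fun e => ⟨e.1 0, by rw [Submodule.mem_torsionBy_iff, ← hX]; exact e.2.2.1⟩
      map_add' := fun _ _ => rfl
      map_smul' := fun _ _ => rfl }
  have hπ : Function.Surjective π := by
    rintro ⟨e₀, he₀⟩
    obtain ⟨e, he0, hee, hlim⟩ := hE.exists_division_sequence ha1 e₀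
    exact ⟨⟨e, by rwa [hX], by rw [hX, he0]; exact he₀, hlim⟩, Subtype.ext he0⟩
  -- Uniformizability makes `π` surjective, and projectivity turns the pointwise choice of null
  -- sequences into an `A`-linear one.
  obtain ⟨G, hG⟩ := Module.projective_lifting_property π g hπ
  let c := Module.Free.chooseBasis Fq[X] A
  obtain ⟨f, hf, hfδ⟩ := exists_dualHom_coeffDual_eq (Fq := Fq) (V := E.Points) c G
  obtain ⟨δ, hδ⟩ := AlgDual.exists_coeffDual_zero_eq c (l := l₀) fun x => by
    rw [hX]; exact hl₀ _ (v.asIdeal.mul_mem_right x hav)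
  refine ⟨f, hf, ?_⟩
  rw [← hδ, hfδ]
  have h1 : (G δ).1 0 = u δ • w := congrArg Subtype.val (LinearMap.congr_fun hG δ)
  rw [h1]
  -- For this `δ` the multiplier satisfies `l₀(u δ x) = l₀(s x)`, and `s` is congruent to `1` modulo
  -- `𝔭`.
  refine (huw _ 1 fun x => ?_).trans (one_smul A w)
  rw [← hu, hδ, ← sub_eq_zero, ← map_sub, ← sub_mul]
  refine hl₀ _ (v.asIdeal.mul_mem_right x ?_)
  rw [← neg_sub]
  exact neg_mem hs

end AndersonModule

/-! ### Ranks and reductions -/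

/-- The rank of a finite torsion-free module is the dimension of its reduction. -/
theorem IsDedekindDomain.HeightOneSpectrum.finrank_eq_of_quotient_equiv {A M N : Type*} [CommRing A]
    [IsDedekindDomain A] [AddCommGroup M] [Module A M] [Module.Finite A M]
    [Module.IsTorsionFree A M] (v : HeightOneSpectrum A) [AddCommGroup N] [Module A N]
    [Module (A ⧸ v.asIdeal) N] [IsScalarTower A (A ⧸ v.asIdeal) N]
    (e : (M ⧸ (v.asIdeal • ⊤ : Submodule A M)) ≃ₗ[A] N) :
    Module.finrank A M = Module.finrank (A ⧸ v.asIdeal) N := by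
  have hmax : v.asIdeal.IsMaximal := v.isMaximal
  rw [← Ideal.finrank_fiber_eq_finrank v.asIdeal]
  let i : (A ⧸ v.asIdeal) ≃ₗ[A] v.asIdeal.ResidueField := LinearEquiv.ofBijective
    ((IsScalarTower.toAlgHom A (A ⧸ v.asIdeal) v.asIdeal.ResidueField).toLinearMap)
    v.asIdeal.bijective_algebraMap_quotient_residueField
  let j : N ≃ₗ[A] v.asIdeal.ResidueField ⊗[A] M := e.symm.trans
    ((TensorProduct.quotTensorEquivQuotSMul M v.asIdeal).symm.trans (i.rTensor M))
  have h := lift_rank_eq_of_equiv_equiv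
    (algebraMap (A ⧸ v.asIdeal) v.asIdeal.ResidueField) j.toAddEquiv
    v.asIdeal.bijective_algebraMap_quotient_residueField fun r x => ?_
  · rw [Module.finrank, Module.finrank, ← Cardinal.toNat_lift, ← h, Cardinal.toNat_lift]
  obtain ⟨a, rfl⟩ := Ideal.Quotient.mk_surjective r
  have h1 : Ideal.Quotient.mk v.asIdeal a • x = a • x := algebraMap_smul (A ⧸ v.asIdeal) a x
  have h2 : algebraMap (A ⧸ v.asIdeal) v.asIdeal.ResidueField (Ideal.Quotient.mk v.asIdeal a) =
      algebraMap A _ a := rfl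
  rw [h1, h2, algebraMap_smul]
  exact j.map_smul a x

/-- A pairing vanishing on the integers pairs the inverse of a uniformizer trivially with the
prime. -/
theorem apply_inv_eq_zero_of_mem {Fq A K : Type*} [Field Fq] [CommRing A] [IsDedekindDomain A]
    [Field K] [Algebra Fq A] [Algebra A K] [IsFractionRing A K] {v : HeightOneSpectrum A} {a : A}
    (ha : v.intValuation a = WithZero.exp (-1 : ℤ)) {Λ : v.adicCompletion K →+ Module.Dual Fq A}
    (h0 : ∀ r : v.adicCompletionIntegers K, Λ r = 0)
    (hmul : ∀ (x y : A) (z : v.adicCompletion K),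
      Λ (algebraMap A (v.adicCompletion K) x * z) y = Λ z (x * y)) {x : A} (hx : x ∈ v.asIdeal) :
    Λ (algebraMap A (v.adicCompletion K) a)⁻¹ x = 0 := by
  have h1 := (HeightOneSpectrum.algebraMap_mem_maximalIdeal_iff K v x).2 hx
  rw [HeightOneSpectrum.maximalIdeal_eq_span_of_intValuation_eq K v ha,
    Ideal.mem_span_singleton] at h1
  obtain ⟨r, hr⟩ := h1
  have h2 : algebraMap A (v.adicCompletion K) x = algebraMap A (v.adicCompletion K) a *
      (r : v.adicCompletion K) := congrArg Subtype.val hr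
  rw [← mul_one x, ← hmul, h2]
  by_cases h3 : algebraMap A (v.adicCompletion K) a = 0
  · rw [h3, zero_mul, zero_mul, map_zero]
    rfl
  · rw [mul_comm, ← mul_assoc, inv_mul_cancel₀ h3, one_mul, h0]
    rfl

section TorsionFree

variable {Fq A V : Type*} [Field Fq] [CommRing A] [IsDomain A] [Algebra Fq A] [AddCommGroup V]
  [TopologicalSpace V] [IsTopologicalAddGroup V] [Module Fq V] [Module A V] [SMulCommClass Fq A V]
  [ContinuousConstSMul A V]

instance : Module.IsTorsionFree A (dualHom Fq A V) := by
  refine .of_smul_eq_zero fun a f h => ?_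
  by_contra! hne
  refine hne.2 (Subtype.ext (LinearMap.ext fun l => ?_))
  obtain ⟨ρ, hρ⟩ := (LinearMap.mulLeft Fq a).exists_leftInverse_of_injective
    (LinearMap.ker_eq_bot.2 (mul_right_injective₀ hne.1))
  have h1 : (LinearMap.mulLeft Fq a).dualMap (ρ.dualMap l) = l :=
    LinearMap.ext fun x => congrArg l (LinearMap.congr_fun hρ x)
  rw [← h1, f.2.2]
  exact LinearMap.congr_fun (congrArg Subtype.val h) _

end TorsionFree

namespace AndersonModule

instance {Fq A K C : Type*} [Field Fq] [CommRing A] [Field K]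
    [NormedField C] [Algebra A K] [Algebra K C] [Algebra Fq C] {L : IntermediateField K C}
    (E : AndersonModule Fq A L) (I : Ideal A) : IsScalarTower A (A ⧸ I) (E.torsion I) :=
  inferInstanceAs (IsScalarTower A (A ⧸ I) (Submodule.torsionBySet A E.Points I))

variable {Fq A K C : Type*} [Field Fq] [Finite Fq] [CommRing A] [IsDedekindDomain A]
  [Field K] [NormedField C] [Algebra Fq A] [Algebra A K] [Algebra Fq K] [IsScalarTower Fq A K]
  [IsFractionRing A K] [Algebra K C] [Algebra Fq C] [IsScalarTower Fq K C]
  {Oinf : ValuationSubring K} {L : IntermediateField K C}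

omit [IsDedekindDomain A] [Algebra Fq A] [Algebra Fq K] [IsScalarTower Fq A K]
  [IsScalarTower Fq K C] in
theorem finite_torsion (E : AndersonModule Fq A L) {I : Ideal A} (hI : I ≠ ⊥) :
    Finite (E.torsion I) := by
  obtain ⟨a, ha, ha0⟩ := Submodule.exists_mem_ne_zero_of_ne_bot hI
  exact ((E.finite_setOf_smul_eq_zero ha0).subset
    fun x hx => (Submodule.mem_torsionBySet_iff _ _).1 hx ⟨a, ha⟩).to_subtype

theorem IsUniformizable.finrank_dualHom (hA : IsPuncturedCurve Fq A K Oinf)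
    (hC : IsCompletedAlgClosure K C Oinf) {E : AndersonModule Fq A L} (hE : E.IsUniformizable)
    [Module.Finite A (dualHom Fq A E.Points)]
    (v : HeightOneSpectrum A) : Module.finrank A (dualHom Fq A E.Points) = E.rankAt v := by
  have := hA.finiteType
  have hfin : Finite (A ⧸ v.asIdeal) := finite_quotient_of_finiteType Fq v.ne_bot
  obtain ⟨a, ha⟩ := v.intValuation_exists_uniformizer
  obtain ⟨-, Λ, -, hΛ0, hΛmul, hΛgen⟩ := exists_residue_pairing Fq K v ha
  set l₀ := Λ (algebraMap A (v.adicCompletion K) a)⁻¹ with hl₀_def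
  have hgen : ∀ l : Module.Dual Fq A, (∀ x ∈ v.asIdeal, l x = 0) → ∃ u, ∀ x, l x = l₀ (u * x) := by
    intro l hl
    obtain ⟨u, rfl⟩ := hΛgen l hl
    exact ⟨u, fun x => by rw [hΛmul]⟩
  have hl₀ : ∀ x ∈ v.asIdeal, l₀ x = 0 := fun x => apply_inv_eq_zero_of_mem ha hΛ0 hΛmul
  let ev : dualHom Fq A E.Points →ₗ[A] E.torsion v.asIdeal :=
    { toFun := fun f => ⟨f.1 l₀, (Submodule.mem_torsionBySet_iff _ _).2 fun x => by
        change (x : A) • f.1 l₀ = 0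
        rw [← f.2.2]
        have : (LinearMap.mulLeft Fq (x : A)).dualMap l₀ = 0 :=
          LinearMap.ext fun y => hl₀ _ (v.asIdeal.mul_mem_right y x.2)
        rw [this, map_zero]⟩
      map_add' := fun _ _ => rfl
      map_smul' := fun _ _ => rfl }
  -- Vanishing at `l₀` means vanishing at all functionals killing `𝔭`, since these are multiples of
  -- `l₀`.
  have hker : LinearMap.ker ev = v.asIdeal • ⊤ := by
    ext f
    refine ⟨fun hf => mem_smul_top_of_forall_eq_zero v f fun l hl => ?_, fun hf => ?_⟩
    · obtain ⟨u, hu⟩ := hgen l hl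
      have : l = (LinearMap.mulLeft Fq u).dualMap l₀ := LinearMap.ext hu
      rw [this, f.2.2, show f.1 l₀ = 0 from congrArg Subtype.val hf, smul_zero]
    · exact Subtype.ext (eq_zero_of_mem_smul_top hf hl₀)
  have hsurj : Function.Surjective ev := by
    rintro ⟨w, hw⟩
    obtain ⟨f, hf, hfw⟩ := hE.exists_dualHom_apply_eq hA hC hl₀ hgen (w := w)
      fun x hx => (Submodule.mem_torsionBySet_iff _ _).1 hw ⟨x, hx⟩
    exact ⟨⟨f, hf⟩, Subtype.ext hfw⟩
  exact v.finrank_eq_of_quotient_equiv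
    ((Submodule.quotEquivOfEq _ _ hker.symm).trans (ev.quotKerEquivOfSurjective hsurj))

end AndersonModule

/-! ### Nakayama arguments over complete and discrete valuation rings -/

section CompleteLocal

open IsLocalRing

variable {R : Type*} [CommRing R]

/-- Finite powers of a complete ring are complete. -/
theorem IsPrecomplete.pi_const (I : Ideal R) [IsPrecomplete I R] (ι : Type*) [Finite ι] :
    IsPrecomplete I (ι → R) := by
  classical
  have := Fintype.ofFinite ι
  have hmem : ∀ n (x : ι → R), x ∈ (I ^ n • ⊤ : Submodule R (ι → R)) ↔ ∀ i, x i ∈ I ^ n := by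
    refine fun n x => ⟨fun hx i => ?_, fun hx => ?_⟩
    · induction hx using Submodule.smul_induction_on' with
      | smul a ha y _ => exact (I ^ n).mul_mem_right _ ha
      | add y _ z _ hy hz => exact (I ^ n).add_mem hy hz
    · rw [← Finset.univ_sum_single x]
      refine Submodule.sum_mem _ fun i _ => ?_
      have : Pi.single i (x i) = x i • (Pi.single i 1 : ι → R) := by
        rw [← Pi.single_smul, smul_eq_mul, mul_one]
      rw [this]
      exact Submodule.smul_mem_smul (hx i) trivial
  refine ⟨fun f hf => ?_⟩
  have : ∀ i, ∃ L : R, ∀ n, f n i ≡ L [SMOD (I ^ n • ⊤ : Submodule R R)] := fun i =>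
    IsPrecomplete.prec' (fun n => f n i) fun {m n} hmn => by
      rw [SModEq.sub_mem, smul_eq_mul, Ideal.mul_top]
      exact (hmem m _).1 (SModEq.sub_mem.1 (hf hmn)) i
  choose L hL using this
  refine ⟨L, fun n => SModEq.sub_mem.2 ((hmem n _).2 fun i => ?_)⟩
  have := SModEq.sub_mem.1 (hL i n)
  rwa [smul_eq_mul, Ideal.mul_top] at this

/-- A separated module over a complete ring is finite if its reduction is covered by finitely many
elements. -/
theorem Module.Finite.of_isHausdorff_of_finite {M : Type*} [AddCommGroup M] [Module R M]
    (I : Ideal R) [IsPrecomplete I R] [IsHausdorff I M] {s : Set M} (hs : s.Finite)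
    (h : ∀ x, ∃ y ∈ s, x - y ∈ (I • ⊤ : Submodule R M)) : Module.Finite R M := by
  have := hs.fintype
  have := IsPrecomplete.pi_const I s
  refine Module.Finite.of_surjective (Fintype.linearCombination R (Subtype.val : s → M))
    (surjective_of_mkQ_comp_surjective (I := I) fun y => ?_)
  obtain ⟨x, rfl⟩ := Submodule.mkQ_surjective _ y
  obtain ⟨z, hz, hxz⟩ := h x
  classical
  refine ⟨Pi.single ⟨z, hz⟩ 1, ?_⟩
  rw [LinearMap.comp_apply, Fintype.linearCombination_apply_single, one_smul]
  exact ((Submodule.Quotient.eq _).2 hxz).symm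

variable [IsDomain R] [IsDiscreteValuationRing R] {ϖ : R} (hϖ : maximalIdeal R = Ideal.span {ϖ})
  {N T : Type*} [AddCommGroup N] [AddCommGroup T] [Module R N] [Module R T]
  [Module.Finite R N] [Module.Finite R T] {J : N →ₗ[R] T}
  (hT : ∀ x : T, ϖ • x = 0 → x = 0) (hJ : ∀ n x, J n = ϖ • x → ∃ n', n = ϖ • n')

include hϖ hT hJ

omit [Module.Finite R T] in
/-- A homomorphism into a torsion-free module that is injective modulo the maximal ideal is
injective. -/
theorem LinearMap.injective_of_forall_eq_smul : Function.Injective J := by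
  rw [← LinearMap.ker_eq_bot]
  -- The kernel equals `ϖ` times itself: an element of it is `ϖ n'`, and `J n'` vanishes because `T`
  -- has no `ϖ`-torsion.
  refine Submodule.eq_bot_of_le_smul_of_le_jacobson_bot (maximalIdeal R) _ (IsNoetherian.noetherian _)
    (fun n hn => ?_) (maximalIdeal_le_jacobson _)
  have h0 : J n = ϖ • (0 : T) := by rw [smul_zero]; exact hn
  obtain ⟨n', rfl⟩ := hJ n 0 h0
  refine Submodule.smul_mem_smul (hϖ ▸ Ideal.mem_span_singleton_self ϖ) (hT _ ?_)
  rw [← map_smul]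
  exact hn

omit [Module.Finite R N] in
/-- A homomorphism into a torsion-free module that is injective modulo the maximal ideal splits. -/
theorem LinearMap.exists_isCompl_range_of_forall_eq_smul :
    ∃ P : Submodule R T, IsCompl (LinearMap.range J) P := by
  have hstep : ∀ x, ϖ • x ∈ LinearMap.range J → x ∈ LinearMap.range J := by
    rintro x ⟨n, hn⟩
    obtain ⟨n', rfl⟩ := hJ n x hn
    rw [map_smul, ← sub_eq_zero, ← smul_sub] at hn
    exact ⟨n', sub_eq_zero.1 (hT _ hn)⟩
  have hpow : ∀ (k : ℕ) x, ϖ ^ k • x ∈ LinearMap.range J → x ∈ LinearMap.range J := by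
    intro k
    induction k with
    | zero => intro x hx; rwa [pow_zero, one_smul] at hx
    | succ k ih =>
      intro x hx
      rw [pow_succ', mul_smul] at hx
      exact ih _ (hstep _ hx)
  have hirr : Irreducible ϖ := (IsDiscreteValuationRing.irreducible_iff_uniformizer _).2 hϖ
  -- Every nonzero scalar is a unit times a power of `ϖ`. The quotient is then finite and
  -- torsion-free, hence projective, which yields the section `s`.
  have : Module.IsTorsionFree R (T ⧸ LinearMap.range J) := by
    refine .of_smul_eq_zero fun r y h => ?_
    by_contra! hne
    refine hne.2 ?_
    obtain ⟨x, rfl⟩ := Submodule.Quotient.mk_surjective _ y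
    obtain ⟨k, u, rfl⟩ := IsDiscreteValuationRing.eq_unit_mul_pow_irreducible hne.1 hirr
    rw [← Submodule.Quotient.mk_smul, Submodule.Quotient.mk_eq_zero, mul_smul] at h
    rw [Submodule.Quotient.mk_eq_zero]
    refine hpow k x ?_
    have := (LinearMap.range J).smul_mem (u⁻¹ : Rˣ) h
    rwa [smul_smul, Units.inv_mul, one_smul] at this
  obtain ⟨s, hs⟩ := Module.projective_lifting_property (LinearMap.range J).mkQ LinearMap.id
    (Submodule.mkQ_surjective _)
  let f : T →ₗ[R] LinearMap.range J := (LinearMap.id - s ∘ₗ (LinearMap.range J).mkQ).codRestrict _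
    fun x => by
      rw [← Submodule.Quotient.mk_eq_zero, ← Submodule.mkQ_apply, LinearMap.sub_apply, map_sub,
        LinearMap.comp_apply, ← LinearMap.comp_apply (LinearMap.range J).mkQ s, hs]
      exact sub_self _
  refine ⟨LinearMap.ker f, LinearMap.isCompl_of_proj fun x => Subtype.ext ?_⟩
  change x.1 - s ((LinearMap.range J).mkQ x.1) = x.1
  rw [Submodule.mkQ_apply, (Submodule.Quotient.mk_eq_zero _).2 x.2, map_zero, sub_zero]

omit [IsDomain R] [IsDiscreteValuationRing R] [Module.Finite R N] hϖ hT hJ in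
theorem LinearMap.surjective_of_forall_sub_eq_smul [IsLocalRing R] {ϖ : R}
    (hϖ : maximalIdeal R = Ideal.span {ϖ}) (h : ∀ x : T, ∃ n y, x - J n = ϖ • y) :
    Function.Surjective J := by
  rw [← LinearMap.range_eq_top, eq_top_iff]
  refine Submodule.le_of_le_smul_of_le_jacobson_bot (I := maximalIdeal R) Module.Finite.fg_top
    (maximalIdeal_le_jacobson _) fun x _ => ?_
  obtain ⟨n, y, hxy⟩ := h x
  rw [← add_sub_cancel (J n) x, hxy]
  exact Submodule.add_mem_sup ⟨n, rfl⟩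
    (Submodule.smul_mem_smul (hϖ ▸ Ideal.mem_span_singleton_self ϖ) trivial)

end CompleteLocal

/-! ### The Tate module -/

namespace AndersonModule

section Tate

variable {Fq A K C : Type*} [Field Fq] [CommRing A] [IsDedekindDomain A] [Field K]
  [NormedField C] [Algebra A K] [IsFractionRing A K] [Algebra K C] [Algebra Fq C]
  {L : IntermediateField K C} {E : AndersonModule Fq A L} {v : HeightOneSpectrum A}

noncomputable instance : Module A (E.TateModule v) :=
  Module.compHom _ (algebraMap A (v.adicCompletionIntegers K))

instance : IsScalarTower A (v.adicCompletionIntegers K) (E.TateModule v) :=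
  IsScalarTower.of_algebraMap_smul fun _ _ => rfl

namespace TateModule

/-- The value at the class of an element of the completion. -/
noncomputable def eval (F : E.TateModule v) (y : v.adicCompletion K) : E.Points :=
  F (Submodule.Quotient.mk y)

theorem ext_eval {F F' : E.TateModule v} (h : ∀ y, F.eval y = F'.eval y) : F = F' :=
  DFunLike.ext _ _ fun x => by
    obtain ⟨y, rfl⟩ := Submodule.Quotient.mk_surjective _ x
    exact h y

theorem eval_sub (F F' : E.TateModule v) (y : v.adicCompletion K) :
    (F - F').eval y = F.eval y - F'.eval y := rfl

theorem eval_smul (r : v.adicCompletionIntegers K) (F : E.TateModule v) (y : v.adicCompletion K) :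
    (r • F).eval y = F.eval (r * y) := rfl

theorem eval_add_arg (F : E.TateModule v) (y y' : v.adicCompletion K) :
    F.eval (y + y') = F.eval y + F.eval y' :=
  LinearMap.map_add (M := LocalQuotient K v) (M₃ := E.Points) (R := A) F (Submodule.Quotient.mk y)
    (Submodule.Quotient.mk y')

theorem eval_algebraMap_mul (F : E.TateModule v) (x : A) (y : v.adicCompletion K) :
    F.eval (algebraMap A (v.adicCompletion K) x * y) = x • F.eval y := by
  have := LinearMap.map_smul (M := LocalQuotient K v) (M₂ := E.Points) (R := A) F x
    (Submodule.Quotient.mk y)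
  rw [← Submodule.Quotient.mk_smul, Algebra.smul_def] at this
  exact this

theorem eval_integer (F : E.TateModule v) (r : v.adicCompletionIntegers K) :
    F.eval r = 0 := by
  have : (Submodule.Quotient.mk (r : v.adicCompletion K) : LocalQuotient K v) = 0 :=
    (Submodule.Quotient.mk_eq_zero _).2 ⟨r, rfl⟩
  rw [eval, this]
  exact LinearMap.map_zero (M := LocalQuotient K v) (M₃ := E.Points) (R := A) F

/-- An element of the Tate module from a function on the completion. -/
noncomputable def ofFun (F : v.adicCompletion K →+ E.Points)
    (hF : ∀ (x : A) y, F (algebraMap A (v.adicCompletion K) x * y) = x • F y)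
    (h0 : ∀ r : v.adicCompletionIntegers K, F r = 0) : E.TateModule v :=
  LinearMap.comp (M₂ := v.adicCompletion K ⧸ (LinearMap.range (Algebra.linearMap
      (v.adicCompletionIntegers K) (v.adicCompletion K))).restrictScalars A)
    (((LinearMap.range (Algebra.linearMap (v.adicCompletionIntegers K)
      (v.adicCompletion K))).restrictScalars A).liftQ
      { toFun := F, map_add' := F.map_add, map_smul' := fun x y => by
          rw [Algebra.smul_def]; exact hF x y } (by
        rintro _ ⟨r, rfl⟩
        exact h0 r))
    (Submodule.Quotient.restrictScalarsEquiv A _).symm.toLinearMap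

theorem eval_ofFun (F : v.adicCompletion K →+ E.Points) (hF h0) (y : v.adicCompletion K) :
    (ofFun (E := E) F hF h0).eval y = F y := rfl

section Uniformizer

variable {a : A} (ha : v.intValuation a = WithZero.exp (-1 : ℤ))

include ha

theorem _root_.algebraMap_uniformizer_ne_zero : algebraMap A (v.adicCompletion K) a ≠ 0 := by
  intro h0
  have h3 := HeightOneSpectrum.valued_algebraMap K v a
  rw [show ((algebraMap A (v.adicCompletionIntegers K) a : v.adicCompletionIntegers K) :
    v.adicCompletion K) = algebraMap A (v.adicCompletion K) a from rfl, h0, ha, map_zero] at h3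
  exact WithZero.exp_ne_zero h3.symm

theorem _root_.exists_eq_algebraMap_add (r : v.adicCompletionIntegers K) :
    ∃ (x : A) (s : v.adicCompletionIntegers K), r = algebraMap A _ x + algebraMap A _ a * s := by
  obtain ⟨x, hx⟩ := HeightOneSpectrum.exists_algebraMap_sub_mem_maximalIdeal K v r
  rw [HeightOneSpectrum.maximalIdeal_eq_span_of_intValuation_eq K v ha,
    Ideal.mem_span_singleton] at hx
  obtain ⟨s, hs⟩ := hx
  exact ⟨x, s, by rw [← hs]; ring⟩

theorem eq_zero_of_uniformizer_smul {F : E.TateModule v}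
    (hF : algebraMap A (v.adicCompletionIntegers K) a • F = 0) : F = 0 := by
  refine ext_eval fun y => ?_
  have h1 : (algebraMap A (v.adicCompletionIntegers K) a • F).eval
      ((algebraMap A (v.adicCompletion K) a)⁻¹ * y) = (0 : E.TateModule v).eval
      ((algebraMap A (v.adicCompletion K) a)⁻¹ * y) := by rw [hF]
  rw [eval_smul] at h1
  change F.eval (algebraMap A (v.adicCompletion K) a * _) = _ at h1
  rwa [mul_inv_cancel_left₀ (algebraMap_uniformizer_ne_zero ha)] at h1

/-- The quotient is `y ↦ F(y/a)`. It vanishes on the integers because `r/a` is an `A`-multiple of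
`1/a` plus an integer. -/
theorem exists_eq_uniformizer_smul {F : E.TateModule v}
    (hF : F.eval (algebraMap A (v.adicCompletion K) a)⁻¹ = 0) :
    ∃ F', F = algebraMap A (v.adicCompletionIntegers K) a • F' := by
  have hne : algebraMap A (v.adicCompletion K) a ≠ 0 := algebraMap_uniformizer_ne_zero ha
  refine ⟨ofFun
    { toFun := fun y => F.eval ((algebraMap A (v.adicCompletion K) a)⁻¹ * y)
      map_zero' := by
        rw [mul_zero]
        exact F.eval_integer 0
      map_add' := fun y y' => by rw [mul_add, eval_add_arg] }
    (fun x y => ?_) fun r => ?_, ext_eval fun y => ?_⟩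
  · change F.eval _ = x • F.eval _
    rw [← eval_algebraMap_mul, mul_left_comm]
  · change F.eval _ = 0
    obtain ⟨x, s, rfl⟩ := exists_eq_algebraMap_add ha r
    have : (algebraMap A (v.adicCompletion K) a)⁻¹ *
        ((algebraMap A (v.adicCompletionIntegers K) x + algebraMap A _ a * s :
          v.adicCompletionIntegers K) : v.adicCompletion K) =
        algebraMap A (v.adicCompletion K) x * (algebraMap A (v.adicCompletion K) a)⁻¹ + s := by
      change _ * (algebraMap A (v.adicCompletion K) x + algebraMap A (v.adicCompletion K) a * s) = _
      field_simp
    rw [this, eval_add_arg, eval_algebraMap_mul, hF, smul_zero, eval_integer, add_zero]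
  · rw [eval_smul, eval_ofFun]
    change _ = F.eval (_ * (algebraMap A (v.adicCompletion K) a * y))
    rw [inv_mul_cancel_left₀ hne]

theorem smul_eval_inv_eq_zero (F : E.TateModule v) {x : A} (hx : x ∈ v.asIdeal) :
    x • F.eval (algebraMap A (v.adicCompletion K) a)⁻¹ = 0 := by
  have h1 := (HeightOneSpectrum.algebraMap_mem_maximalIdeal_iff K v x).2 hx
  rw [HeightOneSpectrum.maximalIdeal_eq_span_of_intValuation_eq K v ha,
    Ideal.mem_span_singleton] at h1
  obtain ⟨r, hr⟩ := h1
  have h2 : algebraMap A (v.adicCompletion K) x = algebraMap A (v.adicCompletion K) a *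
      (r : v.adicCompletion K) := congrArg Subtype.val hr
  rw [← eval_algebraMap_mul, h2, mul_right_comm,
    mul_inv_cancel₀ (algebraMap_uniformizer_ne_zero ha), one_mul, eval_integer]

theorem exists_uniformizer_pow_mul_eq (y : v.adicCompletion K) :
    ∃ (n : ℕ) (r : v.adicCompletionIntegers K),
      algebraMap A (v.adicCompletion K) a ^ n * y = r := by
  obtain ⟨r, s, hs, rfl⟩ := IsFractionRing.div_surjective (A := v.adicCompletionIntegers K) y
  have hs0 := nonZeroDivisors.ne_zero hs
  have hirr : Irreducible (algebraMap A (v.adicCompletionIntegers K) a) :=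
    (IsDiscreteValuationRing.irreducible_iff_uniformizer _).2
      (HeightOneSpectrum.maximalIdeal_eq_span_of_intValuation_eq K v ha)
  obtain ⟨n, u, hu⟩ := IsDiscreteValuationRing.eq_unit_mul_pow_irreducible hs0 hirr
  refine ⟨n, r * (u⁻¹ : (v.adicCompletionIntegers K)ˣ), ?_⟩
  have hu' : algebraMap _ (v.adicCompletion K) ((u⁻¹ : (v.adicCompletionIntegers K)ˣ) :
      v.adicCompletionIntegers K) * algebraMap _ (v.adicCompletion K) s =
      algebraMap A (v.adicCompletion K) a ^ n := by
    rw [← map_mul, hu, Units.inv_mul_cancel_left, map_pow]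
    rfl
  have hs1 : algebraMap _ (v.adicCompletion K) s ≠ 0 :=
    fun h => hs0 (FaithfulSMul.algebraMap_injective _ (v.adicCompletion K) (by rw [h, map_zero]))
  have hcoe : ((r * (u⁻¹ : (v.adicCompletionIntegers K)ˣ) : v.adicCompletionIntegers K) :
      v.adicCompletion K) = algebraMap (v.adicCompletionIntegers K) (v.adicCompletion K)
        (r * (u⁻¹ : (v.adicCompletionIntegers K)ˣ)) := rfl
  rw [hcoe, map_mul, ← hu']
  field_simp

/-- Each element of `K_𝔭` becomes integral after multiplication by a power of `a`, so multiples of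
that power vanish on it. -/
theorem isHausdorff : IsHausdorff (IsLocalRing.maximalIdeal (v.adicCompletionIntegers K))
    (E.TateModule v) := by
  refine ⟨fun F hF => ext_eval fun y => ?_⟩
  obtain ⟨n, r, hr⟩ := exists_uniformizer_pow_mul_eq ha y
  have hpow : ∀ G ∈ (IsLocalRing.maximalIdeal (v.adicCompletionIntegers K) ^ n • ⊤ :
      Submodule (v.adicCompletionIntegers K) (E.TateModule v)), G.eval y = 0 := by
    intro G hG
    induction hG using Submodule.smul_induction_on' with
    | smul t ht G _ =>
      rw [HeightOneSpectrum.maximalIdeal_eq_span_of_intValuation_eq K v ha,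
        Ideal.span_singleton_pow, Ideal.mem_span_singleton] at ht
      obtain ⟨s, rfl⟩ := ht
      have : ((algebraMap A (v.adicCompletionIntegers K) a ^ n * s :
          v.adicCompletionIntegers K) : v.adicCompletion K) * y =
          ((s * r : v.adicCompletionIntegers K) : v.adicCompletion K) := by
        change algebraMap A (v.adicCompletion K) a ^ n * s * y = s * r
        rw [← hr]
        ring
      rw [eval_smul, this, eval_integer]
    | add G _ G' _ h h' =>
      change G.eval y + G'.eval y = 0
      rw [h, h', add_zero]
  exact hpow F (SModEq.zero.1 (hF n))

/-- Evaluation at `1/a` separates classes modulo `a` and takes values in the finite set of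
`a`-torsion points; completeness of `A_𝔭` does the rest. -/
theorem finite [Finite Fq] : Module.Finite (v.adicCompletionIntegers K) (E.TateModule v) := by
  have := isHausdorff (E := E) ha
  have ha0 : a ≠ 0 := fun h => algebraMap_uniformizer_ne_zero (K := K) ha (by rw [h, map_zero])
  have ha' : a ∈ v.asIdeal := (exists_mem_and_forall_mul_mem_span v ha).1
  let e : E.TateModule v → E.Points := fun F => F.eval (algebraMap A (v.adicCompletion K) a)⁻¹
  have hfin : (Set.range e).Finite := (E.finite_setOf_smul_eq_zero ha0).subset (by
    rintro _ ⟨F, rfl⟩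
    exact smul_eval_inv_eq_zero ha F ha')
  choose! σ hσ using fun y (hy : y ∈ Set.range e) => hy
  refine Module.Finite.of_isHausdorff_of_finite
    (IsLocalRing.maximalIdeal (v.adicCompletionIntegers K)) (hfin.image σ) fun F =>
    ⟨σ (e F), ⟨e F, ⟨F, rfl⟩, rfl⟩, ?_⟩
  obtain ⟨F', hF'⟩ := exists_eq_uniformizer_smul ha (F := F - σ (e F)) (by
    rw [eval_sub, sub_eq_zero]
    exact (hσ _ ⟨F, rfl⟩).symm)
  rw [hF']
  refine Submodule.smul_mem_smul ?_ trivial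
  exact (HeightOneSpectrum.algebraMap_mem_maximalIdeal_iff K v a).2 ha'

end Uniformizer

end TateModule

end Tate

end AndersonModule

/-! ### The comparison map -/

section Reduction

variable {A R M S : Type*} [CommRing A] [CommRing R] [Algebra A R] [AddCommGroup M] [Module A M]
  [Module R M] [IsScalarTower A R M] [AddCommGroup S] [Module A S] {ϖ : R}

/-- Modulo `ϖ`, the base change of `S` is generated by `S`. -/
theorem TensorProduct.exists_eq_tmul_add_smul (hϖ : ∀ r : R, ∃ x s, r = algebraMap A R x + ϖ * s)
    (G : M ≃ₗ[R] R) (n : M ⊗[A] S) : ∃ h n', n = G.symm 1 ⊗ₜ h + ϖ • n' := by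
  induction n using TensorProduct.induction_on with
  | zero => exact ⟨0, 0, by rw [TensorProduct.tmul_zero, smul_zero, add_zero]⟩
  | tmul ω h =>
    obtain ⟨x, s, hs⟩ := hϖ (G ω)
    have hω : ω = x • G.symm 1 + ϖ • s • G.symm 1 := by
      rw [← algebraMap_smul R x, ← map_smul, ← map_smul, ← map_smul, ← map_add,
        LinearEquiv.eq_symm_apply, hs]
      simp only [smul_eq_mul, mul_one]
    refine ⟨x • h, (s • G.symm 1) ⊗ₜ h, ?_⟩
    conv_lhs => rw [hω]
    rw [TensorProduct.add_tmul, TensorProduct.smul_tmul, TensorProduct.smul_tmul']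
  | add n n' hn hn' =>
    obtain ⟨h, m, rfl⟩ := hn
    obtain ⟨h', m', rfl⟩ := hn'
    refine ⟨h + h', m + m', ?_⟩
    rw [TensorProduct.tmul_add, smul_add]
    abel

theorem TensorProduct.exists_tmul_eq_smul {I : Ideal A}
    (hI : ∀ x ∈ I, ∃ r, algebraMap A R x = ϖ * r) (m : M) {h : S}
    (hh : h ∈ (I • ⊤ : Submodule A S)) : ∃ n : M ⊗[A] S, m ⊗ₜ h = ϖ • n := by
  induction hh using Submodule.smul_induction_on' with
  | smul x hx h _ =>
    obtain ⟨r, hr⟩ := hI x hx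
    refine ⟨(r • m) ⊗ₜ h, ?_⟩
    rw [← TensorProduct.smul_tmul, TensorProduct.smul_tmul', smul_smul, ← hr, algebraMap_smul]
  | add h _ h' _ hh hh' =>
    obtain ⟨n, hn⟩ := hh
    obtain ⟨n', hn'⟩ := hh'
    exact ⟨n + n', by rw [TensorProduct.tmul_add, hn, hn', smul_add]⟩

end Reduction

namespace AndersonModule

theorem sfEquiv_sfMap {Fq A K C ι : Type*} [Field Fq] [Finite Fq] [CommRing A] [Field K]
    [NormedField C] [CompleteSpace C] [IsUltrametricDist C] [Algebra Fq A] [Algebra A K]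
    [Algebra K C] [Algebra Fq C] {L : IntermediateField K C} {E E' : AndersonModule Fq A L}
    (f : E.Hom E') (b : Module.Basis ι Fq A) (h : E.sf b) (l : Module.Dual Fq A) :
    (E'.sfEquiv b (f.sfMap b h)).1 l = f.toLinearMap ((E.sfEquiv b h).1 l) := by
  refine (E'.sfEquiv_hasSum b _ l).unique ?_
  have := (E.sfEquiv_hasSum b h l).map f.toLinearMap f.continuous
  simpa [Function.comp_def, Hom.sfMap] using this

section

variable {Fq A K C : Type*} [Field Fq] [CommRing A] [IsDedekindDomain A] [Field K]
  [NormedField C] [Algebra Fq A] [Algebra A K] [IsFractionRing A K] [Algebra K C] [Algebra Fq C]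
  {L : IntermediateField K C} {v : HeightOneSpectrum A} [Finite Fq]
  {Λ : v.adicCompletion K →+ Module.Dual Fq A}

/-- The element of the Tate module given by a special function and the coordinate of a
differential. -/
noncomputable def tatePairing (E : AndersonModule Fq A L)
    (h0 : ∀ r : v.adicCompletionIntegers K, Λ r = 0)
    (hmul : ∀ (x y : A) (z : v.adicCompletion K),
      Λ (algebraMap A (v.adicCompletion K) x * z) y = Λ z (x * y))
    (g : v.adicCompletionIntegers K) (f : dualHom Fq A E.Points) : E.TateModule v :=
  TateModule.ofFun
    { toFun := fun y => f.1 (Λ (y * g))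
      map_zero' := by rw [zero_mul, map_zero, map_zero]
      map_add' := fun y y' => by rw [add_mul, map_add, map_add] }
    (fun x y => by
      change f.1 (Λ (_ * y * g)) = x • f.1 (Λ (y * g))
      rw [← f.2.2, mul_assoc]
      exact congrArg f.1 (LinearMap.ext fun z => hmul x z _))
    (fun r => by
      change f.1 (Λ ((r * g : v.adicCompletionIntegers K) : v.adicCompletion K)) = 0
      rw [h0, map_zero])

variable (E : AndersonModule Fq A L) (h0 : ∀ r : v.adicCompletionIntegers K, Λ r = 0)
  (hmul : ∀ (x y : A) (z : v.adicCompletion K),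
      Λ (algebraMap A (v.adicCompletion K) x * z) y = Λ z (x * y))

variable [CompleteSpace C] [IsUltrametricDist C] {M : Type*} [AddCommGroup M] [Module A M]
  [Module (v.adicCompletionIntegers K) M] [IsScalarTower A (v.adicCompletionIntegers K) M]
  {ι : Type*} (b : Module.Basis ι Fq A)

/-- The comparison map from special functions to the Tate module, in terms of a coordinate on the
differentials. -/
noncomputable def tateMap
    (G : M →ₗ[v.adicCompletionIntegers K] v.adicCompletionIntegers K) :
    (M ⊗[A] E.sf b) →ₗ[v.adicCompletionIntegers K] E.TateModule v :=
  TensorProduct.AlgebraTensorModule.lift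
    { toFun := fun ω =>
        { toFun := fun h => E.tatePairing h0 hmul (G ω) (E.sfEquiv b h)
          map_add' := fun h h' => TateModule.ext_eval fun y => by
            rw [map_add]; rfl
          map_smul' := fun x h => TateModule.ext_eval fun y => by
            rw [map_smul]
            exact (TateModule.eval_algebraMap_mul
              (E.tatePairing h0 hmul (G ω) (E.sfEquiv b h)) x y).symm }
      map_add' := fun ω ω' => LinearMap.ext fun h => TateModule.ext_eval fun y => by
        change (E.sfEquiv b h).1 (Λ (y * (G (ω + ω') : v.adicCompletionIntegers K))) =
          (E.sfEquiv b h).1 (Λ (y * (G ω : v.adicCompletionIntegers K))) +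
          (E.sfEquiv b h).1 (Λ (y * (G ω' : v.adicCompletionIntegers K)))
        rw [← map_add, ← map_add, ← mul_add, map_add]
        rfl
      map_smul' := fun r ω => LinearMap.ext fun h => TateModule.ext_eval fun y => by
        change (E.sfEquiv b h).1 (Λ (y * (G (r • ω) : v.adicCompletionIntegers K))) =
          (E.sfEquiv b h).1 (Λ (r * y * (G ω : v.adicCompletionIntegers K)))
        rw [map_smul, mul_comm (r : v.adicCompletion K), mul_assoc]
        rfl }

variable (G : M ≃ₗ[v.adicCompletionIntegers K] v.adicCompletionIntegers K)

theorem eval_tateMap_tmul (ω : M) (h : E.sf b) (y : v.adicCompletion K) :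
    (E.tateMap h0 hmul b G.toLinearMap (ω ⊗ₜ h)).eval y =
      (E.sfEquiv b h).1 (Λ (y * (G ω : v.adicCompletionIntegers K))) := rfl

variable {a : A} (ha : v.intValuation a = WithZero.exp (-1 : ℤ))

variable (hgen : ∀ l : Module.Dual Fq A, (∀ x ∈ v.asIdeal, l x = 0) → ∃ u : A,
    l = Λ (algebraMap A (v.adicCompletion K) u * (algebraMap A (v.adicCompletion K) a)⁻¹))

-- Injectivity modulo the maximal ideal. Modulo `a` an element is `G⁻¹(1) ⊗ h`, and its image at
-- `1/a` is the value of `h` at `Λ(1/a)`. If this vanishes, `h` lies in `𝔭 sf(E)`.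
include ha hgen in
theorem exists_eq_smul_of_tateMap_eq_smul (n : M ⊗[A] E.sf b)
    {F : E.TateModule v} (hn : E.tateMap h0 hmul b G.toLinearMap n =
      algebraMap A (v.adicCompletionIntegers K) a • F) :
    ∃ n', n = algebraMap A (v.adicCompletionIntegers K) a • n' := by
  obtain ⟨h, n', rfl⟩ := TensorProduct.exists_eq_tmul_add_smul
    (exists_eq_algebraMap_add (K := K) ha) G n
  rw [map_add, map_smul, ← eq_sub_iff_add_eq, ← smul_sub] at hn
  -- A multiple of `a` takes at `1/a` the value of an element of the Tate module at `1`, which is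
  -- integral.
  have h1 : (E.sfEquiv b h).1 (Λ (algebraMap A (v.adicCompletion K) a)⁻¹) = 0 := by
    have h2 := E.eval_tateMap_tmul h0 hmul b G (G.symm 1) h (algebraMap A (v.adicCompletion K) a)⁻¹
    rw [hn, LinearEquiv.apply_symm_apply, TateModule.eval_smul] at h2
    change TateModule.eval _ (algebraMap A (v.adicCompletion K) a * _) =
      (E.sfEquiv b h).1 (Λ (_ * 1)) at h2
    rw [mul_inv_cancel₀ (algebraMap_uniformizer_ne_zero ha), mul_one] at h2
    exact h2.symm.trans (TateModule.eval_integer _ 1)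
  have h3 : E.sfEquiv b h ∈ (v.asIdeal • ⊤ : Submodule A (dualHom Fq A E.Points)) := by
    refine mem_smul_top_of_forall_eq_zero v _ fun l hl => ?_
    obtain ⟨u, rfl⟩ := hgen l hl
    have : Λ (algebraMap A (v.adicCompletion K) u * (algebraMap A (v.adicCompletion K) a)⁻¹) =
        (LinearMap.mulLeft Fq u).dualMap (Λ (algebraMap A (v.adicCompletion K) a)⁻¹) :=
      LinearMap.ext fun y => hmul _ _ _
    rw [this, (E.sfEquiv b h).2.2, h1, smul_zero]
  have h4 : h ∈ (v.asIdeal • ⊤ : Submodule A (E.sf b)) := by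
    have := Submodule.mem_map_of_mem (f := (E.sfEquiv b).symm.toLinearMap) h3
    rw [Submodule.map_smul'', Submodule.map_top, LinearEquiv.range] at this
    simpa using this
  obtain ⟨m, hm⟩ := TensorProduct.exists_tmul_eq_smul
    (ϖ := algebraMap A (v.adicCompletionIntegers K) a) (I := v.asIdeal) (fun x hx => by
      have h5 := (HeightOneSpectrum.algebraMap_mem_maximalIdeal_iff K v x).2 hx
      rwa [HeightOneSpectrum.maximalIdeal_eq_span_of_intValuation_eq K v ha,
        Ideal.mem_span_singleton] at h5) (G.symm 1) h4
  exact ⟨m + n', by rw [hm, smul_add]⟩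

end

end AndersonModule

namespace AndersonModule

variable {Fq A K C : Type*} [Field Fq] [Finite Fq] [CommRing A] [IsDedekindDomain A]
  [Field K] [NormedField C] [CompleteSpace C] [IsUltrametricDist C] [Algebra Fq A] [Algebra A K]
  [Algebra Fq K] [IsScalarTower Fq A K]
  [IsFractionRing A K] [Algebra K C] [Algebra Fq C] [IsScalarTower Fq K C]
  {Oinf : ValuationSubring K} {L : IntermediateField K C} {v : HeightOneSpectrum A}
  {Λ : v.adicCompletion K →+ Module.Dual Fq A}
  {M : Type*} [AddCommGroup M] [Module A M]
  [Module (v.adicCompletionIntegers K) M] [IsScalarTower A (v.adicCompletionIntegers K) M]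
  {ι : Type*} {E : AndersonModule Fq A L} {h0 : ∀ r : v.adicCompletionIntegers K, Λ r = 0}
  {hmul : ∀ (x y : A) (z : v.adicCompletion K),
      Λ (algebraMap A (v.adicCompletion K) x * z) y = Λ z (x * y)}
  {b : Module.Basis ι Fq A}
  {G : M ≃ₗ[v.adicCompletionIntegers K] v.adicCompletionIntegers K} {a : A}

omit [Algebra Fq K] [IsScalarTower Fq A K] [IsScalarTower Fq K C] in
theorem tateMap_injective_and_isCompl (ha : v.intValuation a = WithZero.exp (-1 : ℤ))
    (hgen : ∀ l : Module.Dual Fq A, (∀ x ∈ v.asIdeal, l x = 0) → ∃ u : A,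
      l = Λ (algebraMap A (v.adicCompletion K) u * (algebraMap A (v.adicCompletion K) a)⁻¹))
    [Module.Finite A (E.sf b)] :
    Function.Injective (E.tateMap h0 hmul b G.toLinearMap) ∧
      ∃ N : Submodule (v.adicCompletionIntegers K) (E.TateModule v),
        IsCompl (LinearMap.range (E.tateMap h0 hmul b G.toLinearMap)) N := by
  have hϖ := HeightOneSpectrum.maximalIdeal_eq_span_of_intValuation_eq K v ha
  have : Module.Finite (v.adicCompletionIntegers K) (M ⊗[A] E.sf b) :=
    Module.Finite.equiv
      (TensorProduct.AlgebraTensorModule.congr G.symm (LinearEquiv.refl A (E.sf b)))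
  have := TateModule.finite (E := E) (K := K) ha
  have hT := fun F : E.TateModule v => TateModule.eq_zero_of_uniformizer_smul (K := K) ha (F := F)
  have hJ := fun n (F : E.TateModule v) =>
    E.exists_eq_smul_of_tateMap_eq_smul h0 hmul b G ha hgen n (F := F)
  exact ⟨LinearMap.injective_of_forall_eq_smul hϖ hT hJ,
    LinearMap.exists_isCompl_range_of_forall_eq_smul hϖ hT hJ⟩

/-- The value `F(1/a)` is killed by `𝔭`, so some special function takes it at `Λ(1/a)`; subtracting
its image leaves a multiple of `a`. -/
theorem IsUniformizable.tateMap_surjective (hA : IsPuncturedCurve Fq A K Oinf)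
    (hC : IsCompletedAlgClosure K C Oinf) (hE : E.IsUniformizable)
    (ha : v.intValuation a = WithZero.exp (-1 : ℤ))
    (hgen : ∀ l : Module.Dual Fq A, (∀ x ∈ v.asIdeal, l x = 0) → ∃ u : A,
      l = Λ (algebraMap A (v.adicCompletion K) u * (algebraMap A (v.adicCompletion K) a)⁻¹)) :
    Function.Surjective (E.tateMap h0 hmul b G.toLinearMap) := by
  have hϖ := HeightOneSpectrum.maximalIdeal_eq_span_of_intValuation_eq K v ha
  have := TateModule.finite (E := E) (K := K) ha
  refine LinearMap.surjective_of_forall_sub_eq_smul hϖ fun F => ?_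
  obtain ⟨f, hf, hfF⟩ := hE.exists_dualHom_apply_eq hA hC
    (fun x => apply_inv_eq_zero_of_mem ha h0 hmul) (fun l hl => by
      obtain ⟨u, rfl⟩ := hgen l hl
      exact ⟨u, fun x => hmul _ _ _⟩)
    fun x hx => TateModule.smul_eval_inv_eq_zero (K := K) ha F hx
  refine ⟨G.symm 1 ⊗ₜ (E.sfEquiv b).symm ⟨f, hf⟩, TateModule.exists_eq_uniformizer_smul ha ?_⟩
  rw [TateModule.eval_sub, eval_tateMap_tmul, LinearEquiv.apply_symm_apply,
    LinearEquiv.apply_symm_apply, sub_eq_zero]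
  change _ = f (Λ (_ * 1))
  rw [mul_one, hfF]

end AndersonModule

theorem theoremA {Fq A K C : Type*} [Field Fq] [Finite Fq] [CommRing A] [IsDedekindDomain A]
    [Field K] [NormedField C] [Algebra Fq A] [Algebra A K] [Algebra Fq K] [IsScalarTower Fq A K]
    [IsFractionRing A K] [Algebra K C] [Algebra Fq C] [IsScalarTower Fq K C]
    (Oinf : ValuationSubring K) (hA : IsPuncturedCurve Fq A K Oinf)
    (hC : IsCompletedAlgClosure K C Oinf) (L : IntermediateField K C)
    {ι : Type*} (b : Module.Basis ι Fq A) (v : HeightOneSpectrum A) :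
    ∃ j : ∀ E : AndersonModule Fq A L,
        (ContDifferentials Fq K v ⊗[A] E.sf b) →ₗ[v.adicCompletionIntegers K] E.TateModule v,
      (∀ (E : AndersonModule Fq A L) (ω : ContDifferentials Fq K v) (h : E.sf b)
          (x : v.adicCompletion K),
          HasSum (fun i => Algebra.trace Fq (residueSubfield Fq K v)
              (residue Fq K v (x * algebraMap A (v.adicCompletion K) (b i)) ω) • h.1 i)
            (j E (ω ⊗ₜ[A] h) (Submodule.Quotient.mk x))) ∧
      (∀ (E E' : AndersonModule Fq A L) (f : E.Hom E') (ω : ContDifferentials Fq K v)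
          (h : E.sf b) (x : LocalQuotient K v),
          j E' (ω ⊗ₜ[A] f.sfMap b h) x = f.toLinearMap (j E (ω ⊗ₜ[A] h) x)) ∧
      ∀ E : AndersonModule Fq A L,
        Function.Injective (j E) ∧
        (∃ N : Submodule (v.adicCompletionIntegers K) (E.TateModule v),
          IsCompl (LinearMap.range (j E)) N) ∧
        (E.IsUniformizable →
          Function.Bijective (j E) ∧
          Module.Finite A (E.sf b) ∧
          (∀ w : HeightOneSpectrum A, Module.Finite (A ⧸ w.asIdeal) (E.torsion w.asIdeal) ∧
            Module.finrank A (E.sf b) = E.rankAt w) ∧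
          ∀ w w' : HeightOneSpectrum A, E.rankAt w = E.rankAt w') := by
  have := hC.complete
  have := hC.ultrametric
  have := hA.finiteType
  have : Finite (A ⧸ v.asIdeal) := finite_quotient_of_finiteType Fq v.ne_bot
  obtain ⟨a, ha⟩ := v.intValuation_exists_uniformizer
  have hav : a ∈ v.asIdeal := (exists_mem_and_forall_mul_mem_span v ha).1
  have ha0 : a ≠ 0 := by
    rintro rfl
    rw [map_zero] at ha
    exact WithZero.exp_ne_zero ha.symm
  -- The uniformizer itself has a pole at `∞`, as a nonzero element of a proper ideal, so it can
  -- serve as the expanding element in the proof of finite generation.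
  have hainf := hA.notMem_of_mem_ideal v.isPrime.ne_top hav ha0
  obtain ⟨G, Λ, hres, h0, hmul, hgen⟩ := exists_residue_pairing Fq K v ha
  refine ⟨fun E => E.tateMap h0 hmul b G.toLinearMap, fun E ω h x => ?_, fun E E' f ω h x => ?_,
    fun E => ?_⟩
  · simp only [hres]
    exact E.sfEquiv_hasSum b h _
  · obtain ⟨y, rfl⟩ := Submodule.Quotient.mk_surjective _ x
    exact AndersonModule.sfEquiv_sfMap f b h _
  have := E.finite_dualHom hA hC hainf
  have hfin : Module.Finite A (E.sf b) := Module.Finite.equiv (E.sfEquiv b).symm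
  obtain ⟨hinj, hcompl⟩ := AndersonModule.tateMap_injective_and_isCompl (E := E) (h0 := h0)
    (hmul := hmul) (b := b) (G := G) ha hgen
  refine ⟨hinj, hcompl, fun hE => ?_⟩
  have hrank : ∀ w : HeightOneSpectrum A, Module.finrank A (E.sf b) = E.rankAt w := fun w => by
    rw [(E.sfEquiv b).finrank_eq, hE.finrank_dualHom hA hC w]
  refine ⟨⟨hinj, hE.tateMap_surjective hA hC ha hgen⟩, hfin, fun w => ?_,
    fun w w' => (hrank w).symm.trans (hrank w')⟩
  have := E.finite_torsion w.ne_bot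
  exact ⟨Module.Finite.of_finite, hrank w⟩
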